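/- **Setting.** All powers are principal: $z^{k}=\exp(k\log z)$. Let $\frac12<k<1$ and $\nu>1$. For $d\in\mathbb R$, $\delta,\rho>0$ let $S_{d,\delta}=\{\tau\ne0:|d-\arg\tau|<\delta\}$, $D(0,\rho)=\{|\tau|<\rho\}$, $L_-=(-\rho,0]$, and $\Omega=S_{d,\delta}\cup(D(0,\rho)\setminus L_-)$. $F^{d}_{(\nu,\beta,\mu,k,\rho)}$ is the space of functions $h(\tau,m)$ that are continuous on $S_{d,\delta}\times\mathbb R$, holomorphic in $\tau$ on $S_{d,\delta}$, extend analytically in $\tau$ to $D(0,\rho)\setminus L_-$ for every $m\in\mathbb R$, and have finite norm $$\|h\|_{(\nu,\beta,\mu,k,\rho)}=\sup_{\tau\in\Omega,\,m\in\mathbb R}(1+|m|)^{\mu}\,\frac{1+|\tau|^{2k}}{|\tau|^{k}}\,e^{\beta|m|-\nu|\tau|^{k}}|h(\tau,m)| .$$ $E_{(\beta,\mu)}$ is the space of continuous $h:\mathbb R\to\mathbb C$ with $\|h\|_{(\beta,\mu)}=\sup_m(1+|m|)^\mu e^{\beta|m|}|h(m)|<\infty$. Integrals $\int_0^{\tau^k}$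 are along the segment. Put $$\mathcal C_k(w)(\tau,m)=\frac{\tau^k}{\Gamma(\frac1k-1)}\int_0^{\tau^k}(\tau^k-s)^{\frac1k-2}\,k\,w(s^{1/k},m)\,ds,\qquad \exp(-\kappa\,\mathcal C_k)w=\sum_{p\ge0}\frac{(-1)^p\kappa^p}{p!}\,\mathcal C_k^{(p)}w .$$ *The constant $K_1$.* Call $K_1>0$ admissible for $(k,\nu)$ if for all $d,\delta,\rho$ with $\delta,\rho>0$, $|d|+\delta\le\pi$, all $\beta,\kappa>0$, $\mu>1$, $C,C'>0$, and every $f$ continuous on $S_{d,\delta}\times\mathbb R$, holomorphic in $\tau$ on $S_{d,\delta}$ with analytic extension to $D(0,\rho)\setminus L_-$ for each $m$, such that $|f(\tau,m)|\le C|\tau|^ke^{\nu|\tau|^k}(1+|m|)^{-\mu}e^{-\beta|m|}$ on $S_{d,\delta}\times\mathbb R$ and $|f(\tau,m)|\le C'|\tau|^k(1+|m|)^{-\mu}e^{-\beta|m|}$ on $(D(0,\rho)\setminus L_-)\times\mathbb R$, one has on $S_{d,\delta}\times\mathbb R$ $$|(\exp(-\kappa\,\mathcal C_k)f)(\tau,m)|\le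 C|\tau|^k\exp\Big(\kappa K_1\tfrac{k}{\Gamma(\frac1k-1)}|\tau|^k\Big)e^{\nu|\tau|^k}(1+|m|)^{-\mu}e^{-\beta|m|}.$$ *Data.* Let $D\ge2$ be an integer and $\alpha_D>0$. For $1\le l\le D-1$ let $d_l,\delta_l,\Delta_l$ be non-negative integers and $\kappa_l>0$, with $\delta_1=1$, $\delta_l<\delta_{l+1}$ (for $l\le D-2$), $d_{l,k}:=d_l-\delta_l(k+1)>0$ and $\Delta_l-d_l+\delta_l\ge0$. Let $Q,Q_1,Q_2,R_1,\dots,R_D\in\mathbb C[X]$ with $\deg Q=\deg R_D\ge\deg R_l,\deg Q_1,\deg Q_2$, and $Q(im)\ne0$, $R_D(im)\neq0$ for all $m\in\mathbb R$. Let $\beta>0$, $\mu>\max(\deg Q_1+1,\deg Q_2+1)$, $\epsilon_0,K_0,T_0>0$. For $n\ge1$ let $F_n(\cdot,\epsilon)\in E_{(\beta,\mu)}$ depend analytically on $\epsilon\in D(0,\epsilon_0)$ with $\|F_n(\cdot,\epsilon)\|_{(\beta,\mu)}\le K_0T_0^{-n}$, and let $\psi(\tau,m,\epsilon)=\sum_{n\ge1}F_n(m,\epsilon)\tau^n/\Gamma(\frac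 nk)$. Assume $\nu>T_0^{-k}$. Let $I_l\subset\mathbb N$ be finite and, for $n\in I_l$, let $A_{l,n}$ be bounded and holomorphic on $D(0,\epsilon_0)$. Let $A_{\delta,p}$ be the real numbers with $T^{\delta(k+1)}\partial_T^\delta=(T^{k+1}\partial_T)^\delta+\sum_{1\le p\le\delta-1}A_{\delta,p}T^{k(\delta-p)}(T^{k+1}\partial_T)^p$. *Sector and disc.* Assume that for some $r_2>r_1>1$, $\eta>0$ and some direction $d_{Q,R_D}$, all the quotients $Q(im)/R_D(im)$, $m\in\mathbb R$, lie in $\{re^{i\theta}:r_1\le r\le r_2,\ |\theta-d_{Q,R_D}|\le\eta\}$. For $l\in\mathbb Z$ put $a_l(m)=\log\big|\frac{Q(im)}{R_D(im)}\big|+i\arg\frac{Q(im)}{R_D(im)}+2l\pi i$ and $\tau_l(m)=\big|\frac{a_l(m)}{\alpha_Dk}\big|^{1/k}e^{\frac ik\arg a_l(m)}$; these are the zeros of $H(\tau,m)=Q(im)-\exp(\alpha_Dk\tau^k)R_D(im)$. Let $d\in(-\frac\pi2,\frac\pi2)$, $0<\delta<\delta'$, $0<\rho<\rho'$ be such that $\tau_l(m)\notin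 S_{d,\delta'}\cup D(0,\rho')$ for all $l\in\mathbb Z$, $m\in\mathbb R$. Put $S_d=S_{d,\delta}$. *Equation.* For complex $c_{12},c_f,c_1,\dots,c_{D-1}$ consider, for $\tau\in\Omega$, $m\in\mathbb R$, $$\begin{aligned}Q(im)w(\tau,m,\epsilon)={}&\exp(\alpha_Dk\tau^k)R_D(im)w(\tau,m,\epsilon)+\sum_{l=1}^{D-1}\epsilon^{\Delta_l-d_l+\delta_l}R_l(im)\,c_l\sum_{n\in I_l}A_{l,n}(\epsilon)\\&\times\Big(\frac{\tau^k}{\Gamma(\frac{n+d_{l,k}}k)}\int_0^{\tau^k}(\tau^k-s)^{\frac{n+d_{l,k}}k-1}k^{\delta_l}s^{\delta_l}(\exp(-\kappa_l\mathcal C_k)w)(s^{1/k},m,\epsilon)\frac{ds}s\\&\quad+\sum_{1\le p\le\delta_l-1}A_{\delta_l,p}\frac{\tau^k}{\Gamma(\frac{n+d_{l,k}}k+\delta_l-p)}\int_0^{\tau^k}(\tau^k-s)^{\frac{n+d_{l,k}}k+\delta_l-p-1}k^ps^p(\exp(-\kappa_l\mathcal C_k)w)(s^{1/k},m,\epsilon)\frac{ds}s\Big)\\&+c_{12}\frac{\tau^k}{(2\pi)^{1/2}}\int_0^{\tau^k}\!\int_{-\infty}^{+\infty}Q_1(i(m-m_1))w((\tau^k-s)^{1/k},m-m_1,\epsilon)\,Q_2(im_1)w(s^{1/k},m_1,\epsilon)\frac{dm_1\,ds}{(\tau^k-s)s}+c_f\psi(\tau,m,\epsilon).\end{aligned}\tag{E}$$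 **Proposition.** There is an admissible $K_1$ for $(k,\nu)$. There are $A_{H,d},B_{H,d}>0$ with $$|H(\tau,m)|\ge A_{H,d}|Q(im)|\exp(B_{H,d}\alpha_D|\tau|^k)\qquad(\tau\in S_d,\ m\in\mathbb R).\tag{L}$$ For every admissible $K_1$ and all $A_{H,d},B_{H,d}>0$ satisfying (L): if $$B_{H,d}\,\alpha_D>\kappa_lK_1\frac{k}{\Gamma(\frac1k-1)}\qquad\text{for all }1\le l\le D-1,$$ then there is $c_0>0$ such that whenever $|c_{12}|,|c_f|,|c_1|,\dots,|c_{D-1}|\le c_0$ there is $\varpi>0$ such that, for every $\epsilon\in D(0,\epsilon_0)$, equation (E) has exactly one solution $w^d(\cdot,\cdot,\epsilon)$ in $F^d_{(\nu,\beta,\mu,k,\rho)}$ with $\|w^d(\cdot,\cdot,\epsilon)\|_{(\nu,\beta,\mu,k,\rho)}\le\varpi$. -/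

import Mathlib

open Set

/-! Complex powers `z ^ (k : ℂ)` are Mathlib's principal powers `exp (k * log z)`. -/

/-- The unbounded sector `S_{d,δ}` with vertex `0`, bisecting direction `d`, half-aperture `δ`. -/
def sector (d δ : ℝ) : Set ℂ := {τ | τ ≠ 0 ∧ |d - Complex.arg τ| < δ}

/-- The cut disc `D(0,ρ) \ (-ρ,0]`. -/
def cutDisc (ρ : ℝ) : Set ℂ := Metric.ball 0 ρ ∩ Complex.slitPlane

/-- The set `S_d ∪ (D(0,ρ) \ (-ρ,0])` on which the unknown function is considered. -/
def tauDomain (d δ ρ : ℝ) : Set ℂ := sector d δ ∪ cutDisc ρ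

/-- The integral `∫_0^z g(s) ds` along the segment `[0,z]`, parametrized by `s = u z`. -/
noncomputable def segInt (z : ℂ) (g : ℂ → ℂ) : ℂ :=
  ∫ u in (0 : ℝ)..1, g ((u : ℂ) * z) * z

/-! ### The Banach spaces -/

/-- The norm of `E_{(β,μ)}`. -/
noncomputable def normE (β μ : ℝ) (h : ℝ → ℂ) : ℝ :=
  ⨆ m : ℝ, (1 + |m|) ^ μ * Real.exp (β * |m|) * ‖h m‖

/-- Membership in `E_{(β,μ)}`: continuous functions with finite norm. -/
def MemE (β μ : ℝ) (h : ℝ → ℂ) : Prop :=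
  Continuous h ∧
    BddAbove (range fun m : ℝ => (1 + |m|) ^ μ * Real.exp (β * |m|) * ‖h m‖)

/-- The weighted modulus whose supremum is the norm of `F^d_{(ν,β,μ,k,ρ)}`. -/
noncomputable def weightedAbs (ν β μ k : ℝ) (h : ℂ → ℝ → ℂ) (τ : ℂ) (m : ℝ) : ℝ :=
  (1 + |m|) ^ μ * ((1 + ‖τ‖ ^ (2 * k)) / ‖τ‖ ^ k) *
    Real.exp (β * |m| - ν * ‖τ‖ ^ k) * ‖h τ m‖

/-- The norm of `F^d_{(ν,β,μ,k,ρ)}`, the sector being `S_{d,δ}`. -/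
noncomputable def normF (ν β μ k d δ ρ : ℝ) (h : ℂ → ℝ → ℂ) : ℝ :=
  ⨆ p : tauDomain d δ ρ × ℝ, weightedAbs ν β μ k h p.1 p.2

/-- Membership in `F^d_{(ν,β,μ,k,ρ)}`: continuous on `S_d × ℝ`, and for each `m` holomorphic in
`τ` on `S_d` with an analytic extension to the cut disc, with finite norm. A member is represented
by a total function, of which only the values on `tauDomain d δ ρ × ℝ` matter. -/
structure MemF (ν β μ k d δ ρ : ℝ) (h : ℂ → ℝ → ℂ) : Prop where
  continuousOn : ContinuousOn (fun p : ℂ × ℝ => h p.1 p.2) (sector d δ ×ˢ univ)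
  holomorphic : ∀ m : ℝ, DifferentiableOn ℂ (fun τ => h τ m) (tauDomain d δ ρ)
  bddAbove : BddAbove
    (range fun p : tauDomain d δ ρ × ℝ => weightedAbs ν β μ k h p.1 p.2)

/-! ### The operators -/

/-- The operator `C_k`. -/
noncomputable def opC (k : ℝ) (f : ℂ → ℝ → ℂ) (τ : ℂ) (m : ℝ) : ℂ :=
  τ ^ (k : ℂ) / (Real.Gamma (1 / k - 1) : ℂ) *
    segInt (τ ^ (k : ℂ)) fun s =>
      (τ ^ (k : ℂ) - s) ^ ((1 / k - 2 : ℝ) : ℂ) * (k : ℂ) * f (s ^ ((1 / k : ℝ) : ℂ)) m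

/-- The operator `exp(-κ C_k)`, as the series of iterates of `C_k`. -/
noncomputable def expOpC (k κ : ℝ) (f : ℂ → ℝ → ℂ) (τ : ℂ) (m : ℝ) : ℂ :=
  ∑' p : ℕ, (-1 : ℂ) ^ p * (κ : ℂ) ^ p / (p.factorial : ℂ) * ((opC k)^[p] f) τ m

/-- `K₁` is an admissible constant in the estimate of `exp(-κ C_k)` on sectors: a constant attached
to `(k, ν)` alone, which serves for all sectors, discs, decay rates, functions and `κ > 0`. -/
def IsExpOpBound (k ν K₁ : ℝ) : Prop :=
  0 < K₁ ∧
  ∀ (d δ ρ β μ C C' κ : ℝ) (f : ℂ → ℝ → ℂ),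
    0 < δ → |d| + δ ≤ Real.pi → 0 < ρ → 0 < β → 1 < μ → 0 < C → 0 < C' → 0 < κ →
    ContinuousOn (fun p : ℂ × ℝ => f p.1 p.2) (sector d δ ×ˢ univ) →
    (∀ m : ℝ, DifferentiableOn ℂ (fun τ => f τ m) (tauDomain d δ ρ)) →
    (∀ τ ∈ sector d δ, ∀ m : ℝ, ‖f τ m‖ ≤
      C * ‖τ‖ ^ k * Real.exp (ν * ‖τ‖ ^ k) * (1 + |m|) ^ (-μ) * Real.exp (-β * |m|)) →
    (∀ τ ∈ cutDisc ρ, ∀ m : ℝ, ‖f τ m‖ ≤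
      C' * ‖τ‖ ^ k * (1 + |m|) ^ (-μ) * Real.exp (-β * |m|)) →
    ∀ τ ∈ sector d δ, ∀ m : ℝ, ‖expOpC k κ f τ m‖ ≤
      C * ‖τ‖ ^ k * Real.exp (κ * K₁ * (k / Real.Gamma (1 / k - 1)) * ‖τ‖ ^ k) *
        Real.exp (ν * ‖τ‖ ^ k) * (1 + |m|) ^ (-μ) * Real.exp (-β * |m|)

/-- The coefficients `A_{δ,p}` of the expansion of `T^{δ(k+1)} ∂_T^δ` in terms of
`T^{k+1} ∂_T`; see `tahara_expansion`. -/
noncomputable def tahara (k : ℝ) : ℕ → ℕ → ℝ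
  | 0, 0 => 1
  | 0, _ + 1 => 0
  | δ + 1, 0 => -(δ : ℝ) * tahara k δ 0
  | δ + 1, p + 1 => tahara k δ p - (k * ((p : ℝ) + 1) + (δ : ℝ)) * tahara k δ (p + 1)

/-- The differential operator `T^{k+1} ∂_T` on functions on `(0,∞)`. -/
noncomputable def irregD (k : ℝ) (f : ℝ → ℂ) (T : ℝ) : ℂ :=
  ((T ^ (k + 1) : ℝ) : ℂ) * deriv f T

theorem tahara_eq_zero (k : ℝ) : ∀ δ p : ℕ, δ < p → tahara k δ p = 0
  | 0, 0, h => absurd h (lt_irrefl 0)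
  | 0, _ + 1, _ => by simp [tahara]
  | _ + 1, 0, h => absurd h (Nat.not_lt_zero _)
  | δ + 1, p + 1, h => by
      simp [tahara, tahara_eq_zero k δ p (by omega), tahara_eq_zero k δ (p + 1) (by omega)]

theorem tahara_self (k : ℝ) : ∀ δ : ℕ, tahara k δ δ = 1
  | 0 => by simp [tahara]
  | δ + 1 => by simp [tahara, tahara_self k δ, tahara_eq_zero k δ (δ + 1) (by omega)]

theorem tahara_zero (k : ℝ) : ∀ δ : ℕ, tahara k (δ + 1) 0 = 0
  | 0 => by simp [tahara]
  | δ + 1 => by rw [tahara, tahara_zero k δ, mul_zero]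

theorem irregD_iterate_contDiffOn (k : ℝ) (f : ℝ → ℂ)
    (hf : ContDiffOn ℝ (⊤ : ℕ∞) f (Ioi 0)) (p : ℕ) :
    ContDiffOn ℝ (⊤ : ℕ∞) ((irregD k)^[p] f) (Ioi 0) := by
  induction p with
  | zero => simpa using hf
  | succ p ih =>
    rw [Function.iterate_succ', Function.comp_apply]
    have h1 : ContDiffOn ℝ (⊤ : ℕ∞) (fun T : ℝ => ((T ^ (k + 1) : ℝ) : ℂ)) (Ioi 0) := by
      refine Complex.ofRealCLM.contDiff.comp_contDiffOn ?_
      intro x hx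
      exact (Real.contDiffAt_rpow_const_of_ne (ne_of_gt hx)).contDiffWithinAt
    exact h1.mul (ih.deriv_of_isOpen isOpen_Ioi (by simp))

theorem tahara_expansion_aux (k : ℝ) (f : ℝ → ℂ)
    (hf : ContDiffOn ℝ (⊤ : ℕ∞) f (Ioi 0)) (δ : ℕ) :
    ∀ T : ℝ, 0 < T →
    ((T ^ ((δ : ℝ) * (k + 1)) : ℝ) : ℂ) * iteratedDeriv δ f T =
      ∑ p ∈ Finset.range (δ + 1), (tahara k δ p : ℂ) *
        ((T ^ (k * ((δ : ℝ) - (p : ℝ))) : ℝ) : ℂ) * ((irregD k)^[p] f) T := by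
  induction δ with
  | zero => intro T hT; simp [tahara]
  | succ δ ih =>
    intro T hT
    have hpow : ∀ a : ℝ, HasDerivAt (fun t : ℝ => ((t ^ a : ℝ) : ℂ))
        ((a * T ^ (a - 1) : ℝ) : ℂ) T := fun a =>
      (Real.hasDerivAt_rpow_const (Or.inl hT.ne')).ofReal_comp
    have hg : ∀ p : ℕ, HasDerivAt ((irregD k)^[p] f) (deriv ((irregD k)^[p] f) T) T := fun p =>
      (((irregD_iterate_contDiffOn k f hf p).differentiableOn (by simp)).differentiableAt
        (Ioi_mem_nhds hT)).hasDerivAt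
    have hfd : HasDerivAt (iteratedDeriv δ f) (iteratedDeriv (δ + 1) f T) T := by
      rw [iteratedDeriv_succ]
      have h1 : ∀ j : ℕ, ContDiffOn ℝ (⊤ : ℕ∞) (iteratedDeriv j f) (Ioi 0) := by
        intro j
        induction j with
        | zero => simpa using hf
        | succ j ihj => rw [iteratedDeriv_succ]; exact ihj.deriv_of_isOpen isOpen_Ioi (by simp)
      exact (((h1 δ).differentiableOn (by simp)).differentiableAt (Ioi_mem_nhds hT)).hasDerivAt
    have hL := (hpow ((δ : ℝ) * (k + 1))).mul hfd
    have hR := HasDerivAt.fun_sum (u := Finset.range (δ + 1))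
      (fun p _ => ((hpow (k * ((δ : ℝ) - (p : ℝ)))).const_mul (tahara k δ p : ℂ)).mul (hg p))
    have hLR := hL.unique (hR.congr_of_eventuallyEq
      (Filter.eventuallyEq_of_mem (Ioi_mem_nhds hT) (fun t ht => ih t ht)))
    have e : ∀ a b c : ℝ, a + b = c → ((T ^ a : ℝ) : ℂ) * ((T ^ b : ℝ) : ℂ) = ((T ^ c : ℝ) : ℂ) := by
      intro a b c h
      rw [← Complex.ofReal_mul, ← Real.rpow_add hT, h]
    have hD : ∀ p : ℕ, ((irregD k)^[p + 1] f) T =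
        ((T ^ (k + 1) : ℝ) : ℂ) * deriv ((irregD k)^[p] f) T := by
      intro p
      rw [Function.iterate_succ', Function.comp_apply]
      rfl
    have ihT := ih T hT
    have key : ((T ^ (((δ + 1 : ℕ) : ℝ) * (k + 1)) : ℝ) : ℂ) * iteratedDeriv (δ + 1) f T =
        ∑ p ∈ Finset.range (δ + 1), ((tahara k δ p : ℂ) *
            ((T ^ (k * ((δ : ℝ) - (p : ℝ))) : ℝ) : ℂ) * ((irregD k)^[p + 1] f) T -
          ((k * p + δ : ℝ) : ℂ) * (tahara k δ p : ℂ) *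
            ((T ^ (k * (((δ + 1 : ℕ) : ℝ) - (p : ℝ))) : ℝ) : ℂ) * ((irregD k)^[p] f) T) := by
      have h2 := congrArg (fun z => ((T ^ (k + 1) : ℝ) : ℂ) * z) hLR
      beta_reduce at h2
      rw [mul_add, Finset.mul_sum] at h2
      have h3 : ((T ^ (k + 1) : ℝ) : ℂ) *
          (((((δ : ℝ) * (k + 1)) * T ^ ((δ : ℝ) * (k + 1) - 1) : ℝ) : ℂ) * iteratedDeriv δ f T) =
          ∑ p ∈ Finset.range (δ + 1), ((δ * (k + 1) : ℝ) : ℂ) * (tahara k δ p : ℂ) *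
            ((T ^ (k * (((δ + 1 : ℕ) : ℝ) - (p : ℝ))) : ℝ) : ℂ) * ((irregD k)^[p] f) T := by
        have : ((T ^ (k + 1) : ℝ) : ℂ) *
          (((((δ : ℝ) * (k + 1)) * T ^ ((δ : ℝ) * (k + 1) - 1) : ℝ) : ℂ) * iteratedDeriv δ f T) =
          ((δ * (k + 1) : ℝ) : ℂ) * ((T ^ k : ℝ) : ℂ) *
            (((T ^ ((δ : ℝ) * (k + 1)) : ℝ) : ℂ) * iteratedDeriv δ f T) := by
          have h4 := e (k + 1) ((δ : ℝ) * (k + 1) - 1) (k + (δ : ℝ) * (k + 1)) (by ring)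
          have h5 := e k ((δ : ℝ) * (k + 1)) (k + (δ : ℝ) * (k + 1)) (by ring)
          rw [Complex.ofReal_mul]
          linear_combination (((δ : ℝ) * (k + 1) : ℝ) : ℂ) * iteratedDeriv δ f T * (h4 - h5)
        rw [this, ihT, Finset.mul_sum]
        refine Finset.sum_congr rfl fun p _ => ?_
        have h6 := e k (k * ((δ : ℝ) - (p : ℝ))) (k * (((δ + 1 : ℕ) : ℝ) - (p : ℝ)))
          (by push_cast; ring)
        linear_combination ((δ * (k + 1) : ℝ) : ℂ) * (tahara k δ p : ℂ) * ((irregD k)^[p] f) T * h6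
      rw [h3] at h2
      have h7 := e (k + 1) ((δ : ℝ) * (k + 1)) (((δ + 1 : ℕ) : ℝ) * (k + 1)) (by push_cast; ring)
      rw [← h7, mul_assoc, ← sub_eq_of_eq_add' h2.symm, ← Finset.sum_sub_distrib]
      refine Finset.sum_congr rfl fun p _ => ?_
      have h8 := e (k + 1) (k * ((δ : ℝ) - (p : ℝ)) - 1) (k * (((δ + 1 : ℕ) : ℝ) - (p : ℝ)))
          (by push_cast; ring)
      rw [hD, ← h8]
      push_cast
      ring_nf
    rw [key, Finset.sum_range_succ' _ (δ + 1), Finset.sum_sub_distrib, Finset.sum_range_succ' (fun p : ℕ =>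
      ((k * p + δ : ℝ) : ℂ) * (tahara k δ p : ℂ) *
            ((T ^ (k * (((δ + 1 : ℕ) : ℝ) - (p : ℝ))) : ℝ) : ℂ) * ((irregD k)^[p] f) T) δ]
    have h9 : ∑ p ∈ Finset.range δ, ((k * ((p + 1 : ℕ) : ℝ) + δ : ℝ) : ℂ) * (tahara k δ (p + 1) : ℂ) *
            ((T ^ (k * (((δ + 1 : ℕ) : ℝ) - ((p + 1 : ℕ) : ℝ))) : ℝ) : ℂ) *
              ((irregD k)^[p + 1] f) T =
        ∑ p ∈ Finset.range (δ + 1), ((k * ((p + 1 : ℕ) : ℝ) + δ : ℝ) : ℂ) * (tahara k δ (p + 1) : ℂ) *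
            ((T ^ (k * (((δ + 1 : ℕ) : ℝ) - ((p + 1 : ℕ) : ℝ))) : ℝ) : ℂ) *
              ((irregD k)^[p + 1] f) T := by
      rw [Finset.sum_range_succ _ δ, tahara_eq_zero k δ (δ + 1) (by omega)]
      simp
    rw [h9, ← sub_sub, ← Finset.sum_sub_distrib, sub_eq_add_neg]
    congr 1
    · refine Finset.sum_congr rfl fun p _ => ?_
      have h10 : k * (((δ + 1 : ℕ) : ℝ) - ((p + 1 : ℕ) : ℝ)) = k * ((δ : ℝ) - (p : ℝ)) := by
        push_cast; ring
      rw [h10, tahara]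
      push_cast
      ring
    · simp [tahara]

/-- The identity that defines the numbers `A_{δ,p}`:
`T^{δ(k+1)} ∂^δ = (T^{k+1}∂)^δ + ∑_{1 ≤ p ≤ δ-1} A_{δ,p} T^{k(δ-p)} (T^{k+1}∂)^p`. -/
theorem tahara_expansion (k : ℝ) (f : ℝ → ℂ) (hf : ContDiffOn ℝ (⊤ : ℕ∞) f (Ioi 0))
    (δ : ℕ) (hδ : 1 ≤ δ) (T : ℝ) (hT : 0 < T) :
    ((T ^ ((δ : ℝ) * (k + 1)) : ℝ) : ℂ) * iteratedDeriv δ f T =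
      ((irregD k)^[δ] f) T +
        ∑ p ∈ Finset.Icc 1 (δ - 1), (tahara k δ p : ℂ) *
          ((T ^ (k * ((δ : ℝ) - (p : ℝ))) : ℝ) : ℂ) * ((irregD k)^[p] f) T := by
  obtain ⟨δ, rfl⟩ : ∃ j, δ = j + 1 := ⟨δ - 1, by omega⟩
  rw [tahara_expansion_aux k f hf (δ + 1) T hT, Finset.sum_range_succ, tahara_self, add_comm]
  congr 1
  · simp
  · rw [Finset.range_eq_Ico, Finset.sum_eq_sum_Ico_succ_bot (by omega), tahara_zero]
    have : Finset.Ico (0 + 1) (δ + 1) = Finset.Icc 1 (δ + 1 - 1) := by ext; simp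
    rw [this]
    simp

/-! ### The convolution equation -/

/-- The value `P(im)`. -/
noncomputable def evalI (P : Polynomial ℂ) (m : ℝ) : ℂ := P.eval (Complex.I * (m : ℂ))

/-- `H(τ,m) = Q(im) - exp(α k τ^k) R_D(im)`. -/
noncomputable def funH (k α : ℝ) (Q RD : Polynomial ℂ) (τ : ℂ) (m : ℝ) : ℂ :=
  evalI Q m - Complex.exp ((α : ℂ) * (k : ℂ) * τ ^ (k : ℂ)) * evalI RD m

/-- `a_l(m) = log |Q(im)/R_D(im)| + i arg (Q(im)/R_D(im)) + 2 l π i`. -/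
noncomputable def rootA (Q RD : Polynomial ℂ) (l : ℤ) (m : ℝ) : ℂ :=
  (Real.log ‖evalI Q m / evalI RD m‖ : ℂ) +
    Complex.I * (Complex.arg (evalI Q m / evalI RD m) : ℂ) +
    2 * (l : ℂ) * (Real.pi : ℂ) * Complex.I

/-- `τ_l = |a_l(m)/(α k)|^{1/k} exp(i arg(a_l(m))/k)`. -/
noncomputable def rootTau (k α : ℝ) (Q RD : Polynomial ℂ) (l : ℤ) (m : ℝ) : ℂ :=
  ((‖rootA Q RD l m / ((α : ℂ) * (k : ℂ))‖ ^ (1 / k) : ℝ) : ℂ) *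
    Complex.exp (Complex.I * ((Complex.arg (rootA Q RD l m) / k : ℝ) : ℂ))

/-- The closed sectorial annulus with radii `r₁ ≤ r₂`, direction `d` and aperture `η`
(arguments being taken modulo `2π`). -/
def sectorialAnnulus (r₁ r₂ d η : ℝ) : Set ℂ :=
  {z | ∃ r θ : ℝ, r₁ ≤ r ∧ r ≤ r₂ ∧ |θ - d| ≤ η ∧ z = (r : ℂ) * Complex.exp (Complex.I * (θ : ℂ))}

/-- `ψ(τ,m,ε) = ∑_{n ≥ 1} F_n(m,ε) τ^n / Γ(n/k)`; `F n m ε` stands for `F_n(m,ε)`. -/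
noncomputable def psi (k : ℝ) (F : ℕ → ℝ → ℂ → ℂ) (τ : ℂ) (m : ℝ) (ε : ℂ) : ℂ :=
  ∑' j : ℕ, F (j + 1) m ε * τ ^ (j + 1) / (Real.Gamma (((j + 1 : ℕ) : ℝ) / k) : ℂ)

/-- `τ^k / Γ(a) * ∫_0^{τ^k} (τ^k - s)^{a-1} k^p s^p (exp(-κ C_k) w)(s^{1/k}, m) ds/s`. -/
noncomputable def convExp (k κ a : ℝ) (p : ℕ) (w : ℂ → ℝ → ℂ) (τ : ℂ) (m : ℝ) : ℂ :=
  τ ^ (k : ℂ) / (Real.Gamma a : ℂ) *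
    segInt (τ ^ (k : ℂ)) fun s =>
      (τ ^ (k : ℂ) - s) ^ ((a - 1 : ℝ) : ℂ) * (k : ℂ) ^ p * s ^ p *
        expOpC k κ w (s ^ ((1 / k : ℝ) : ℂ)) m / s

/-- The bracket attached to `l` and `n ∈ I_l`, with `dk = d_{l,k}` and `δ = δ_l`. -/
noncomputable def bracket (k κ dk : ℝ) (δ n : ℕ) (w : ℂ → ℝ → ℂ) (τ : ℂ) (m : ℝ) : ℂ :=
  convExp k κ (((n : ℝ) + dk) / k) δ w τ m +
    ∑ p ∈ Finset.Icc 1 (δ - 1), (tahara k δ p : ℂ) *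
      convExp k κ (((n : ℝ) + dk) / k + (δ : ℝ) - (p : ℝ)) p w τ m

/-- The nonlinear convolution term, without the factor `c₁₂`. -/
noncomputable def quadTerm (k : ℝ) (Q₁ Q₂ : Polynomial ℂ) (w : ℂ → ℝ → ℂ) (τ : ℂ) (m : ℝ) : ℂ :=
  τ ^ (k : ℂ) / ((2 * Real.pi) ^ (1 / 2 : ℝ) : ℝ) *
    segInt (τ ^ (k : ℂ)) fun s =>
      ∫ m₁ : ℝ, evalI Q₁ (m - m₁) * w ((τ ^ (k : ℂ) - s) ^ ((1 / k : ℝ) : ℂ)) (m - m₁) *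
        (evalI Q₂ m₁ * w (s ^ ((1 / k : ℝ) : ℂ)) m₁) * (1 / ((τ ^ (k : ℂ) - s) * s))

/-- `w` solves the convolution equation, for the value `ε` of the parameter, at all
`τ ∈ S_d ∪ (D(0,ρ) \ (-ρ,0])` and all `m ∈ ℝ`. Here `R l` for `1 ≤ l ≤ D` are the polynomials
`R_l` (so `R D` is `R_D`), and `d_{l,k} = d_l - δ_l (k+1)`. -/
def SolvesConvEq (k α : ℝ) (D : ℕ) (Q Q₁ Q₂ : Polynomial ℂ) (R : ℕ → Polynomial ℂ)
    (dl δl Δl : ℕ → ℕ) (κ : ℕ → ℝ) (I : ℕ → Finset ℕ) (A : ℕ → ℕ → ℂ → ℂ)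
    (F : ℕ → ℝ → ℂ → ℂ) (c₁₂ cf : ℂ) (c : ℕ → ℂ) (d δ ρ : ℝ) (ε : ℂ) (w : ℂ → ℝ → ℂ) : Prop :=
  ∀ τ ∈ tauDomain d δ ρ, ∀ m : ℝ,
    evalI Q m * w τ m =
      Complex.exp ((α : ℂ) * (k : ℂ) * τ ^ (k : ℂ)) * evalI (R D) m * w τ m +
      ∑ l ∈ Finset.Icc 1 (D - 1), ε ^ (Δl l + δl l - dl l) * evalI (R l) m * c l *
        ∑ n ∈ I l, A l n ε *
          bracket k (κ l) ((dl l : ℝ) - (δl l : ℝ) * (k + 1)) (δl l) n w τ m +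
      c₁₂ * quadTerm k Q₁ Q₂ w τ m +
      cf * psi k F τ m ε

/-! Dividing (E) by H turns it into a fixed point equation. For small coefficients the resulting map
`convMap` is a contraction of the unit ball with ratio 1/2, so the radius ϖ = 1 always serves. In
every integral one substitutes s = u τ^k. Since k < 1 keeps k arg τ in the principal range, s^{1/k}
becomes u^{1/k} τ, and all integrals run over 0 < u < 1 along the ray from 0 to τ. The only geometry
they need is that the domain is invariant under these homotheties.

Write x = |τ|^k. The weight is x/(1+x²) e^{νx} times a decay in m, and four estimates carry the
proof.

The operator exp(-κ C_k): bounding C_k trivially costs a factor |τ| = x^{1/k} per application, and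
the series would grow like exp(const |τ|), which nothing of order k can absorb. Keeping e^{νux}
under the integral produces a Gamma integral and a gain (νx)^{1-1/k}, so that each application costs
only k ν^{1-1/k} x (`opC_bound`). The series then sums to exp(κ k ν^{1-1/k} x), which yields K₁ =
Γ(1/k-1) ν^{1-1/k}.

The lower bound of H: since |Q/R_D| > 1, the logarithms a_l lie in the right half plane, and their
arguments tend to ±π/2. A sector free of all τ_l must therefore satisfy k(|d|+δ') ≤ π/2
(`sector_aperture_lt`). Hence Re τ^k ≥ c|τ|^k on S_d with c > 0, and H grows exponentially there. By
the hypothesis on B_{H,d} this growth outweighs that of exp(-κ_l C_k), and the surplus absorbs all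
powers of x (`exists_convExp_bound`).

The quadratic term: the two exponentials multiply to e^{νx}, the singularity 1/((1-u)u) is cancelled
by the two weights, and an arctangent integral gives back x/(1+x²). The powers of m lost to Q₁ and
Q₂ are paid for by Q (`exists_quadBi_bound`).

The forcing term: T₀^{-k} < ν leaves room for a rate ν' in between, for which the series ψ is
dominated by a geometric one (`exists_psi_bound`).

Uniqueness has one further point. A member of F is jointly continuous over the sector only, while
the estimates need continuity in m on the cut disc as well. A Vitali argument propagates it
(`MemF.inBall`). -/

/-! ### Functions continuous in both variables and holomorphic in the first. -/

/-- `g` is jointly continuous on `S × ℝ` and holomorphic in the first variable on `S`. -/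
structure IsHC (S : Set ℂ) (g : ℂ → ℝ → ℂ) : Prop where
  cont : ContinuousOn (fun p : ℂ × ℝ => g p.1 p.2) (S ×ˢ univ)
  holo : ∀ m : ℝ, DifferentiableOn ℂ (fun τ => g τ m) S

namespace IsHC

variable {S : Set ℂ} {f g : ℂ → ℝ → ℂ}

theorem add (hf : IsHC S f) (hg : IsHC S g) : IsHC S fun τ m => f τ m + g τ m :=
  ⟨hf.cont.add hg.cont, fun m => (hf.holo m).add (hg.holo m)⟩

theorem sub (hf : IsHC S f) (hg : IsHC S g) : IsHC S fun τ m => f τ m - g τ m :=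
  ⟨hf.cont.sub hg.cont, fun m => (hf.holo m).sub (hg.holo m)⟩

theorem mul (hf : IsHC S f) (hg : IsHC S g) : IsHC S fun τ m => f τ m * g τ m :=
  ⟨hf.cont.mul hg.cont, fun m => (hf.holo m).mul (hg.holo m)⟩

theorem div (hf : IsHC S f) (hg : IsHC S g) (h0 : ∀ τ ∈ S, ∀ m, g τ m ≠ 0) :
    IsHC S fun τ m => f τ m / g τ m :=
  ⟨hf.cont.div hg.cont fun _ hp => h0 _ hp.1 _, fun m => (hf.holo m).div (hg.holo m)
    fun τ hτ => h0 τ hτ m⟩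

theorem const (c : ℂ) : IsHC S fun _ _ => c :=
  ⟨continuousOn_const, fun _ => differentiableOn_const c⟩

theorem of_snd {h : ℝ → ℂ} (hh : Continuous h) : IsHC S fun _ m => h m :=
  ⟨(hh.comp continuous_snd).continuousOn, fun m => differentiableOn_const (h m)⟩

theorem of_fst {h : ℂ → ℂ} (hh : DifferentiableOn ℂ h S) : IsHC S fun τ _ => h τ :=
  ⟨hh.continuousOn.comp continuousOn_fst fun _ hp => hp.1, fun _ => hh⟩

theorem sum {ι : Type*} {s : Finset ι} {f : ι → ℂ → ℝ → ℂ} (hf : ∀ i ∈ s, IsHC S (f i)) :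
    IsHC S fun τ m => ∑ i ∈ s, f i τ m :=
  ⟨continuousOn_finsetSum s fun i hi => (hf i hi).cont,
    fun m => DifferentiableOn.fun_sum fun i hi => (hf i hi).holo m⟩

theorem congr (hf : IsHC S f) (h : ∀ τ ∈ S, ∀ m, g τ m = f τ m) : IsHC S g :=
  ⟨hf.cont.congr fun _ hp => h _ hp.1 _, fun m => (hf.holo m).congr fun τ hτ => h τ hτ m⟩

/-- Scaling of the first variable. -/
theorem comp_scale (hf : IsHC S f) {t : ℂ} (ht : ∀ τ ∈ S, t * τ ∈ S) :
    IsHC S fun τ m => f (t * τ) m :=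
  ⟨hf.cont.comp (f := fun p : ℂ × ℝ => (t * p.1, p.2)) (by fun_prop) fun p hp => ⟨ht _ hp.1, hp.2⟩,
    fun m => (hf.holo m).comp (by fun_prop) fun τ hτ => ht τ hτ⟩

/-- Translation of the second variable. -/
theorem comp_sub_right (hf : IsHC S f) (a : ℝ) : IsHC S fun τ m => f τ (m - a) :=
  ⟨hf.cont.comp (f := fun p : ℂ × ℝ => (p.1, p.2 - a)) (by fun_prop)
    fun p hp => ⟨hp.1, mem_univ _⟩, fun m => hf.holo (m - a)⟩

/-- Freezing the second variable. -/
theorem freeze (hf : IsHC S f) (a : ℝ) : IsHC S fun τ _ => f τ a :=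
  of_fst (hf.holo a)

/-- The property is local in the modulus of the first variable. -/
theorem of_ball (h : ∀ R : ℝ, IsHC (S ∩ Metric.ball 0 R) f) : IsHC S f := by
  constructor
  · intro p hp
    have h1 := (h (‖p.1‖ + 1)).cont p ⟨⟨hp.1, by simp⟩, mem_univ _⟩
    refine h1.mono_of_mem_nhdsWithin ?_
    have : (Metric.ball (0 : ℂ) (‖p.1‖ + 1) ×ˢ (univ : Set ℝ)) ∈ nhds p :=
      (Metric.isOpen_ball.prod isOpen_univ).mem_nhds ⟨by simp, mem_univ _⟩
    filter_upwards [nhdsWithin_le_nhds this, self_mem_nhdsWithin] with q h2 h3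
    exact ⟨⟨h3.1, h2.1⟩, mem_univ _⟩
  · intro m τ hτ
    have h1 := (h (‖τ‖ + 1)).holo m τ ⟨hτ, by simp⟩
    refine h1.mono_of_mem_nhdsWithin ?_
    have : (Metric.ball (0 : ℂ) (‖τ‖ + 1)) ∈ nhds τ := Metric.isOpen_ball.mem_nhds (by simp)
    filter_upwards [nhdsWithin_le_nhds this, self_mem_nhdsWithin] with q h2 h3
    exact ⟨h3, h2⟩

theorem tsum (hS : IsOpen S) {f : ℕ → ℂ → ℝ → ℂ} (hf : ∀ i, IsHC S (f i))
    (hb : ∀ R : ℝ, ∃ b : ℕ → ℝ, Summable b ∧ ∀ i, ∀ τ ∈ S, ‖τ‖ < R → ∀ m, ‖f i τ m‖ ≤ b i) :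
    IsHC S fun τ m => ∑' i, f i τ m := by
  refine of_ball fun R => ?_
  obtain ⟨b, hb, hfb⟩ := hb R
  constructor
  · exact continuousOn_tsum (fun i => (hf i).cont.mono (prod_mono inter_subset_left le_rfl)) hb
      fun i p hp => hfb i _ hp.1.1 (by simpa using hp.1.2) _
  · intro m
    exact Complex.differentiableOn_tsum_of_summable_norm hb
      (fun i => ((hf i).holo m).mono inter_subset_left) (hS.inter Metric.isOpen_ball)
      fun i τ hτ => hfb i τ hτ.1 (by simpa using hτ.2) m

end IsHC

/-- Dominating the functions suffices: Cauchy's estimate turns the bound `b` into a bound for their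
derivatives, and one differentiates under the integral. -/
theorem differentiableOn_integral_of_dominated {Y : Type*} [MeasurableSpace Y]
    {lam : MeasureTheory.Measure Y} {S : Set ℂ} (hS : IsOpen S) {G : Y → ℂ → ℂ} {b : Y → ℝ}
    (hmeas : ∀ τ ∈ S, MeasureTheory.AEStronglyMeasurable (fun y => G y τ) lam)
    (hG : ∀ᵐ y ∂lam, DifferentiableOn ℂ (G y) S)
    (hb : MeasureTheory.Integrable b lam) (hGb : ∀ᵐ y ∂lam, ∀ τ ∈ S, ‖G y τ‖ ≤ b y) :
    DifferentiableOn ℂ (fun τ => ∫ y, G y τ ∂lam) S := by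
  intro τ₀ hτ₀
  obtain ⟨r, hr, hrS⟩ := Metric.isOpen_iff.1 hS τ₀ hτ₀
  refine DifferentiableAt.differentiableWithinAt ?_
  have hr2 : 0 < r / 2 := by positivity
  have hderiv : ∀ᵐ y ∂lam, ∀ τ ∈ Metric.ball τ₀ r, HasDerivAt (G y) (deriv (G y) τ) τ := by
    filter_upwards [hG] with y hy τ hτ
    exact ((hy τ (hrS hτ)).differentiableAt (hS.mem_nhds (hrS hτ))).hasDerivAt
  -- Here τ ranges over the disc of radius r/2 about `τ₀`, and Cauchy's estimate is applied on discs
  -- of radius r/4 about τ, which stay inside the disc of radius r contained in `S`.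
  refine (hasDerivAt_integral_of_dominated_loc_of_deriv_le (μ := lam) (F := fun τ y => G y τ)
    (F' := fun τ y => deriv (G y) τ) (bound := fun y => b y / (r / 2 / 2)) (x₀ := τ₀)
    (Metric.ball_mem_nhds τ₀ hr2) ?_ ?_ ?_ ?_ ?_ ?_).2.differentiableAt
  · filter_upwards [hS.mem_nhds hτ₀] with τ hτ using hmeas τ hτ
  · exact hb.mono' (hmeas τ₀ hτ₀) (by filter_upwards [hGb] with y hy using hy τ₀ hτ₀)
  -- The derivative at `τ₀` is measurable in `y` as a limit of difference quotients along a sequence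
  -- tending to `τ₀`.
  · let z : ℕ → ℂ := fun n => τ₀ + ((r / 2 / ((n : ℝ) + 1) : ℝ) : ℂ)
    have hzlim0 : Filter.Tendsto (fun n : ℕ => r / 2 / ((n : ℝ) + 1)) Filter.atTop (nhds 0) := by
      have := tendsto_one_div_add_atTop_nhds_zero_nat (𝕜 := ℝ)
      simpa [div_eq_mul_inv] using this.const_mul (r / 2)
    have hzne : ∀ n, z n ≠ τ₀ := by
      intro n h
      have h1 : ((r / 2 / ((n : ℝ) + 1) : ℝ) : ℂ) = 0 := by simpa [z] using h
      have h2 : (0 : ℝ) < r / 2 / ((n : ℝ) + 1) := by positivity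
      exact h2.ne' (by exact_mod_cast h1)
    have hzS : ∀ n, z n ∈ Metric.ball τ₀ r := by
      intro n
      have h2 : (0 : ℝ) < r / 2 / ((n : ℝ) + 1) := by positivity
      have h3 : r / 2 / ((n : ℝ) + 1) ≤ r / 2 := div_le_self hr2.le (by linarith [n.cast_nonneg (α := ℝ)])
      simp only [z, Metric.mem_ball, dist_self_add_left, Complex.norm_real, Real.norm_eq_abs]
      rw [abs_of_pos h2]; linarith
    have hzlim : Filter.Tendsto z Filter.atTop (nhdsWithin τ₀ {τ₀}ᶜ) := by
      refine tendsto_nhdsWithin_iff.2 ⟨?_, Filter.Eventually.of_forall hzne⟩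
      have h4 := (Complex.continuous_ofReal.tendsto 0).comp hzlim0
      simpa [z, Function.comp_def] using h4.const_add τ₀
    refine aestronglyMeasurable_of_tendsto_ae Filter.atTop
      (f := fun n y => (z n - τ₀)⁻¹ * (G y (z n) - G y τ₀)) (fun n => ?_) ?_
    · exact ((hmeas _ (hrS (hzS n))).sub (hmeas _ hτ₀)).const_mul _
    · filter_upwards [hderiv] with y hy
      have h5 := hasDerivAt_iff_tendsto_slope.1 (hy τ₀ (Metric.mem_ball_self hr))
      have := h5.comp hzlim
      simpa [slope_def_field, Function.comp_def, div_eq_inv_mul] using this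
  · filter_upwards [hG, hGb] with y hy hyb τ hτ
    have hsub : Metric.closedBall τ (r / 2 / 2) ⊆ S := by
      refine Subset.trans ?_ hrS
      intro z hz
      rw [Metric.mem_ball] at hτ ⊢
      rw [Metric.mem_closedBall] at hz
      linarith [dist_triangle z τ τ₀]
    refine Complex.norm_deriv_le_of_forall_mem_sphere_norm_le (by positivity) ?_ fun z hz =>
      hyb z (hsub (Metric.sphere_subset_closedBall hz))
    exact (hy.mono hsub).diffContOnCl_ball le_rfl
  · exact hb.div_const _
  · filter_upwards [hderiv] with y hy τ hτ
    exact hy τ (Metric.ball_subset_ball (by linarith) hτ)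

/-- Parametric integrals, with local domination, inherit `IsHC`. -/
theorem IsHC.integral {Y : Type*} [MeasurableSpace Y] {lam : MeasureTheory.Measure Y} {S : Set ℂ}
    (hS : IsOpen S) {G : Y → ℂ → ℝ → ℂ}
    (hmeas : ∀ τ ∈ S, ∀ m, MeasureTheory.AEStronglyMeasurable (fun y => G y τ m) lam)
    (hG : ∀ᵐ y ∂lam, IsHC S (G y))
    (hb : ∀ R : ℝ, ∃ b : Y → ℝ, MeasureTheory.Integrable b lam ∧
      ∀ᵐ y ∂lam, ∀ τ ∈ S, ‖τ‖ < R → ∀ m, ‖G y τ m‖ ≤ b y) :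
    IsHC S fun τ m => ∫ y, G y τ m ∂lam := by
  refine IsHC.of_ball fun R => ?_
  obtain ⟨b, hb, hGb⟩ := hb R
  constructor
  · refine MeasureTheory.continuousOn_of_dominated (bound := b) ?_ ?_ hb ?_
    · exact fun p hp => hmeas _ hp.1.1 _
    · intro p hp
      filter_upwards [hGb] with y hy using hy _ hp.1.1 (by simpa using hp.1.2) _
    · filter_upwards [hG] with y hy using hy.cont.mono (prod_mono inter_subset_left le_rfl)
  · intro m
    refine differentiableOn_integral_of_dominated (hS.inter Metric.isOpen_ball) (b := b)
      (fun τ hτ => hmeas τ hτ.1 m) ?_ hb ?_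
    · filter_upwards [hG] with y hy using (hy.holo m).mono inter_subset_left
    · filter_upwards [hGb] with y hy τ hτ using hy τ hτ.1 (by simpa using hτ.2) m

/-! ### Conic sets and integrals along rays. -/

/-- `S` is invariant under the homotheties of ratio in `(0,1)`, and does not contain `0`. -/
def IsConic (S : Set ℂ) : Prop :=
  (∀ τ ∈ S, ∀ t : ℝ, 0 < t → t < 1 → (t : ℂ) * τ ∈ S) ∧ (0 : ℂ) ∉ S

theorem IsConic.ne_zero {S : Set ℂ} (hS : IsConic S) {τ : ℂ} (hτ : τ ∈ S) : τ ≠ 0 :=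
  fun h => hS.2 (h ▸ hτ)

/-- The integral of `φ(u) g(u^{1/k} τ, m)` over `0 < u < 1`. -/
noncomputable def rayInt (k : ℝ) (φ : ℝ → ℝ) (g : ℂ → ℝ → ℂ) (τ : ℂ) (m : ℝ) : ℂ :=
  ∫ u in Ioo (0 : ℝ) 1, (φ u : ℂ) * g (((u ^ (1 / k) : ℝ) : ℂ) * τ) m

theorem segInt_eq_setIntegral (z : ℂ) (g : ℂ → ℂ) :
    segInt z g = ∫ u in Ioo (0 : ℝ) 1, g ((u : ℂ) * z) * z := by
  rw [segInt, intervalIntegral.integral_of_le zero_le_one, MeasureTheory.integral_Ioc_eq_integral_Ioo]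

theorem ofReal_mul_cpow {u : ℝ} (hu : 0 < u) {z : ℂ} (hz : z ≠ 0) (c : ℝ) :
    ((u : ℂ) * z) ^ (c : ℂ) = ((u ^ c : ℝ) : ℂ) * z ^ (c : ℂ) := by
  have hu' : (u : ℂ) ≠ 0 := by exact_mod_cast hu.ne'
  rw [Complex.cpow_def_of_ne_zero (mul_ne_zero hu' hz), Complex.cpow_def_of_ne_zero hz,
    Complex.log_ofReal_mul hu hz, Complex.ofReal_cpow hu.le, Complex.cpow_def_of_ne_zero hu',
    ← Complex.exp_add, Complex.ofReal_log hu.le]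
  ring_nf

/-- As 0 < k < 1, the angle k arg τ stays in (-π, π], so the two principal branches compose without
a jump. -/
theorem cpow_cpow_inv {k : ℝ} (hk : 0 < k) (hk1 : k < 1) {τ : ℂ} :
    (τ ^ (k : ℂ)) ^ ((1 / k : ℝ) : ℂ) = τ := by
  have him : (Complex.log τ * (k : ℂ)).im = Complex.arg τ * k := by
    simp [Complex.mul_im, Complex.log_im]
  have h1 : -Real.pi < Complex.arg τ * k := by
    nlinarith [Complex.neg_pi_lt_arg τ, Real.pi_pos]
  have h2 : Complex.arg τ * k ≤ Real.pi := by
    nlinarith [Complex.arg_le_pi τ, Real.pi_pos]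
  rw [← Complex.cpow_mul _ (by rw [him]; exact h1) (by rw [him]; exact h2)]
  have : (k : ℂ) * ((1 / k : ℝ) : ℂ) = 1 := by
    rw [← Complex.ofReal_mul, mul_one_div_cancel hk.ne', Complex.ofReal_one]
  rw [this, Complex.cpow_one]

theorem cpow_ne_zero' {τ : ℂ} (hτ : τ ≠ 0) (c : ℂ) : τ ^ c ≠ 0 := by
  rw [Complex.cpow_def_of_ne_zero hτ]; exact Complex.exp_ne_zero _

theorem root_ofReal_mul_cpow {k : ℝ} (hk : 0 < k) (hk1 : k < 1) {u : ℝ} (hu : 0 < u) {τ : ℂ}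
    (hτ : τ ≠ 0) :
    ((u : ℂ) * τ ^ (k : ℂ)) ^ ((1 / k : ℝ) : ℂ) = ((u ^ (1 / k) : ℝ) : ℂ) * τ := by
  rw [ofReal_mul_cpow hu (cpow_ne_zero' hτ _), cpow_cpow_inv hk hk1]

theorem sub_ofReal_mul_cpow {u : ℝ} (hu : u < 1) {z : ℂ} (hz : z ≠ 0) (c : ℝ) :
    (z - (u : ℂ) * z) ^ (c : ℂ) = (((1 - u) ^ c : ℝ) : ℂ) * z ^ (c : ℂ) := by
  rw [← ofReal_mul_cpow (sub_pos.2 hu) hz]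
  congr 1
  push_cast; ring

theorem norm_scale_rpow {k : ℝ} (hk : 0 < k) {u : ℝ} (hu : 0 ≤ u) (τ : ℂ) :
    ‖((u ^ (1 / k) : ℝ) : ℂ) * τ‖ ^ k = u * ‖τ‖ ^ k := by
  have h0 : 0 ≤ u ^ (1 / k) := Real.rpow_nonneg hu _
  rw [norm_mul, Complex.norm_real, Real.norm_of_nonneg h0, Real.mul_rpow h0 (norm_nonneg _),
    ← Real.rpow_mul hu, one_div_mul_cancel hk.ne', Real.rpow_one]

theorem IsConic.scale_mem {S : Set ℂ} (hS : IsConic S) {k : ℝ} (hk : 0 < k) {u : ℝ}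
    (hu : u ∈ Ioo (0 : ℝ) 1) {τ : ℂ} (hτ : τ ∈ S) : ((u ^ (1 / k) : ℝ) : ℂ) * τ ∈ S :=
  hS.1 τ hτ _ (Real.rpow_pos_of_pos hu.1 _) (Real.rpow_lt_one hu.1.le hu.2 (by positivity))

theorem norm_scale_le {k : ℝ} (hk : 0 < k) {u : ℝ} (hu : u ∈ Ioo (0 : ℝ) 1) (τ : ℂ) :
    ‖((u ^ (1 / k) : ℝ) : ℂ) * τ‖ ≤ ‖τ‖ := by
  have h0 : 0 ≤ u ^ (1 / k) := Real.rpow_nonneg hu.1.le _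
  rw [norm_mul, Complex.norm_real, Real.norm_of_nonneg h0]
  exact mul_le_of_le_one_left (norm_nonneg _) (Real.rpow_lt_one hu.1.le hu.2 (by positivity)).le

theorem opC_eq_rayInt {k : ℝ} (hk : 0 < k) (hk1 : k < 1) (f : ℂ → ℝ → ℂ) {τ : ℂ} (hτ : τ ≠ 0)
    (m : ℝ) : opC k f τ m =
      ((k / Real.Gamma (1 / k - 1) : ℝ) : ℂ) * τ * rayInt k (fun u => (1 - u) ^ (1 / k - 2)) f τ m := by
  rw [opC, segInt_eq_setIntegral, rayInt, ← MeasureTheory.integral_const_mul,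
    ← MeasureTheory.integral_const_mul]
  refine MeasureTheory.setIntegral_congr_fun measurableSet_Ioo fun u hu => ?_
  have hz : τ ^ (k : ℂ) ≠ 0 := cpow_ne_zero' hτ _
  rw [root_ofReal_mul_cpow hk hk1 hu.1 hτ, sub_ofReal_mul_cpow hu.2 hz]
  -- The exponents of τ^k are 1 from the prefactor, 1/k - 2 from the kernel and 1 from ds; they add
  -- up to 1/k.
  have h1 : τ ^ (k : ℂ) * (τ ^ (k : ℂ)) ^ ((1 / k - 2 : ℝ) : ℂ) * τ ^ (k : ℂ) = τ := by
    conv_rhs => rw [← cpow_cpow_inv hk hk1 (τ := τ)]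
    have : ((1 / k : ℝ) : ℂ) = 1 + ((1 / k - 2 : ℝ) : ℂ) + 1 := by push_cast; ring
    rw [this, Complex.cpow_add _ _ hz, Complex.cpow_add _ _ hz, Complex.cpow_one]
  push_cast at h1 ⊢
  linear_combination (k : ℂ) / (Real.Gamma (1 / k - 1) : ℂ) * (((1 - u) ^ (1 / k - 2) : ℝ) : ℂ) *
    f (((u ^ (1 / k) : ℝ) : ℂ) * τ) m * h1

/-- The substitution s = u τ^k again; p ≥ 1 turns s^p / s into the nonsingular factor u^{p-1}. -/
theorem convExp_eq_rayInt {k : ℝ} (hk : 0 < k) (hk1 : k < 1) (κ a : ℝ) {p : ℕ} (hp : 1 ≤ p)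
    (w : ℂ → ℝ → ℂ) {τ : ℂ} (hτ : τ ≠ 0) (m : ℝ) : convExp k κ a p w τ m =
      ((k ^ p / Real.Gamma a : ℝ) : ℂ) * (τ ^ (k : ℂ)) ^ ((a + p : ℝ) : ℂ) *
        rayInt k (fun u => (1 - u) ^ (a - 1) * u ^ (p - 1)) (expOpC k κ w) τ m := by
  rw [convExp, segInt_eq_setIntegral, rayInt, ← MeasureTheory.integral_const_mul,
    ← MeasureTheory.integral_const_mul]
  refine MeasureTheory.setIntegral_congr_fun measurableSet_Ioo fun u hu => ?_
  have hz : τ ^ (k : ℂ) ≠ 0 := cpow_ne_zero' hτ _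
  rw [root_ofReal_mul_cpow hk hk1 hu.1 hτ, sub_ofReal_mul_cpow hu.2 hz]
  obtain ⟨q, rfl⟩ : ∃ q, p = q + 1 := ⟨p - 1, by omega⟩
  have hu0 : (u : ℂ) ≠ 0 := by exact_mod_cast hu.1.ne'
  have h1 : (τ ^ (k : ℂ)) ^ ((a + (q + 1 : ℕ) : ℝ) : ℂ) =
      (τ ^ (k : ℂ)) ^ ((a - 1 : ℝ) : ℂ) * (τ ^ (k : ℂ)) ^ (q + 2) := by
    have : ((a + (q + 1 : ℕ) : ℝ) : ℂ) = ((a - 1 : ℝ) : ℂ) + ((q + 2 : ℕ) : ℂ) := by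
      push_cast; ring
    rw [this, Complex.cpow_add _ _ hz, Complex.cpow_natCast]
  rw [h1, Nat.add_sub_cancel]
  push_cast
  field_simp
  ring

theorem integrableOn_one_sub_rpow {c : ℝ} (hc : 0 < c) :
    MeasureTheory.IntegrableOn (fun u : ℝ => (1 - u) ^ (c - 1)) (Ioo 0 1) := by
  have h := (intervalIntegral.intervalIntegrable_rpow' (a := 0) (b := 1)
    (show (-1 : ℝ) < c - 1 by linarith)).comp_sub_left 1
  have h2 := (h.symm)
  norm_num at h2
  rwa [intervalIntegrable_iff_integrableOn_Ioo_of_le zero_le_one] at h2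

theorem integral_one_sub_rpow {c : ℝ} (hc : 0 < c) :
    ∫ u in Ioo (0 : ℝ) 1, (1 - u) ^ (c - 1) = 1 / c := by
  rw [← MeasureTheory.integral_Ioc_eq_integral_Ioo,
    ← intervalIntegral.integral_of_le zero_le_one,
    intervalIntegral.integral_comp_sub_left (fun v : ℝ => v ^ (c - 1)) 1,
    integral_rpow (Or.inl (by linarith))]
  norm_num [hc.ne']

/-- After v = 1 - u the integral is extended to (0, ∞), where it is a Gamma integral. The gain
r^{-c} over the trivial bound e^r / c is what keeps exp(-κ C_k) at exponential order k in |τ|. -/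
theorem integral_one_sub_rpow_mul_exp_le {c r : ℝ} (hc : 0 < c) (hr : 0 < r) :
    ∫ u in Ioo (0 : ℝ) 1, (1 - u) ^ (c - 1) * Real.exp (r * u) ≤
      Real.exp r * ((1 / r) ^ c * Real.Gamma c) := by
  have h1 : ∫ u in Ioo (0 : ℝ) 1, (1 - u) ^ (c - 1) * Real.exp (r * u) =
      Real.exp r * ∫ v in Ioc (0 : ℝ) 1, v ^ (c - 1) * Real.exp (-(r * v)) := by
    rw [← MeasureTheory.integral_Ioc_eq_integral_Ioo,
      ← intervalIntegral.integral_of_le zero_le_one,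
      ← intervalIntegral.integral_of_le zero_le_one, ← intervalIntegral.integral_const_mul]
    have := intervalIntegral.integral_comp_sub_left (a := 0) (b := 1)
      (fun v : ℝ => Real.exp r * (v ^ (c - 1) * Real.exp (-(r * v)))) 1
    norm_num at this
    rw [intervalIntegral.integral_const_mul, ← this, ← intervalIntegral.integral_const_mul]
    refine intervalIntegral.integral_congr fun u _ => ?_
    have : Real.exp (r * u) = Real.exp r * Real.exp (-(r * (1 - u))) := by
      rw [← Real.exp_add]; ring_nf
    rw [this]; ring
  rw [h1, ← Real.integral_rpow_mul_exp_neg_mul_Ioi hc hr]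
  refine mul_le_mul_of_nonneg_left ?_ (Real.exp_pos _).le
  refine MeasureTheory.setIntegral_mono_set ?_ ?_ (Filter.Eventually.of_forall Ioc_subset_Ioi_self)
  -- A non-integrable function has integral 0 by convention, which contradicts the positive value of
  -- the Gamma integral.
  · by_contra h
    have h2 := Real.integral_rpow_mul_exp_neg_mul_Ioi hc hr
    rw [MeasureTheory.integral_undef h] at h2
    have : 0 < (1 / r) ^ c * Real.Gamma c :=
      mul_pos (Real.rpow_pos_of_pos (by positivity) _) (Real.Gamma_pos_of_pos hc)
    linarith
  · filter_upwards [MeasureTheory.ae_restrict_mem measurableSet_Ioi] with v hv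
    exact mul_nonneg (Real.rpow_nonneg (le_of_lt hv) _) (Real.exp_pos _).le

theorem norm_rayInt_le {k : ℝ} {φ B : ℝ → ℝ} {g : ℂ → ℝ → ℂ} {τ : ℂ} {m : ℝ}
    (hint : MeasureTheory.IntegrableOn (fun u => φ u * B u) (Ioo 0 1))
    (hφ : ∀ u ∈ Ioo (0 : ℝ) 1, 0 ≤ φ u)
    (hB : ∀ u ∈ Ioo (0 : ℝ) 1, ‖g (((u ^ (1 / k) : ℝ) : ℂ) * τ) m‖ ≤ B u) :
    ‖rayInt k φ g τ m‖ ≤ ∫ u in Ioo (0 : ℝ) 1, φ u * B u := by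
  refine MeasureTheory.norm_integral_le_of_norm_le hint ?_
  filter_upwards [MeasureTheory.ae_restrict_mem measurableSet_Ioo] with u hu
  rw [norm_mul, Complex.norm_real, Real.norm_of_nonneg (hφ u hu)]
  exact mul_le_mul_of_nonneg_left (hB u hu) (hφ u hu)

/-- Boundedness on the bounded parts of `S`, uniformly in the second variable. -/
def LocBdd (S : Set ℂ) (g : ℂ → ℝ → ℂ) : Prop :=
  ∀ R : ℝ, ∃ C : ℝ, ∀ τ ∈ S, ‖τ‖ < R → ∀ m, ‖g τ m‖ ≤ C

theorem IsHC.continuousOn_ray {S : Set ℂ} (hS : IsConic S) {k : ℝ} (hk : 0 < k)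
    {g : ℂ → ℝ → ℂ} (hg : IsHC S g) {τ : ℂ} (hτ : τ ∈ S) (m : ℝ) :
    ContinuousOn (fun u : ℝ => g (((u ^ (1 / k) : ℝ) : ℂ) * τ) m) (Ioo 0 1) := by
  refine (hg.holo m).continuousOn.comp ?_ fun u hu => hS.scale_mem hk hu hτ
  refine ContinuousOn.mul (Complex.continuous_ofReal.comp_continuousOn ?_) continuousOn_const
  exact fun u hu => (Real.continuousAt_rpow_const _ _ (Or.inl hu.1.ne')).continuousWithinAt

theorem IsHC.rayInt_integrand {S : Set ℂ} (hS : IsConic S) {k : ℝ} (hk : 0 < k) {φ : ℝ → ℝ}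
    (hφ : MeasureTheory.IntegrableOn φ (Ioo 0 1)) {g : ℂ → ℝ → ℂ} (hg : IsHC S g)
    (hb : LocBdd S g) {τ : ℂ} (hτ : τ ∈ S) (m : ℝ) :
    MeasureTheory.IntegrableOn (fun u : ℝ => (φ u : ℂ) * g (((u ^ (1 / k) : ℝ) : ℂ) * τ) m)
      (Ioo 0 1) := by
  obtain ⟨C, hC⟩ := hb (‖τ‖ + 1)
  refine (MeasureTheory.Integrable.ofReal hφ).mul_bdd (c := C)
    ((hg.continuousOn_ray hS hk hτ m).aestronglyMeasurable measurableSet_Ioo) ?_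
  filter_upwards [MeasureTheory.ae_restrict_mem measurableSet_Ioo] with u hu
  exact hC _ (hS.scale_mem hk hu hτ) (by linarith [norm_scale_le hk hu τ]) _

theorem IsHC.rayInt {S : Set ℂ} (hSo : IsOpen S) (hS : IsConic S) {k : ℝ} (hk : 0 < k) {φ : ℝ → ℝ}
    (hφ : MeasureTheory.IntegrableOn φ (Ioo 0 1)) {g : ℂ → ℝ → ℂ} (hg : IsHC S g)
    (hb : LocBdd S g) : IsHC S (rayInt k φ g) := by
  refine IsHC.integral hSo ?_ ?_ ?_
  · exact fun τ hτ m => (hg.rayInt_integrand hS hk hφ hb hτ m).aestronglyMeasurable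
  · filter_upwards [MeasureTheory.ae_restrict_mem measurableSet_Ioo] with u hu
    exact (IsHC.const _).mul (hg.comp_scale fun τ hτ => hS.scale_mem hk hu hτ)
  · intro R
    obtain ⟨C, hC⟩ := hb R
    refine ⟨fun u => ‖φ u‖ * C, hφ.norm.mul_const C, ?_⟩
    filter_upwards [MeasureTheory.ae_restrict_mem measurableSet_Ioo] with u hu τ hτ hR m
    rw [norm_mul, Complex.norm_real]
    exact mul_le_mul_of_nonneg_left
      (hC _ (hS.scale_mem hk hu hτ) ((norm_scale_le hk hu τ).trans_lt hR) _) (norm_nonneg _)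

/-! ### Growth of C_k and of its exponential. -/

/-- With x = |τ|^k, the prefactor contributes x^{1/k} and the Gamma integral (νx)^{1-1/k}: one
application costs exactly one power of x. The rate ν is unchanged, so the estimate iterates. -/
theorem opC_bound {k ν : ℝ} (hk : 0 < k) (hk1 : k < 1) (hν : 0 < ν) {S : Set ℂ} (hS : IsConic S)
    {f : ℂ → ℝ → ℂ} {m C : ℝ} (hC : 0 ≤ C) (p : ℕ)
    (h : ∀ τ ∈ S, ‖f τ m‖ ≤ C * (‖τ‖ ^ k) ^ (p + 1) * Real.exp (ν * ‖τ‖ ^ k)) :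
    ∀ τ ∈ S, ‖opC k f τ m‖ ≤
      C * (k * ν ^ (1 - 1 / k)) * (‖τ‖ ^ k) ^ (p + 2) * Real.exp (ν * ‖τ‖ ^ k) := by
  intro τ hτ
  have hτ0 : 0 < ‖τ‖ := norm_pos_iff.2 (hS.ne_zero hτ)
  have hx : 0 < ‖τ‖ ^ k := Real.rpow_pos_of_pos hτ0 k
  have hc : 0 < 1 / k - 1 := by rw [sub_pos, lt_div_iff₀ hk]; linarith
  have hΓ := Real.Gamma_pos_of_pos hc
  set x := ‖τ‖ ^ k with hxdef
  have hτx : ‖τ‖ = x ^ (1 / k) := by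
    rw [hxdef, ← Real.rpow_mul hτ0.le, mul_one_div_cancel hk.ne', Real.rpow_one]
  rw [opC_eq_rayInt hk hk1 f (hS.ne_zero hτ), norm_mul, norm_mul, Complex.norm_real,
    Real.norm_of_nonneg (by positivity)]
  have hint := integrableOn_one_sub_rpow hc
  have e2 : (1 / k - 2 : ℝ) = (1 / k - 1) - 1 := by ring
  have hray : ‖rayInt k (fun u => (1 - u) ^ (1 / k - 2)) f τ m‖ ≤
      C * x ^ (p + 1) * (Real.exp (ν * x) * ((1 / (ν * x)) ^ (1 / k - 1) * Real.Gamma (1 / k - 1))) := by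
    rw [e2]
    -- Only the power of ux is replaced by that of x. The exponential keeps its dependence on u,
    -- since the gain comes from integrating it.
    refine (norm_rayInt_le (B := fun u => C * x ^ (p + 1) * Real.exp (ν * x * u)) ?_ ?_ ?_).trans ?_
    · refine hint.mul_bdd (c := C * x ^ (p + 1) * Real.exp (ν * x)) (by fun_prop) ?_
      filter_upwards [MeasureTheory.ae_restrict_mem measurableSet_Ioo] with u hu
      rw [Real.norm_of_nonneg (by positivity)]
      have : ν * x * u ≤ ν * x := mul_le_of_le_one_right (by positivity) hu.2.le
      gcongr
    · exact fun u hu => Real.rpow_nonneg (by linarith [hu.2]) _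
    · intro u hu
      refine (h _ (hS.scale_mem hk hu hτ)).trans ?_
      rw [norm_scale_rpow hk hu.1.le]
      have h1 : u * x ≤ x := mul_le_of_le_one_left hx.le hu.2.le
      have h2 : ν * (u * ‖τ‖ ^ k) = ν * x * u := by rw [← hxdef]; ring
      rw [h2, ← hxdef]
      have h3 : 0 ≤ u * x := mul_nonneg hu.1.le hx.le
      gcongr
    · have : ∫ u in Ioo (0 : ℝ) 1, (1 - u) ^ (1 / k - 1 - 1) * (C * x ^ (p + 1) * Real.exp (ν * x * u))
          = C * x ^ (p + 1) * ∫ u in Ioo (0 : ℝ) 1, (1 - u) ^ (1 / k - 1 - 1) * Real.exp (ν * x * u) := by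
        rw [← MeasureTheory.integral_const_mul]
        congr 1 with u
        ring
      rw [this]
      exact mul_le_mul_of_nonneg_left (integral_one_sub_rpow_mul_exp_le hc (by positivity))
        (by positivity)
  refine (mul_le_mul_of_nonneg_left hray (by positivity)).trans (le_of_eq ?_)
  have h4 : ‖τ‖ * (1 / (ν * x)) ^ (1 / k - 1) = ν ^ (1 - 1 / k) * x := by
    rw [one_div (ν * x), Real.inv_rpow (by positivity), ← Real.rpow_neg (by positivity),
      Real.mul_rpow hν.le hx.le, hτx, mul_left_comm, ← Real.rpow_add hx]
    rw [show -(1 / k - 1) = 1 - 1 / k by ring, show 1 / k + (1 - 1 / k) = (1 : ℝ) by ring, Real.rpow_one]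
  have h5 : k / Real.Gamma (1 / k - 1) * Real.Gamma (1 / k - 1) = k := div_mul_cancel₀ _ hΓ.ne'
  calc _ = (k / Real.Gamma (1 / k - 1) * Real.Gamma (1 / k - 1)) *
        (‖τ‖ * (1 / (ν * x)) ^ (1 / k - 1)) * (C * x ^ (p + 1) * Real.exp (ν * x)) := by ring
    _ = _ := by rw [h5, h4]; ring

theorem opC_iterate_bound {k ν : ℝ} (hk : 0 < k) (hk1 : k < 1) (hν : 0 < ν) {S : Set ℂ}
    (hS : IsConic S) {f : ℂ → ℝ → ℂ} {m C : ℝ} (hC : 0 ≤ C)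
    (h : ∀ τ ∈ S, ‖f τ m‖ ≤ C * ‖τ‖ ^ k * Real.exp (ν * ‖τ‖ ^ k)) (p : ℕ) :
    ∀ τ ∈ S, ‖((opC k)^[p] f) τ m‖ ≤
      C * (k * ν ^ (1 - 1 / k)) ^ p * (‖τ‖ ^ k) ^ (p + 1) * Real.exp (ν * ‖τ‖ ^ k) := by
  induction p with
  | zero => simpa using h
  | succ p ih =>
    rw [Function.iterate_succ_apply']
    intro τ hτ
    refine (opC_bound hk hk1 hν hS ?_ p ih τ hτ).trans (le_of_eq (by ring))
    exact mul_nonneg hC (pow_nonneg (mul_nonneg hk.le (Real.rpow_nonneg hν.le _)) _)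

theorem expOpC_term_bound {k ν κ : ℝ} (hk : 0 < k) (hk1 : k < 1) (hν : 0 < ν) (hκ : 0 < κ)
    {S : Set ℂ} (hS : IsConic S) {f : ℂ → ℝ → ℂ} {m C : ℝ} (hC : 0 ≤ C)
    (h : ∀ τ ∈ S, ‖f τ m‖ ≤ C * ‖τ‖ ^ k * Real.exp (ν * ‖τ‖ ^ k)) (p : ℕ) :
    ∀ τ ∈ S, ‖(-1 : ℂ) ^ p * (κ : ℂ) ^ p / (p.factorial : ℂ) * ((opC k)^[p] f) τ m‖ ≤
      C * ‖τ‖ ^ k * Real.exp (ν * ‖τ‖ ^ k) *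
        ((κ * (k * ν ^ (1 - 1 / k)) * ‖τ‖ ^ k) ^ p / p.factorial) := by
  intro τ hτ
  have h1 := opC_iterate_bound hk hk1 hν hS hC h p τ hτ
  rw [norm_mul, norm_div, norm_mul, norm_pow, norm_pow, norm_neg, norm_one, one_pow, one_mul,
    Complex.norm_natCast, Complex.norm_real, Real.norm_of_nonneg hκ.le]
  refine (mul_le_mul_of_nonneg_left h1 (by positivity)).trans (le_of_eq ?_)
  rw [mul_pow (κ * _), mul_pow κ]
  ring

/-- The bounds of the terms form an exponential series in κ k ν^{1-1/k} |τ|^k. -/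
theorem expOpC_bound {k ν κ : ℝ} (hk : 0 < k) (hk1 : k < 1) (hν : 0 < ν) (hκ : 0 < κ)
    {S : Set ℂ} (hS : IsConic S) {f : ℂ → ℝ → ℂ} {m C : ℝ} (hC : 0 ≤ C)
    (h : ∀ τ ∈ S, ‖f τ m‖ ≤ C * ‖τ‖ ^ k * Real.exp (ν * ‖τ‖ ^ k)) :
    ∀ τ ∈ S, ‖expOpC k κ f τ m‖ ≤
      C * ‖τ‖ ^ k * Real.exp (ν * ‖τ‖ ^ k) * Real.exp (κ * (k * ν ^ (1 - 1 / k)) * ‖τ‖ ^ k) := by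
  intro τ hτ
  refine tsum_of_norm_bounded (HasSum.mul_left _ ?_)
    fun p => expOpC_term_bound hk hk1 hν hκ hS hC h p τ hτ
  rw [Real.exp_eq_exp_ℝ]
  exact NormedSpace.expSeries_div_hasSum_exp _

theorem IsConic.sector (d δ : ℝ) : IsConic (sector d δ) := by
  refine ⟨fun τ hτ t ht _ => ⟨mul_ne_zero (by exact_mod_cast ht.ne') hτ.1, ?_⟩, fun h => h.1 rfl⟩
  rw [Complex.arg_real_mul _ ht]
  exact hτ.2

theorem exists_isExpOpBound {k ν : ℝ} (hk : 0 < k) (hk1 : k < 1) (hν : 0 < ν) :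
    ∃ K₁ : ℝ, IsExpOpBound k ν K₁ := by
  have hc : 0 < 1 / k - 1 := by rw [sub_pos, lt_div_iff₀ hk]; linarith
  have hΓ := Real.Gamma_pos_of_pos hc
  -- The value is chosen so that K₁ k / Γ(1/k-1) is the constant k ν^{1-1/k} of `expOpC_bound`.
  refine ⟨Real.Gamma (1 / k - 1) * ν ^ (1 - 1 / k), mul_pos hΓ (Real.rpow_pos_of_pos hν _), ?_⟩
  intro d δ ρ β μ C C' κ f _ _ _ _ _ hC _ hκ _ _ hf _ τ hτ m
  refine (expOpC_bound (m := m) hk hk1 hν hκ (IsConic.sector d δ)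
    (C := C * (1 + |m|) ^ (-μ) * Real.exp (-β * |m|)) (by positivity) ?_ τ hτ).trans (le_of_eq ?_)
  · intro τ hτ
    exact (hf τ hτ m).trans (le_of_eq (by ring))
  · have : κ * (Real.Gamma (1 / k - 1) * ν ^ (1 - 1 / k)) * (k / Real.Gamma (1 / k - 1)) =
        κ * (k * ν ^ (1 - 1 / k)) := by
      generalize Real.Gamma (1 / k - 1) = G at hΓ ⊢
      field_simp
    rw [this]; ring

theorem LocBdd.rayInt {S : Set ℂ} (hS : IsConic S) {k : ℝ} (hk : 0 < k) {φ : ℝ → ℝ}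
    (hφ : MeasureTheory.IntegrableOn φ (Ioo 0 1)) {g : ℂ → ℝ → ℂ} (hb : LocBdd S g) :
    LocBdd S (rayInt k φ g) := by
  intro R
  obtain ⟨C, hC⟩ := hb R
  refine ⟨∫ u in Ioo (0 : ℝ) 1, ‖φ u‖ * C, fun τ hτ hR m => ?_⟩
  refine MeasureTheory.norm_integral_le_of_norm_le (hφ.norm.mul_const C) ?_
  filter_upwards [MeasureTheory.ae_restrict_mem measurableSet_Ioo] with u hu
  rw [norm_mul, Complex.norm_real]
  exact mul_le_mul_of_nonneg_left
    (hC _ (hS.scale_mem hk hu hτ) ((norm_scale_le hk hu τ).trans_lt hR) _) (norm_nonneg _)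

theorem locBdd_of_growth {k ν : ℝ} (hk : 0 < k) (hν : 0 < ν) {S : Set ℂ} {f : ℂ → ℝ → ℂ} {C : ℝ}
    (hC : 0 ≤ C) (h : ∀ τ ∈ S, ∀ m, ‖f τ m‖ ≤ C * ‖τ‖ ^ k * Real.exp (ν * ‖τ‖ ^ k)) :
    LocBdd S f := by
  intro R
  refine ⟨C * |R| ^ k * Real.exp (ν * |R| ^ k), fun τ hτ hR m => (h τ hτ m).trans ?_⟩
  have : ‖τ‖ ^ k ≤ |R| ^ k :=
    Real.rpow_le_rpow (norm_nonneg _) (hR.le.trans (le_abs_self R)) hk.le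
  gcongr

/-! ### Regularity and linearity of the iterates and of the exponential. -/

section Iterates

variable {k : ℝ} {S : Set ℂ} {f g : ℂ → ℝ → ℂ}

theorem integrableOn_opC_kernel (hk : 0 < k) (hk1 : k < 1) :
    MeasureTheory.IntegrableOn (fun u : ℝ => (1 - u) ^ (1 / k - 2)) (Ioo 0 1) := by
  have hc : 0 < 1 / k - 1 := by rw [sub_pos, lt_div_iff₀ hk]; linarith
  have := integrableOn_one_sub_rpow hc
  rwa [show (1 / k - 1 - 1 : ℝ) = 1 / k - 2 by ring] at this

theorem IsHC.opC (hSo : IsOpen S) (hS : IsConic S) (hk : 0 < k) (hk1 : k < 1) (hf : IsHC S f)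
    (hb : LocBdd S f) : IsHC S (opC k f) ∧ LocBdd S (opC k f) := by
  have hφ := integrableOn_opC_kernel hk hk1
  constructor
  · refine ((IsHC.of_fst (h := fun τ => ((k / Real.Gamma (1 / k - 1) : ℝ) : ℂ) * τ)
      (by fun_prop)).mul (hf.rayInt hSo hS hk hφ hb)).congr fun τ hτ m => ?_
    exact opC_eq_rayInt hk hk1 f (hS.ne_zero hτ) m
  · intro R
    obtain ⟨C, hC⟩ := hb.rayInt hS hk hφ R
    refine ⟨|k / Real.Gamma (1 / k - 1)| * |R| * C, fun τ hτ hR m => ?_⟩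
    rw [opC_eq_rayInt hk hk1 f (hS.ne_zero hτ), norm_mul, norm_mul, Complex.norm_real,
      Real.norm_eq_abs]
    have := hC τ hτ hR m
    have h2 := hR.le.trans (le_abs_self R)
    gcongr

theorem IsHC.opC_iterate (hSo : IsOpen S) (hS : IsConic S) (hk : 0 < k) (hk1 : k < 1)
    (hf : IsHC S f) (hb : LocBdd S f) (p : ℕ) :
    IsHC S ((_root_.opC k)^[p] f) ∧ LocBdd S ((_root_.opC k)^[p] f) := by
  induction p with
  | zero => exact ⟨hf, hb⟩
  | succ p ih =>
    rw [Function.iterate_succ_apply']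
    exact ih.1.opC hSo hS hk hk1 ih.2

theorem rayInt_congr (hS : IsConic S) (hk : 0 < k) (φ : ℝ → ℝ) {m : ℝ}
    (h : ∀ τ ∈ S, f τ m = g τ m) :
    ∀ τ ∈ S, rayInt k φ f τ m = rayInt k φ g τ m := by
  intro τ hτ
  refine MeasureTheory.setIntegral_congr_fun measurableSet_Ioo fun u hu => ?_
  simp only [h _ (hS.scale_mem hk hu hτ)]

theorem rayInt_sub (hS : IsConic S) (hk : 0 < k) {φ : ℝ → ℝ}
    (hφ : MeasureTheory.IntegrableOn φ (Ioo 0 1)) (hf : IsHC S f) (hfb : LocBdd S f)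
    (hg : IsHC S g) (hgb : LocBdd S g) {τ : ℂ} (hτ : τ ∈ S) (m : ℝ) :
    rayInt k φ (fun τ m => f τ m - g τ m) τ m = rayInt k φ f τ m - rayInt k φ g τ m := by
  rw [rayInt, rayInt, rayInt, ← MeasureTheory.integral_sub
    (hf.rayInt_integrand hS hk hφ hfb hτ m) (hg.rayInt_integrand hS hk hφ hgb hτ m)]
  simp only [mul_sub]

theorem opC_iterate_sub (hSo : IsOpen S) (hS : IsConic S) (hk : 0 < k) (hk1 : k < 1)
    (hf : IsHC S f) (hfb : LocBdd S f) (hg : IsHC S g) (hgb : LocBdd S g) (p : ℕ) :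
    ∀ m, ∀ τ ∈ S, ((opC k)^[p] fun τ m => f τ m - g τ m) τ m =
      ((opC k)^[p] f) τ m - ((opC k)^[p] g) τ m := by
  intro m
  induction p with
  | zero => exact fun τ _ => rfl
  | succ p ih =>
    intro τ hτ
    have hf' := hf.opC_iterate hSo hS hk hk1 hfb p
    have hg' := hg.opC_iterate hSo hS hk hk1 hgb p
    rw [Function.iterate_succ_apply', Function.iterate_succ_apply', Function.iterate_succ_apply',
      opC_eq_rayInt hk hk1 _ (hS.ne_zero hτ), opC_eq_rayInt hk hk1 _ (hS.ne_zero hτ),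
      opC_eq_rayInt hk hk1 _ (hS.ne_zero hτ), rayInt_congr (g := fun τ m => ((opC k)^[p] f) τ m - ((opC k)^[p] g) τ m) hS hk _ ih τ hτ,
      rayInt_sub hS hk (integrableOn_opC_kernel hk hk1) hf'.1 hf'.2 hg'.1 hg'.2 hτ]
    ring

variable {ν κ C : ℝ}

theorem IsHC.expOpC (hSo : IsOpen S) (hS : IsConic S) (hk : 0 < k) (hk1 : k < 1) (hν : 0 < ν)
    (hκ : 0 < κ) (hf : IsHC S f) (hC : 0 ≤ C)
    (h : ∀ τ ∈ S, ∀ m, ‖f τ m‖ ≤ C * ‖τ‖ ^ k * Real.exp (ν * ‖τ‖ ^ k)) :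
    IsHC S (expOpC k κ f) ∧ LocBdd S (expOpC k κ f) := by
  have hb := locBdd_of_growth hk hν hC h
  constructor
  · refine IsHC.tsum hSo (fun p => (IsHC.const _).mul (hf.opC_iterate hSo hS hk hk1 hb p).1) ?_
    intro R
    refine ⟨fun p => C * |R| ^ k * Real.exp (ν * |R| ^ k) *
        ((κ * (k * ν ^ (1 - 1 / k)) * |R| ^ k) ^ p / p.factorial),
      (Real.summable_pow_div_factorial _).mul_left _, fun p τ hτ hR m => ?_⟩
    refine (expOpC_term_bound hk hk1 hν hκ hS hC (fun τ hτ => h τ hτ m) p τ hτ).trans ?_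
    beta_reduce
    have : ‖τ‖ ^ k ≤ |R| ^ k :=
      Real.rpow_le_rpow (norm_nonneg _) (hR.le.trans (le_abs_self R)) hk.le
    gcongr
  · refine locBdd_of_growth (ν := ν + κ * (k * ν ^ (1 - 1 / k))) hk (by positivity) hC
      fun τ hτ m => ?_
    refine (expOpC_bound hk hk1 hν hκ hS hC (fun τ hτ => h τ hτ m) τ hτ).trans (le_of_eq ?_)
    rw [mul_assoc _ (Real.exp _), ← Real.exp_add]
    ring_nf

/-- The growth bounds are needed because integrals and series split over a difference only when both
parts converge. -/
theorem expOpC_sub (hSo : IsOpen S) (hS : IsConic S) (hk : 0 < k) (hk1 : k < 1) (hν : 0 < ν)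
    (hκ : 0 < κ) {C' : ℝ} (hf : IsHC S f) (hC : 0 ≤ C)
    (h : ∀ τ ∈ S, ∀ m, ‖f τ m‖ ≤ C * ‖τ‖ ^ k * Real.exp (ν * ‖τ‖ ^ k))
    (hg : IsHC S g) (hC' : 0 ≤ C')
    (h' : ∀ τ ∈ S, ∀ m, ‖g τ m‖ ≤ C' * ‖τ‖ ^ k * Real.exp (ν * ‖τ‖ ^ k)) :
    ∀ τ ∈ S, ∀ m, _root_.expOpC k κ (fun τ m => f τ m - g τ m) τ m =
      _root_.expOpC k κ f τ m - _root_.expOpC k κ g τ m := by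
  intro τ hτ m
  have hs : ∀ (C : ℝ) (f : ℂ → ℝ → ℂ), 0 ≤ C →
      (∀ τ ∈ S, ∀ m, ‖f τ m‖ ≤ C * ‖τ‖ ^ k * Real.exp (ν * ‖τ‖ ^ k)) →
      Summable fun p : ℕ =>
        (-1 : ℂ) ^ p * (κ : ℂ) ^ p / (p.factorial : ℂ) * ((_root_.opC k)^[p] f) τ m := by
    intro C f hC h
    exact Summable.of_norm_bounded ((Real.summable_pow_div_factorial _).mul_left _)
      fun p => expOpC_term_bound hk hk1 hν hκ hS hC (fun τ hτ => h τ hτ m) p τ hτ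
  rw [_root_.expOpC, _root_.expOpC, _root_.expOpC, ← (hs C f hC h).tsum_sub (hs C' g hC' h')]
  refine tsum_congr fun p => ?_
  rw [opC_iterate_sub hSo hS hk hk1 hf (locBdd_of_growth hk hν hC h) hg
    (locBdd_of_growth hk hν hC' h') p m τ hτ, mul_sub]

end Iterates

/-! ### Propagation of continuity in the parameter. -/

/-- Separate continuity, holomorphy and boundedness give joint continuity. -/
theorem IsHC.of_separately {U : Set ℂ} (hU : IsOpen U) {w : ℂ → ℝ → ℂ}
    (hd : ∀ m, DifferentiableOn ℂ (fun τ => w τ m) U) {M : ℝ} (hM : ∀ τ ∈ U, ∀ m, ‖w τ m‖ ≤ M)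
    (hc : ∀ τ ∈ U, Continuous (w τ)) : IsHC U w := by
  refine ⟨?_, hd⟩
  rintro ⟨z, m₀⟩ ⟨hz, -⟩
  refine ContinuousAt.continuousWithinAt ?_
  obtain ⟨r, hr, hrU⟩ := Metric.isOpen_iff.1 hU z hz
  -- By Schwarz's lemma the common bound `M` makes the functions Lipschitz in the first variable
  -- near `z`, uniformly in m.
  have hlip : ∀ y ∈ Metric.ball z r, ∀ m, dist (w y m) (w z m) ≤ (2 * M) / r * dist y z := by
    intro y hy m
    refine Complex.dist_le_div_mul_dist_of_mapsTo_ball ((hd m).mono hrU) ?_ hy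
    intro x hx
    rw [Metric.mem_closedBall, dist_eq_norm]
    have h1 := hM x (hrU hx) m
    have h2 := hM z hz m
    linarith [norm_sub_le (w x m) (w z m)]
  rw [ContinuousAt, tendsto_iff_dist_tendsto_zero]
  have hlim : Filter.Tendsto (fun p : ℂ × ℝ => (2 * M) / r * dist p.1 z + dist (w z p.2) (w z m₀))
      (nhds (z, m₀)) (nhds 0) := by
    have h1 : Continuous fun p : ℂ × ℝ => (2 * M) / r * dist p.1 z + dist (w z p.2) (w z m₀) :=
      (continuous_const.mul (continuous_fst.dist continuous_const)).add
        (((hc z hz).comp continuous_snd).dist continuous_const)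
    simpa using h1.tendsto (z, m₀)
  refine squeeze_zero' (Filter.Eventually.of_forall fun _ => dist_nonneg) ?_ hlim
  have hnear : Metric.ball z r ×ˢ (univ : Set ℝ) ∈ nhds (z, m₀) :=
    (Metric.isOpen_ball.prod isOpen_univ).mem_nhds ⟨Metric.mem_ball_self hr, mem_univ _⟩
  filter_upwards [hnear] with p hp
  exact (dist_triangle _ (w z p.2) _).trans (add_le_add_left (hlip _ hp.1 _) _)

/-- Joint continuity is uniform over compact sets of τ. This mode of convergence passes to
derivatives, and so gives continuity in m of the Taylor coefficients. -/
theorem IsHC.tendstoLocallyUniformlyOn {U : Set ℂ} (hU : IsOpen U) {w : ℂ → ℝ → ℂ}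
    (hw : IsHC U w) (m₀ : ℝ) :
    TendstoLocallyUniformlyOn (fun m τ => w τ m) (fun τ => w τ m₀) (nhds m₀) U := by
  rw [tendstoLocallyUniformlyOn_iff_forall_isCompact hU]
  intro K hK hKc V hV
  obtain ⟨v, hv, h⟩ := hKc.mem_uniformity_of_prod (f := fun (m : ℝ) (τ : ℂ) => w τ m)
    (s := univ) (q := m₀) (hw.cont.comp (f := fun p : ℝ × ℂ => (p.2, p.1)) (by fun_prop)
      fun p hp => ⟨hK hp.2, mem_univ _⟩) (mem_univ _) (symm_le_uniformity hV)
  rw [nhdsWithin_univ] at hv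
  filter_upwards [hv] with m hm x hx
  exact h m hm x hx

theorem IsHC.continuous_iteratedDeriv {U : Set ℂ} (hU : IsOpen U) {w : ℂ → ℝ → ℂ}
    (hw : IsHC U w) {σ : ℂ} (hσ : σ ∈ U) (n : ℕ) :
    Continuous fun m => iteratedDeriv n (fun τ => w τ m) σ := by
  refine continuous_iff_continuousAt.2 fun m₀ => ?_
  have key : (∀ m, DifferentiableOn ℂ (iteratedDeriv n fun τ => w τ m) U) ∧
      TendstoLocallyUniformlyOn (fun m => iteratedDeriv n fun τ => w τ m)
      (iteratedDeriv n fun τ => w τ m₀) (nhds m₀) U := by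
    induction n with
    | zero => exact ⟨fun m => by simpa using hw.holo m, by
        simpa using hw.tendstoLocallyUniformlyOn hU m₀⟩
    | succ n ih =>
      simp only [iteratedDeriv_succ]
      exact ⟨fun m => (ih.1 m).deriv hU, ih.2.deriv (Filter.Eventually.of_forall ih.1) hU⟩
  exact key.2.tendsto_at hσ

/-- Continuity in the parameter propagates from a neighbourhood of the centre to a disc. -/
theorem continuous_param_of_taylor {w : ℂ → ℝ → ℂ} {σ : ℂ} {R M : ℝ} (hR : 0 < R)
    (hd : ∀ m, DifferentiableOn ℂ (fun τ => w τ m) (Metric.closedBall σ R))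
    (hM : ∀ τ ∈ Metric.closedBall σ R, ∀ m, ‖w τ m‖ ≤ M)
    (hc : ∀ᶠ τ in nhds σ, Continuous (w τ)) {z : ℂ} (hz : z ∈ Metric.ball σ R) :
    Continuous (w z) := by
  obtain ⟨r, hr, hrc⟩ := Metric.eventually_nhds_iff_ball.1 hc
  have hmin : 0 < min r R := lt_min hr hR
  have hHC : IsHC (Metric.ball σ (min r R)) w := by
    have hsub : Metric.ball σ (min r R) ⊆ Metric.closedBall σ R :=
      (Metric.ball_subset_ball (min_le_right _ _)).trans Metric.ball_subset_closedBall
    exact IsHC.of_separately Metric.isOpen_ball (fun m => (hd m).mono hsub)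
      (fun τ hτ => hM τ (hsub hτ)) fun τ hτ => hrc τ (Metric.ball_subset_ball (min_le_left _ _) hτ)
  have hM0 : 0 ≤ M := (norm_nonneg _).trans (hM σ (Metric.mem_closedBall_self hR.le) 0)
  have hsum : ∀ m, ∑' n : ℕ, (n.factorial : ℂ)⁻¹ • (z - σ) ^ n •
      iteratedDeriv n (fun τ => w τ m) σ = w z m := fun m =>
    Complex.taylorSeries_eq_on_ball ((hd m).mono Metric.ball_subset_closedBall) hz
  have hfun : w z = fun m => ∑' n : ℕ, (n.factorial : ℂ)⁻¹ • (z - σ) ^ n •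
      iteratedDeriv n (fun τ => w τ m) σ := funext fun m => (hsum m).symm
  rw [hfun]
  have hq : ‖z - σ‖ / R < 1 := by
    rw [div_lt_one hR, ← dist_eq_norm]; exact hz
  -- Cauchy's estimates on the large disc bound the Taylor terms by a geometric sequence independent
  -- of m, so a series of continuous functions of m converges uniformly.
  refine continuous_tsum (u := fun n => M * (‖z - σ‖ / R) ^ n) (fun n => ?_)
    ((summable_geometric_of_lt_one (by positivity) hq).mul_left _) ?_
  · have := hHC.continuous_iteratedDeriv Metric.isOpen_ball (Metric.mem_ball_self hmin) n
    fun_prop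
  · intro n m
    have h1 := Complex.norm_iteratedDeriv_le_of_forall_mem_sphere_norm_le n hR
      ((hd m).diffContOnCl_ball le_rfl) fun y hy => hM y (Metric.sphere_subset_closedBall hy) m
    rw [norm_smul, norm_smul, norm_inv, Complex.norm_natCast, norm_pow]
    have hn : (0 : ℝ) < n.factorial := by exact_mod_cast n.factorial_pos
    calc _ ≤ (n.factorial : ℝ)⁻¹ * (‖z - σ‖ ^ n * (n.factorial * M / R ^ n)) := by gcongr
      _ = M * (‖z - σ‖ / R) ^ n := by rw [div_pow]; field_simp

/-- A weak form of Vitali's theorem: for a bounded family of holomorphic functions on a connected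
domain, continuity in the parameter propagates from an open subset. -/
theorem continuous_param_of_preconnected {U V : Set ℂ} (hU : IsOpen U) (hUc : IsPreconnected U)
    {w : ℂ → ℝ → ℂ} (hd : ∀ m, DifferentiableOn ℂ (fun τ => w τ m) U) {M : ℝ}
    (hM : ∀ τ ∈ U, ∀ m, ‖w τ m‖ ≤ M) (hV : IsOpen V) (hVU : (U ∩ V).Nonempty)
    (hc : ∀ τ ∈ V, Continuous (w τ)) : ∀ τ ∈ U, Continuous (w τ) := by
  -- It suffices that the interior of the continuity set is relatively closed in `U`: a Taylor disc
  -- of radius r/2 about an interior point at distance less than r/3 covers the given limit point.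
  have hsub : U ⊆ interior {τ | Continuous (w τ)} := by
    refine hUc.subset_of_closure_inter_subset isOpen_interior ?_ ?_
    · obtain ⟨x, hxU, hxV⟩ := hVU
      exact ⟨x, hxU, interior_maximal hc hV hxV⟩
    · rintro τ ⟨hτ, hτU⟩
      obtain ⟨r, hr, hrU⟩ := Metric.isOpen_iff.1 hU τ hτU
      obtain ⟨σ, hσ, hτσ⟩ := Metric.mem_closure_iff.1 hτ (r / 3) (by positivity)
      have hcl : Metric.closedBall σ (r / 2) ⊆ U := by
        refine Subset.trans (fun y hy => ?_) hrU
        rw [Metric.mem_closedBall] at hy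
        rw [Metric.mem_ball]
        linarith [dist_triangle y σ τ, dist_comm σ τ]
      have hball : Metric.ball σ (r / 2) ⊆ {τ | Continuous (w τ)} := fun z hz =>
        continuous_param_of_taylor (by positivity) (fun m => (hd m).mono hcl)
          (fun y hy => hM y (hcl hy)) (mem_interior_iff_mem_nhds.1 hσ) hz
      exact interior_maximal hball Metric.isOpen_ball (by rw [Metric.mem_ball]; linarith)
  exact fun τ hτ => (interior_subset (hsub hτ) : τ ∈ {τ | Continuous (w τ)})

theorem IsHC.of_tendsto {S : Set ℂ} (hS : IsOpen S) {f : ℕ → ℂ → ℝ → ℂ} {g : ℂ → ℝ → ℂ}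
    (hf : ∀ n, IsHC S (f n)) {q : ℝ} (hq0 : 0 ≤ q) (hq1 : q < 1)
    (h : ∀ R : ℝ, ∃ C : ℝ, ∀ n, ∀ τ ∈ S, ‖τ‖ < R → ∀ m, ‖f n τ m - g τ m‖ ≤ C * q ^ n) :
    IsHC S g := by
  refine IsHC.of_ball fun R => ?_
  obtain ⟨C, hC⟩ := h R
  have hlim : Filter.Tendsto (fun n : ℕ => C * q ^ n) Filter.atTop (nhds 0) := by
    simpa using (tendsto_pow_atTop_nhds_zero_of_lt_one hq0 hq1).const_mul C
  constructor
  · refine TendstoUniformlyOn.continuousOn (F := fun (n : ℕ) (p : ℂ × ℝ) => f n p.1 p.2)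
      (p := Filter.atTop) ?_ (Filter.Frequently.of_forall fun n =>
        (hf n).cont.mono (prod_mono inter_subset_left le_rfl))
    rw [Metric.tendstoUniformlyOn_iff]
    intro ε hε
    filter_upwards [hlim.eventually_lt_const hε] with n hn p hp
    rw [dist_comm, dist_eq_norm]
    exact (hC n _ hp.1.1 (by simpa using hp.1.2) _).trans_lt hn
  · intro m
    refine TendstoLocallyUniformlyOn.differentiableOn (F := fun n τ => f n τ m)
      (φ := Filter.atTop) ?_ (Filter.Eventually.of_forall fun n => ((hf n).holo m).mono
        inter_subset_left) (hS.inter Metric.isOpen_ball)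
    refine TendstoUniformlyOn.tendstoLocallyUniformlyOn ?_
    rw [Metric.tendstoUniformlyOn_iff]
    intro ε hε
    filter_upwards [hlim.eventually_lt_const hε] with n hn τ hτ
    rw [dist_comm, dist_eq_norm]
    exact (hC n _ hτ.1 (by simpa using hτ.2) _).trans_lt hn

/-! ### Contractions of a weighted ball. -/

/-- The function `w` is `IsHC` and bounded by `C` times the weight `W`. -/
def InBall (S : Set ℂ) (W : ℂ → ℝ → ℝ) (C : ℝ) (w : ℂ → ℝ → ℂ) : Prop :=
  IsHC S w ∧ ∀ τ ∈ S, ∀ m, ‖w τ m‖ ≤ C * W τ m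

/-- Two fixed points in the ball differ by at most 2W, and each use of the contraction halves this
bound. Pointwise weighted bounds on `S` avoid any quotient by the values taken off `S`. -/
theorem unique_fixedPoint_of_contraction {S : Set ℂ} {W : ℂ → ℝ → ℝ} {T : (ℂ → ℝ → ℂ) → ℂ → ℝ → ℂ}
    (hcontr : ∀ w w', InBall S W 1 w → InBall S W 1 w' → ∀ D : ℝ, 0 < D →
      (∀ τ ∈ S, ∀ m, ‖w τ m - w' τ m‖ ≤ D * W τ m) →
      ∀ τ ∈ S, ∀ m, ‖T w τ m - T w' τ m‖ ≤ D / 2 * W τ m)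
    {w w' : ℂ → ℝ → ℂ} (hw : InBall S W 1 w) (hw' : InBall S W 1 w')
    (hT : ∀ τ ∈ S, ∀ m, T w τ m = w τ m) (hT' : ∀ τ ∈ S, ∀ m, T w' τ m = w' τ m) :
    ∀ τ ∈ S, ∀ m, w τ m = w' τ m := by
  have key : ∀ n : ℕ, ∀ τ ∈ S, ∀ m, ‖w τ m - w' τ m‖ ≤ 2 / 2 ^ n * W τ m := by
    intro n
    induction n with
    | zero =>
      intro τ hτ m
      have h1 := hw.2 τ hτ m
      have h2 := hw'.2 τ hτ m
      have := norm_sub_le (w τ m) (w' τ m)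
      norm_num; linarith
    | succ n ih =>
      intro τ hτ m
      have := hcontr w w' hw hw' _ (by positivity) ih τ hτ m
      rw [hT τ hτ, hT' τ hτ] at this
      refine this.trans (le_of_eq ?_)
      rw [pow_succ]; field_simp
  intro τ hτ m
  rw [← sub_eq_zero, ← norm_le_zero_iff]
  have hlim : Filter.Tendsto (fun n : ℕ => 2 / 2 ^ n * W τ m) Filter.atTop (nhds 0) := by
    have := (tendsto_pow_atTop_nhds_zero_of_lt_one (r := (1 / 2 : ℝ)) (by norm_num)
      (by norm_num)).const_mul (2 * W τ m)
    simp only [mul_zero] at this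
    refine this.congr fun n => ?_
    rw [one_div, inv_pow]; ring
  exact ge_of_tendsto' hlim fun n => key n τ hτ m

/-- Picard iteration from 0. As W is bounded on bounded parts of `S`, the geometric convergence is
uniform there, and the limit inherits continuity and holomorphy. -/
theorem exists_fixedPoint_of_contraction {S : Set ℂ} (hS : IsOpen S) {W : ℂ → ℝ → ℝ}
    (hW0 : ∀ τ ∈ S, ∀ m, 0 ≤ W τ m)
    (hW : ∀ R : ℝ, ∃ C : ℝ, ∀ τ ∈ S, ‖τ‖ < R → ∀ m, W τ m ≤ C)
    {T : (ℂ → ℝ → ℂ) → ℂ → ℝ → ℂ} (hself : ∀ w, InBall S W 1 w → InBall S W 1 (T w))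
    (hcontr : ∀ w w', InBall S W 1 w → InBall S W 1 w' → ∀ D : ℝ, 0 < D →
      (∀ τ ∈ S, ∀ m, ‖w τ m - w' τ m‖ ≤ D * W τ m) →
      ∀ τ ∈ S, ∀ m, ‖T w τ m - T w' τ m‖ ≤ D / 2 * W τ m) :
    ∃ w, InBall S W 1 w ∧ ∀ τ ∈ S, ∀ m, T w τ m = w τ m := by
  let f : ℕ → ℂ → ℝ → ℂ := fun n => T^[n] 0
  have hfs : ∀ n, f (n + 1) = T (f n) := fun n => Function.iterate_succ_apply' T n 0
  have hf : ∀ n, InBall S W 1 (f n) := by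
    intro n
    induction n with
    | zero => exact ⟨IsHC.const 0, fun τ hτ m => by simpa [f] using hW0 τ hτ m⟩
    | succ n ih => rw [hfs]; exact hself _ ih
  have hstep : ∀ n, ∀ τ ∈ S, ∀ m, ‖f n τ m - f (n + 1) τ m‖ ≤ 2 / 2 ^ n * W τ m := by
    intro n
    induction n with
    | zero =>
      intro τ hτ m
      have h1 := (hf 0).2 τ hτ m
      have h2 := (hf 1).2 τ hτ m
      have := norm_sub_le (f 0 τ m) (f 1 τ m)
      norm_num; linarith
    | succ n ih =>
      intro τ hτ m
      rw [hfs, hfs]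
      refine (hcontr _ _ (hf n) (hf (n + 1)) _ (by positivity) ih τ hτ m).trans (le_of_eq ?_)
      rw [pow_succ]; field_simp
  have hdist : ∀ τ ∈ S, ∀ m, ∀ n, dist (f n τ m) (f (n + 1) τ m) ≤ 4 * W τ m / 2 / 2 ^ n := by
    intro τ hτ m n
    rw [dist_eq_norm]
    exact (hstep n τ hτ m).trans (le_of_eq (by ring))
  -- Off `S` nothing is known to converge; the value given there by `limUnder` plays no role.
  let w : ℂ → ℝ → ℂ := fun τ m => Filter.atTop.limUnder fun n => f n τ m
  have hlim : ∀ τ ∈ S, ∀ m, Filter.Tendsto (fun n => f n τ m) Filter.atTop (nhds (w τ m)) :=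
    fun τ hτ m => (cauchySeq_of_le_geometric_two (hdist τ hτ m)).tendsto_limUnder
  have hfw : ∀ n, ∀ τ ∈ S, ∀ m, ‖f n τ m - w τ m‖ ≤ 4 / 2 ^ n * W τ m := by
    intro n τ hτ m
    rw [← dist_eq_norm]
    refine (dist_le_of_le_geometric_two_of_tendsto (hdist τ hτ m) (hlim τ hτ m) n).trans
      (le_of_eq (by ring))
  have hwball : InBall S W 1 w := by
    constructor
    · refine IsHC.of_tendsto hS (fun n => (hf n).1) (q := 1 / 2) (by norm_num) (by norm_num)
        fun R => ?_
      obtain ⟨C, hC⟩ := hW R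
      refine ⟨4 * C, fun n τ hτ hR m => (hfw n τ hτ m).trans ?_⟩
      have := hC τ hτ hR m
      rw [one_div, inv_pow, div_mul_eq_mul_div, ← div_eq_mul_inv]
      gcongr
    · intro τ hτ m
      exact le_of_tendsto' (hlim τ hτ m).norm fun n => (hf n).2 τ hτ m
  refine ⟨w, hwball, fun τ hτ m => ?_⟩
  refine tendsto_nhds_unique (f := fun n => f (n + 1) τ m) ?_
    ((hlim τ hτ m).comp (Filter.tendsto_add_atTop_nat 1))
  rw [tendsto_iff_norm_sub_tendsto_zero]
  have hz : Filter.Tendsto (fun n : ℕ => 4 / 2 ^ n / 2 * W τ m) Filter.atTop (nhds 0) := by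
    have := (tendsto_pow_atTop_nhds_zero_of_lt_one (r := (1 / 2 : ℝ)) (by norm_num)
      (by norm_num)).const_mul (2 * W τ m)
    simp only [mul_zero] at this
    refine this.congr fun n => ?_
    rw [one_div, inv_pow]; ring
  refine squeeze_zero (fun _ => norm_nonneg _) (fun n => ?_) hz
  rw [hfs]
  exact hcontr _ _ (hf n) hwball _ (by positivity) (hfw n) τ hτ m

/-! ### Sectors -/

theorem mem_sector_abs_arg_lt {d δ : ℝ} {τ : ℂ} (hτ : τ ∈ sector d δ) :
    |Complex.arg τ| < |d| + δ := by
  have h1 : |Complex.arg τ| ≤ |d| + |d - Complex.arg τ| := by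
    have := abs_sub_abs_le_abs_sub (Complex.arg τ) d
    rw [abs_sub_comm] at this
    linarith
  linarith [hτ.2]

theorem sector_subset_slitPlane {d δ : ℝ} (h : |d| + δ < Real.pi) :
    sector d δ ⊆ Complex.slitPlane := by
  intro τ hτ
  refine Complex.mem_slitPlane_iff_arg.2 ⟨fun h1 => ?_, hτ.1⟩
  have := mem_sector_abs_arg_lt hτ
  rw [h1, abs_of_pos Real.pi_pos] at this
  linarith

theorem isOpen_sector {d δ : ℝ} (h : |d| + δ < Real.pi) : IsOpen (sector d δ) := by
  have h1 : sector d δ = Complex.slitPlane ∩ Complex.arg ⁻¹' {t | |d - t| < δ} := by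
    ext τ
    constructor
    · exact fun hτ => ⟨sector_subset_slitPlane h hτ, hτ.2⟩
    · exact fun hτ => ⟨Complex.slitPlane_ne_zero hτ.1, hτ.2⟩
  rw [h1]
  refine ContinuousOn.isOpen_inter_preimage
    (fun z hz => (Complex.continuousAt_arg hz).continuousWithinAt) Complex.isOpen_slitPlane ?_
  exact isOpen_lt (by fun_prop) continuous_const

theorem isOpen_tauDomain {d δ ρ : ℝ} (h : |d| + δ < Real.pi) : IsOpen (tauDomain d δ ρ) :=
  (isOpen_sector h).union (Metric.isOpen_ball.inter Complex.isOpen_slitPlane)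

theorem tauDomain_subset_slitPlane {d δ ρ : ℝ} (h : |d| + δ < Real.pi) :
    tauDomain d δ ρ ⊆ Complex.slitPlane :=
  union_subset (sector_subset_slitPlane h) inter_subset_right

theorem isConic_cutDisc (ρ : ℝ) : IsConic (cutDisc ρ) := by
  constructor
  · rintro τ ⟨h1, h2⟩ t ht ht1
    refine ⟨?_, ?_⟩
    · rw [mem_ball_zero_iff] at h1 ⊢
      rw [norm_mul, Complex.norm_real, Real.norm_of_nonneg ht.le]
      exact (mul_le_of_le_one_left (norm_nonneg _) ht1.le).trans_lt h1
    · rw [Complex.mem_slitPlane_iff_arg] at h2 ⊢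
      rw [Complex.arg_real_mul _ ht]
      exact ⟨h2.1, mul_ne_zero (by exact_mod_cast ht.ne') h2.2⟩
  · exact fun h => Complex.slitPlane_ne_zero h.2 rfl

theorem isConic_tauDomain (d δ ρ : ℝ) : IsConic (tauDomain d δ ρ) := by
  constructor
  · rintro τ (h | h) t ht ht1
    · exact Or.inl ((IsConic.sector d δ).1 τ h t ht ht1)
    · exact Or.inr ((isConic_cutDisc ρ).1 τ h t ht ht1)
  · rintro (h | h)
    · exact (IsConic.sector d δ).2 h
    · exact (isConic_cutDisc ρ).2 h

theorem isPreconnected_cutDisc (ρ : ℝ) : IsPreconnected (cutDisc ρ) := by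
  rcases le_or_gt ρ 0 with h | h
  · rw [cutDisc, Metric.ball_eq_empty.2 h, empty_inter]
    exact isPreconnected_empty
  · have hmem : ((ρ / 2 : ℝ) : ℂ) ∈ Metric.ball (0 : ℂ) ρ := by
      rw [mem_ball_zero_iff, Complex.norm_real, Real.norm_of_nonneg (by positivity)]
      linarith
    have h1 : StarConvex ℝ ((ρ / 2 : ℝ) : ℂ) (cutDisc ρ) :=
      ((convex_ball (0 : ℂ) ρ).starConvex hmem).inter
        (Complex.starConvex_ofReal_slitPlane (by positivity))
    exact h1.isPathConnected ⟨hmem, Complex.ofReal_mem_slitPlane.2 (by positivity)⟩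
      |>.isConnected.isPreconnected

/-- A common point is where continuity in m starts to spread from the sector into the cut disc. -/
theorem sector_inter_cutDisc_nonempty {d δ ρ : ℝ} (hδ : 0 < δ) (hρ : 0 < ρ)
    (h : |d| + δ < Real.pi) : (cutDisc ρ ∩ sector d δ).Nonempty := by
  have hd := abs_lt.1 (show |d| < Real.pi by linarith)
  let τ : ℂ := ((ρ / 2 : ℝ) : ℂ) * Complex.exp (d * Complex.I)
  have hρ2 : 0 < ρ / 2 := by positivity
  have harg : Complex.arg τ = d := by
    simp only [τ]
    rw [Complex.arg_real_mul _ hρ2, Complex.arg_exp_mul_I, toIocMod_eq_self]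
    exact ⟨hd.1, by linarith [hd.2]⟩
  have hsec : τ ∈ sector d δ := by
    refine ⟨mul_ne_zero (by exact_mod_cast hρ2.ne') (Complex.exp_ne_zero _), ?_⟩
    rw [harg, sub_self, abs_zero]; exact hδ
  refine ⟨τ, ⟨?_, sector_subset_slitPlane h hsec⟩, hsec⟩
  rw [mem_ball_zero_iff, norm_mul, Complex.norm_exp_ofReal_mul_I, mul_one, Complex.norm_real,
    Real.norm_of_nonneg hρ2.le]
  linarith

/-! ### The function `H` -/

theorem arg_eq_arctan_of_re_pos {z : ℂ} (hz : 0 < z.re) :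
    Complex.arg z = Real.arctan (z.im / z.re) := by
  have h := abs_lt.1 (Complex.abs_arg_lt_pi_div_two_iff.2 (Or.inl hz))
  rw [← Complex.tan_arg, Real.arctan_tan h.1 h.2]

theorem rootA_re (Q RD : Polynomial ℂ) (l : ℤ) (m : ℝ) :
    (rootA Q RD l m).re = Real.log ‖evalI Q m / evalI RD m‖ := by
  simp [rootA]

theorem rootA_im (Q RD : Polynomial ℂ) (l : ℤ) (m : ℝ) :
    (rootA Q RD l m).im = Complex.arg (evalI Q m / evalI RD m) + 2 * l * Real.pi := by
  simp [rootA]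

theorem rootA_eq_log (Q RD : Polynomial ℂ) (l : ℤ) (m : ℝ) :
    rootA Q RD l m = Complex.log (evalI Q m / evalI RD m) + l * (2 * Real.pi * Complex.I) := by
  rw [rootA, Complex.log]; ring

/-- The real part of a_l is positive and independent of l while the imaginary part tends to
infinity, so arg a_l tends to π/2. -/
theorem exists_rootA_arg_gt {Q RD : Polynomial ℂ} {m θ : ℝ}
    (hb : 1 < ‖evalI Q m / evalI RD m‖) (hθ : θ < Real.pi / 2) :
    ∃ l : ℤ, θ < Complex.arg (rootA Q RD l m) := by
  have hb' := Real.log_pos hb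
  have h1 := (tendsto_nhds_of_tendsto_nhdsWithin Real.tendsto_arctan_atTop).eventually_const_lt hθ
  obtain ⟨Y, hY⟩ := Filter.eventually_atTop.1 h1
  obtain ⟨n, hn⟩ := exists_nat_ge ((Y * Real.log ‖evalI Q m / evalI RD m‖ + Real.pi) / (2 * Real.pi))
  refine ⟨n, ?_⟩
  rw [arg_eq_arctan_of_re_pos (by rw [rootA_re]; exact hb'), rootA_re, rootA_im]
  refine hY _ ?_
  rw [le_div_iff₀ hb']
  rw [div_le_iff₀ (by positivity)] at hn
  have := Complex.neg_pi_lt_arg (evalI Q m / evalI RD m)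
  push_cast
  linarith

theorem exists_rootA_arg_lt {Q RD : Polynomial ℂ} {m θ : ℝ}
    (hb : 1 < ‖evalI Q m / evalI RD m‖) (hθ : -(Real.pi / 2) < θ) :
    ∃ l : ℤ, Complex.arg (rootA Q RD l m) < θ := by
  have hb' := Real.log_pos hb
  have h1 := (tendsto_nhds_of_tendsto_nhdsWithin Real.tendsto_arctan_atBot).eventually_lt_const hθ
  obtain ⟨Y, hY⟩ := Filter.eventually_atBot.1 h1
  obtain ⟨n, hn⟩ := exists_nat_ge ((-Y * Real.log ‖evalI Q m / evalI RD m‖ + Real.pi) / (2 * Real.pi))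
  refine ⟨-n, ?_⟩
  rw [arg_eq_arctan_of_re_pos (by rw [rootA_re]; exact hb'), rootA_re, rootA_im]
  refine hY _ ?_
  rw [div_le_iff₀ hb']
  rw [div_le_iff₀ (by positivity)] at hn
  have := Complex.arg_le_pi (evalI Q m / evalI RD m)
  push_cast
  linarith

theorem rootTau_norm {k α : ℝ} (hk : 0 < k) (hα : 0 < α) (Q RD : Polynomial ℂ) (l : ℤ) (m : ℝ) :
    ‖rootTau k α Q RD l m‖ = (‖rootA Q RD l m‖ / (α * k)) ^ (1 / k) := by
  rw [rootTau, mul_comm Complex.I, norm_mul, Complex.norm_exp_ofReal_mul_I, mul_one,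
    Complex.norm_real, Real.norm_of_nonneg (by positivity), norm_div, norm_mul, Complex.norm_real,
    Complex.norm_real, Real.norm_of_nonneg hα.le, Real.norm_of_nonneg hk.le]

/-- What avoiding the points `τ_l` means for the logarithms `a_l`. -/
theorem rootA_of_rootTau_notMem {k α : ℝ} (hk : 1 / 2 < k) (hα : 0 < α) {Q RD : Polynomial ℂ}
    {l : ℤ} {m d δ' ρ' : ℝ} (hρ' : 0 ≤ ρ') (hb : 1 < ‖evalI Q m / evalI RD m‖)
    (h : rootTau k α Q RD l m ∉ sector d δ' ∪ Metric.ball (0 : ℂ) ρ') :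
    δ' ≤ |d - Complex.arg (rootA Q RD l m) / k| ∧ α * k * ρ' ^ k ≤ ‖rootA Q RD l m‖ := by
  have hk0 : 0 < k := by linarith
  set a := rootA Q RD l m with ha
  have hre : 0 < a.re := by rw [ha, rootA_re]; exact Real.log_pos hb
  have ha0 : a ≠ 0 := fun h0 => by rw [h0] at hre; simp at hre
  have harg := abs_lt.1 (Complex.abs_arg_lt_pi_div_two_iff.2 (Or.inl hre))
  rw [mem_union, not_or] at h
  have hr : 0 < ‖a‖ / (α * k) := div_pos (norm_pos_iff.2 ha0) (by positivity)
  have hnorm := rootTau_norm hk0 hα Q RD l m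
  have hne : rootTau k α Q RD l m ≠ 0 := by
    rw [← norm_pos_iff, hnorm]; exact Real.rpow_pos_of_pos hr _
  -- As |arg a| < π/2 and k > 1/2, the angle arg a / k already lies in the principal range.
  have hargτ : Complex.arg (rootTau k α Q RD l m) = Complex.arg a / k := by
    have hpos : 0 < ‖a / ((α : ℂ) * (k : ℂ))‖ ^ (1 / k) := by
      refine Real.rpow_pos_of_pos (norm_pos_iff.2 (div_ne_zero ha0 (mul_ne_zero ?_ ?_))) _
      · exact_mod_cast hα.ne'
      · exact_mod_cast hk0.ne'
    rw [rootTau, ← ha, Complex.arg_real_mul _ hpos, mul_comm Complex.I, Complex.arg_exp_mul_I,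
      toIocMod_eq_self]
    constructor
    · rw [lt_div_iff₀ hk0]; nlinarith [Real.pi_pos]
    · have : -Real.pi + 2 * Real.pi = Real.pi := by ring
      rw [this, div_le_iff₀ hk0]; nlinarith [Real.pi_pos]
  constructor
  · by_contra hlt
    exact h.1 ⟨hne, by rw [hargτ]; exact not_le.1 hlt⟩
  · have h2 := h.2
    rw [mem_ball_zero_iff, not_lt, hnorm] at h2
    have h3 := Real.rpow_le_rpow hρ' h2 hk0.le
    rw [← Real.rpow_mul hr.le, one_div_mul_cancel hk0.ne', Real.rpow_one,
      le_div_iff₀ (by positivity)] at h3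
    linarith

/-- The arguments of the τ_l accumulate at ±π/(2k). As |d| < π/2 and k < 1, these two directions lie
beyond the opposite edges of the sector, so a sector reaching past one of them would contain some
τ_l. -/
theorem sector_aperture_lt {k : ℝ} (hk : 1 / 2 < k) (hk1 : k < 1) {Q RD : Polynomial ℂ}
    {m d δ' : ℝ} (hd : -(Real.pi / 2) < d) (hd2 : d < Real.pi / 2) (hδ' : 0 < δ')
    (hb : 1 < ‖evalI Q m / evalI RD m‖)
    (h : ∀ l : ℤ, δ' ≤ |d - Complex.arg (rootA Q RD l m) / k|) :
    k * (|d| + δ') ≤ Real.pi / 2 := by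
  have hk0 : 0 < k := by linarith
  have hre : ∀ l, 0 < (rootA Q RD l m).re := fun l => by rw [rootA_re]; exact Real.log_pos hb
  have harg := fun l => abs_lt.1 (Complex.abs_arg_lt_pi_div_two_iff.2 (Or.inl (hre l)))
  have up : k * (d + δ') ≤ Real.pi / 2 := by
    by_contra hlt
    push Not at hlt
    obtain ⟨l, hl⟩ := exists_rootA_arg_gt (θ := k * (d - δ')) hb (by nlinarith)
    have h1 := h l
    have h2 := (harg l).2
    have h3 : Complex.arg (rootA Q RD l m) / k < d + δ' := by rw [div_lt_iff₀ hk0]; linarith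
    have h4 : d - δ' < Complex.arg (rootA Q RD l m) / k := by rw [lt_div_iff₀ hk0]; linarith
    have : |d - Complex.arg (rootA Q RD l m) / k| < δ' := by
      rw [abs_lt]; constructor <;> linarith
    linarith
  have dn : -(Real.pi / 2) ≤ k * (d - δ') := by
    by_contra hlt
    push Not at hlt
    obtain ⟨l, hl⟩ := exists_rootA_arg_lt (θ := k * (d + δ')) hb (by nlinarith)
    have h1 := h l
    have h2 := (harg l).1
    have h3 : Complex.arg (rootA Q RD l m) / k < d + δ' := by rw [div_lt_iff₀ hk0]; linarith
    have h4 : d - δ' < Complex.arg (rootA Q RD l m) / k := by rw [lt_div_iff₀ hk0]; linarith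
    have : |d - Complex.arg (rootA Q RD l m) / k| < δ' := by
      rw [abs_lt]; constructor <;> linarith
    linarith
  rcases abs_cases d with ⟨h1, _⟩ | ⟨h1, _⟩ <;> rw [h1] <;> linarith

/-- If e^z is within 1/2 of 1, then log e^z = z - 2πin for some n, and |log(1+w)| ≤ (3/2)|w| gives
the factor 2/3. -/
theorem exists_int_norm_one_sub_exp_ge (z : ℂ) :
    ∃ n : ℤ, min (1 / 2) (2 / 3 * ‖z - n * (2 * Real.pi * Complex.I)‖) ≤ ‖1 - Complex.exp z‖ := by
  rcases le_or_gt (1 / 2 : ℝ) ‖1 - Complex.exp z‖ with h | h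
  · exact ⟨0, (min_le_left _ _).trans h⟩
  · have h1 := Complex.norm_log_one_add_half_le_self (z := Complex.exp z - 1)
      (by rw [norm_sub_rev]; exact h.le)
    rw [add_sub_cancel] at h1
    have h2 : Complex.exp z = Complex.exp (Complex.log (Complex.exp z)) :=
      (Complex.exp_log (Complex.exp_ne_zero z)).symm
    obtain ⟨n, hn⟩ := Complex.exp_eq_exp_iff_exists_int.1 h2
    refine ⟨n, (min_le_right _ _).trans ?_⟩
    have h3 : z - n * (2 * Real.pi * Complex.I) = Complex.log (Complex.exp z) := by
      conv_lhs => rw [hn]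
      ring
    rw [h3]
    rw [norm_sub_rev] at h1
    linarith

theorem funH_eq {k α : ℝ} {Q RD : Polynomial ℂ} {m : ℝ} (hQ : evalI Q m ≠ 0)
    (hR : evalI RD m ≠ 0) (τ : ℂ) : funH k α Q RD τ m = evalI Q m *
      (1 - Complex.exp (α * k * τ ^ (k : ℂ) - Complex.log (evalI Q m / evalI RD m))) := by
  rw [funH, Complex.exp_sub, Complex.exp_log (div_ne_zero hQ hR)]
  field_simp

/-- H = Q (1 - e^z) with z = αkτ^k - log(Q/R_D), and the numbers z - 2πil are the differences αkτ^k
- a_l. Bounding H below relative to Q thus amounts to keeping αkτ^k away from the a_l. -/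
theorem norm_funH_ge_of_dist {k α r : ℝ} {Q RD : Polynomial ℂ} {m : ℝ} (hQ : evalI Q m ≠ 0)
    (hR : evalI RD m ≠ 0) {τ : ℂ}
    (h : ∀ l : ℤ, r ≤ ‖(α : ℂ) * k * τ ^ (k : ℂ) - rootA Q RD l m‖) :
    min (1 / 2) (2 / 3 * r) * ‖evalI Q m‖ ≤ ‖funH k α Q RD τ m‖ := by
  rw [funH_eq hQ hR, norm_mul, mul_comm]
  refine mul_le_mul_of_nonneg_left ?_ (norm_nonneg _)
  obtain ⟨n, hn⟩ := exists_int_norm_one_sub_exp_ge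
    (α * k * τ ^ (k : ℂ) - Complex.log (evalI Q m / evalI RD m))
  refine le_trans (min_le_min le_rfl ?_) hn
  have := h n
  rw [rootA_eq_log, ← sub_sub] at this
  linarith

/-- Rotate by -t and take the imaginary part. When the line of direction t separates the two points,
the left side is the sum of their distances to it. -/
theorem norm_polar_sub_ge (r θ r' φ t : ℝ) :
    r * Real.sin (θ - t) - r' * Real.sin (φ - t) ≤
      ‖(r : ℂ) * (Real.cos θ + Real.sin θ * Complex.I) -
        (r' : ℂ) * (Real.cos φ + Real.sin φ * Complex.I)‖ := by
  have h1 : ‖Complex.exp ((-t : ℝ) * Complex.I)‖ = 1 := Complex.norm_exp_ofReal_mul_I _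
  have h2 := Complex.abs_im_le_norm (((r : ℂ) * (Real.cos θ + Real.sin θ * Complex.I) -
        (r' : ℂ) * (Real.cos φ + Real.sin φ * Complex.I)) * Complex.exp ((-t : ℝ) * Complex.I))
  rw [norm_mul, h1, mul_one] at h2
  refine le_trans (le_of_eq ?_) ((le_abs_self _).trans h2)
  rw [Complex.exp_mul_I, ← Complex.ofReal_cos, ← Complex.ofReal_sin, Real.cos_neg, Real.sin_neg,
    Real.sin_sub, Real.sin_sub]
  simp [-Complex.ofReal_cos, -Complex.ofReal_sin]
  ring

theorem min_sin_le_sin {p q x : ℝ} (hp : 0 ≤ p) (hpx : p ≤ x) (hxq : x ≤ q) (hq : q ≤ Real.pi) :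
    min (Real.sin p) (Real.sin q) ≤ Real.sin x := by
  rcases le_total x (Real.pi / 2) with h | h
  · exact (min_le_left _ _).trans
      (Real.sin_le_sin_of_le_of_le_pi_div_two (by linarith [Real.pi_pos]) h hpx)
  · refine (min_le_right _ _).trans ?_
    rw [← Real.sin_pi_sub q, ← Real.sin_pi_sub x]
    exact Real.sin_le_sin_of_le_of_le_pi_div_two (by linarith [Real.pi_pos]) (by linarith)
      (by linarith)

theorem cpow_polar (τ : ℂ) (k : ℝ) : τ ^ (k : ℂ) = ((‖τ‖ ^ k : ℝ) : ℂ) *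
    (Real.cos (Complex.arg τ * k) + Real.sin (Complex.arg τ * k) * Complex.I) :=
  Complex.cpow_ofReal τ k

section LowerBound

variable {k α : ℝ} {Q RD : Polynomial ℂ} {d δ δ' ρ ρ' : ℝ}

/-- On the disc |αkτ^k| ≤ αkρ^k, whereas |a_l| ≥ αkρ'^k: the two radii leave a fixed margin. -/
theorem exists_norm_funH_ge_cutDisc (hk : 1 / 2 < k) (hα : 0 < α)
    (hQ : ∀ m : ℝ, evalI Q m ≠ 0) (hR : ∀ m : ℝ, evalI RD m ≠ 0) (hρ : 0 < ρ) (hρρ' : ρ < ρ')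
    (ha : ∀ (l : ℤ) (m : ℝ), α * k * ρ' ^ k ≤ ‖rootA Q RD l m‖) :
    ∃ A : ℝ, 0 < A ∧ ∀ τ ∈ cutDisc ρ, ∀ m : ℝ, A * ‖evalI Q m‖ ≤ ‖funH k α Q RD τ m‖ := by
  have hk0 : 0 < k := by linarith
  have hlt : ρ ^ k < ρ' ^ k := Real.rpow_lt_rpow hρ.le hρρ' hk0
  have hpos : 0 < α * k * (ρ' ^ k - ρ ^ k) := mul_pos (by positivity) (sub_pos.2 hlt)
  refine ⟨_, lt_min one_half_pos (mul_pos (by norm_num : (0 : ℝ) < 2 / 3) hpos), fun τ hτ m => ?_⟩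
  refine norm_funH_ge_of_dist (hQ m) (hR m) fun l => ?_
  have h1 : ‖(α : ℂ) * k * τ ^ (k : ℂ)‖ ≤ α * k * ρ ^ k := by
    have h2 : ‖τ‖ < ρ := by simpa using hτ.1
    rw [norm_mul, norm_mul, Complex.norm_cpow_real, Complex.norm_real, Complex.norm_real,
      Real.norm_of_nonneg hα.le, Real.norm_of_nonneg hk0.le]
    have h3 := Real.rpow_le_rpow (norm_nonneg _) h2.le hk0.le
    gcongr
  have h2 := ha l m
  have h3 := norm_sub_norm_le (rootA Q RD l m) ((α : ℂ) * k * τ ^ (k : ℂ))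
  rw [norm_sub_rev] at h3
  linarith

/-- αkτ^k lies in the sector of half-aperture kδ about the direction kd, every a_l outside the one
of half-aperture kδ'. Separation by the edge of the smaller sector on the side of a_l bounds the
distance below by |a_l| times a sine, and |a_l| is bounded below through ρ'. -/
theorem exists_norm_funH_ge_sector (hk : 1 / 2 < k) (hk1 : k < 1) (hα : 0 < α)
    (hQ : ∀ m : ℝ, evalI Q m ≠ 0) (hR : ∀ m : ℝ, evalI RD m ≠ 0)
    (hd : -(Real.pi / 2) < d) (hd2 : d < Real.pi / 2) (hδ : 0 < δ) (hδδ' : δ < δ') (hρ' : 0 < ρ')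
    (hap : k * (|d| + δ') ≤ Real.pi / 2) (hre : ∀ m, 1 < ‖evalI Q m / evalI RD m‖)
    (ha : ∀ (l : ℤ) (m : ℝ), δ' ≤ |d - Complex.arg (rootA Q RD l m) / k| ∧
      α * k * ρ' ^ k ≤ ‖rootA Q RD l m‖) :
    ∃ A : ℝ, 0 < A ∧ ∀ τ ∈ sector d δ, ∀ m : ℝ, A * ‖evalI Q m‖ ≤ ‖funH k α Q RD τ m‖ := by
  have hk0 : 0 < k := by linarith
  have hpi := Real.pi_pos
  have hdabs : d ≤ |d| := le_abs_self d
  have hdabs' : -d ≤ |d| := neg_le_abs d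
  -- The angle from the edge to a_l lies between k(δ'-δ) and π/2 + kπ/2, both inside (0, π); on such
  -- an interval the sine is smallest at an end.
  set s : ℝ := min (Real.sin (k * (δ' - δ))) (Real.sin (Real.pi / 2 + k * (Real.pi / 2))) with hs
  have hγ : 0 < k * (δ' - δ) := mul_pos hk0 (by linarith)
  have hγ2 : k * (δ' - δ) < Real.pi / 2 := by nlinarith [abs_nonneg d]
  have hs0 : 0 < s := lt_min (Real.sin_pos_of_pos_of_lt_pi hγ (by linarith))
    (Real.sin_pos_of_pos_of_lt_pi (by positivity) (by nlinarith))
  have hpos : 0 < α * k * ρ' ^ k * s := by positivity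
  refine ⟨_, lt_min one_half_pos (mul_pos (by norm_num : (0 : ℝ) < 2 / 3) hpos), fun τ hτ m => ?_⟩
  refine norm_funH_ge_of_dist (hQ m) (hR m) fun l => ?_
  obtain ⟨h1, h2⟩ := ha l m
  set a := rootA Q RD l m with hadef
  have hre : 0 < a.re := by rw [hadef, rootA_re]; exact Real.log_pos (hre m)
  obtain ⟨harg1, harg2⟩ := abs_lt.1 (Complex.abs_arg_lt_pi_div_two_iff.2 (Or.inl hre))
  set φ := Complex.arg a
  have hapolar : a = (‖a‖ : ℂ) * (Real.cos φ + Real.sin φ * Complex.I) := by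
    conv_lhs => rw [← Complex.norm_mul_cos_add_sin_mul_I a]
    simp [φ]
  set θ := Complex.arg τ * k with hθ
  have hbpolar : (α : ℂ) * k * τ ^ (k : ℂ) = ((α * k * ‖τ‖ ^ k : ℝ) : ℂ) *
      (Real.cos θ + Real.sin θ * Complex.I) := by
    rw [cpow_polar, Complex.ofReal_mul, Complex.ofReal_mul]; ring
  have hb0 : 0 ≤ α * k * ‖τ‖ ^ k := by positivity
  have hτ1 := abs_lt.1 hτ.2
  have e1 := mul_le_mul_of_nonneg_left hdabs hk0.le
  have e2 := mul_le_mul_of_nonneg_left hdabs' hk0.le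
  have e3 := mul_lt_mul_of_pos_left hδδ' hk0
  have e4 := mul_lt_mul_of_pos_left hd hk0
  have e5 := mul_lt_mul_of_pos_left hd2 hk0
  have e6 := mul_lt_mul_of_pos_left hτ1.1 hk0
  have e7 := mul_lt_mul_of_pos_left hτ1.2 hk0
  have e8 := mul_lt_mul_of_pos_right hk1 hpi
  have e9 := mul_pos hk0 hδ
  have e10 := mul_nonneg hk0.le (abs_nonneg d)
  have hsa : α * k * ρ' ^ k * s ≤ ‖a‖ * s := mul_le_mul_of_nonneg_right h2 hs0.le
  refine hsa.trans ?_
  rcases le_abs.1 h1 with h3 | h3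
  · -- `arg a ≤ k (d - δ')`
    have h4 : φ ≤ k * (d - δ') := by
      have : φ / k ≤ d - δ' := by linarith
      rw [div_le_iff₀ hk0] at this; linarith
    have h5 : s ≤ Real.sin (k * (d - δ) - φ) :=
      min_sin_le_sin hγ.le (by linarith) (by linarith) (by linarith)
    have h6 : 0 ≤ Real.sin (θ - k * (d - δ)) :=
      Real.sin_nonneg_of_nonneg_of_le_pi (by linarith) (by linarith)
    have h7 := norm_polar_sub_ge (α * k * ‖τ‖ ^ k) θ ‖a‖ φ (k * (d - δ))
    rw [← hbpolar, ← hapolar] at h7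
    have h8 : Real.sin (φ - k * (d - δ)) = - Real.sin (k * (d - δ) - φ) := by
      rw [← Real.sin_neg]; ring_nf
    rw [h8] at h7
    have h9 := mul_nonneg hb0 h6
    have h10 := mul_le_mul_of_nonneg_left h5 (norm_nonneg a)
    linarith
  · have h4 : k * (d + δ') ≤ φ := by
      have : d + δ' ≤ φ / k := by linarith
      rw [le_div_iff₀ hk0] at this; linarith
    have h5 : s ≤ Real.sin (φ - k * (d + δ)) :=
      min_sin_le_sin hγ.le (by linarith) (by linarith) (by linarith)
    have h6 : Real.sin (θ - k * (d + δ)) ≤ 0 :=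
      Real.sin_nonpos_of_nonpos_of_neg_pi_le (by linarith) (by linarith)
    have h7 := norm_polar_sub_ge ‖a‖ φ (α * k * ‖τ‖ ^ k) θ (k * (d + δ))
    rw [← hbpolar, ← hapolar, norm_sub_rev] at h7
    have h9 := mul_nonpos_of_nonneg_of_nonpos hb0 h6
    have h10 := mul_le_mul_of_nonneg_left h5 (norm_nonneg a)
    linarith

/-- On the sector Re τ^k ≥ c|τ|^k with c = cos(k(|d|+δ)) > 0. Where exp(kcα|τ|^k) ≥ 2r₂, the
exponential term of H has at least twice the modulus of Q. Elsewhere that exponential is bounded,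
and the constant bound `A` is enough. -/
theorem exists_norm_funH_ge_exp (hk : 1 / 2 < k) (hα : 0 < α)
    (hQ : ∀ m : ℝ, evalI Q m ≠ 0) (hR : ∀ m : ℝ, evalI RD m ≠ 0)
    (hap : k * (|d| + δ) < Real.pi / 2) {r₂ : ℝ}
    (hr₂ : ∀ m, ‖evalI Q m / evalI RD m‖ ≤ r₂) (hre : ∀ m, 1 < ‖evalI Q m / evalI RD m‖)
    {A : ℝ} (hA : 0 < A)
    (h : ∀ τ ∈ sector d δ, ∀ m : ℝ, A * ‖evalI Q m‖ ≤ ‖funH k α Q RD τ m‖) :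
    ∃ AH BH : ℝ, 0 < AH ∧ 0 < BH ∧ ∀ τ ∈ sector d δ, ∀ m : ℝ,
      AH * ‖evalI Q m‖ * Real.exp (BH * α * ‖τ‖ ^ k) ≤ ‖funH k α Q RD τ m‖ := by
  have hk0 : 0 < k := by linarith
  have hr₂0 : 0 < r₂ := by linarith [hr₂ 0, hre 0]
  rcases (sector d δ).eq_empty_or_nonempty with he | ⟨τ₀, hτ₀⟩
  · exact ⟨1, 1, one_pos, one_pos, by simp [he]⟩
  have hap0 : 0 ≤ |d| + δ := (abs_nonneg _).trans (mem_sector_abs_arg_lt hτ₀).le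
  obtain ⟨c, hc⟩ : ∃ c, c = Real.cos (k * (|d| + δ)) := ⟨_, rfl⟩
  have hc0 : 0 < c := hc ▸ Real.cos_pos_of_mem_Ioo
    ⟨by nlinarith [Real.pi_pos, mul_nonneg hk0.le hap0], hap⟩
  refine ⟨min (1 / (2 * r₂)) (A / (2 * r₂)), k * c, lt_min (one_div_pos.2 (mul_pos two_pos hr₂0)) (div_pos hA (mul_pos two_pos hr₂0)), mul_pos hk0 hc0, fun τ hτ m => ?_⟩
  obtain ⟨E, hE⟩ : ∃ E, E = Real.exp (k * c * α * ‖τ‖ ^ k) := ⟨_, rfl⟩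
  rw [← hE]
  have hE0 : 0 < E := hE ▸ Real.exp_pos _
  have hq0 : evalI Q m / evalI RD m ≠ 0 := div_ne_zero (hQ m) (hR m)
  have hnQ := norm_nonneg (evalI Q m)
  rcases le_or_gt (2 * r₂) E with hbig | hsmall
  · have hnorm : E / r₂ ≤
        ‖Complex.exp (α * k * τ ^ (k : ℂ) - Complex.log (evalI Q m / evalI RD m))‖ := by
      rw [Complex.exp_sub, Complex.exp_log hq0, norm_div, Complex.norm_exp]
      have h1 : k * c * α * ‖τ‖ ^ k ≤ ((α : ℂ) * k * τ ^ (k : ℂ)).re := by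
        have h2 : ((α : ℂ) * k * τ ^ (k : ℂ)).re = α * k * (‖τ‖ ^ k * Real.cos (Complex.arg τ * k)) := by
          rw [← Complex.ofReal_mul, Complex.re_ofReal_mul, Complex.cpow_ofReal_re]
        have h3 : c ≤ Real.cos (Complex.arg τ * k) := by
          rw [hc, ← Real.cos_abs (Complex.arg τ * k), abs_mul, abs_of_pos hk0, mul_comm]
          have h4 := (mem_sector_abs_arg_lt hτ).le
          exact Real.cos_le_cos_of_nonneg_of_le_pi (by positivity) (by linarith [Real.pi_pos])
            (by gcongr)
        rw [h2]
        have : 0 ≤ α * k * ‖τ‖ ^ k := by positivity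
        nlinarith
      have h5 := Real.exp_le_exp.2 h1
      rw [hE]
      exact div_le_div₀ (Real.exp_pos _).le h5 (by linarith [hre m]) (hr₂ m)
    have h2 : E / (2 * r₂) ≤
        ‖1 - Complex.exp (α * k * τ ^ (k : ℂ) - Complex.log (evalI Q m / evalI RD m))‖ := by
      have h3 := norm_sub_norm_le
        (Complex.exp (α * k * τ ^ (k : ℂ) - Complex.log (evalI Q m / evalI RD m))) 1
      rw [norm_sub_rev, norm_one] at h3
      have h4 : 1 ≤ E / (2 * r₂) := by rw [le_div_iff₀ (by positivity)]; linarith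
      have h5 : E / r₂ = 2 * (E / (2 * r₂)) := by field_simp
      linarith
    rw [funH_eq (hQ m) (hR m), norm_mul]
    calc _ ≤ 1 / (2 * r₂) * ‖evalI Q m‖ * E := by gcongr; exact min_le_left _ _
      _ = ‖evalI Q m‖ * (E / (2 * r₂)) := by ring
      _ ≤ _ := by gcongr
  · calc _ ≤ A / (2 * r₂) * ‖evalI Q m‖ * (2 * r₂) := by gcongr; exact min_le_right _ _
      _ = A * ‖evalI Q m‖ := by field_simp
      _ ≤ _ := h τ hτ m

end LowerBound

/-! ### Polynomials on the imaginary axis -/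

theorem exists_norm_evalI_le (P : Polynomial ℂ) :
    ∃ C : ℝ, 0 < C ∧ ∀ m : ℝ, ‖evalI P m‖ ≤ C * (1 + |m|) ^ P.natDegree := by
  refine ⟨(∑ i ∈ Finset.range (P.natDegree + 1), ‖P.coeff i‖) + 1, by positivity, fun m => ?_⟩
  rw [evalI, Polynomial.eval_eq_sum_range, add_mul, Finset.sum_mul]
  refine (norm_sum_le _ _).trans
    (le_add_of_le_of_nonneg (Finset.sum_le_sum fun i hi => ?_) (by positivity))
  rw [norm_mul, norm_pow, norm_mul, Complex.norm_I, one_mul, Complex.norm_real, Real.norm_eq_abs]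
  have h1 : (1 : ℝ) ≤ 1 + |m| := by linarith [abs_nonneg m]
  have h2 : |m| ^ i ≤ (1 + |m|) ^ P.natDegree :=
    (pow_le_pow_left₀ (abs_nonneg m) (by linarith) i).trans
      (pow_le_pow_right₀ h1 (Finset.mem_range_succ_iff.1 hi))
  gcongr

/-- No root r lies on the imaginary axis, so |im - r| is at least |Re r| and at least |m| - |r|,
hence at least a multiple of 1 + |m|. -/
theorem exists_norm_prod_sub_ge (s : Multiset ℂ) (hs : ∀ r ∈ s, ∀ m : ℝ, Complex.I * m - r ≠ 0) :
    ∃ c : ℝ, 0 < c ∧ ∀ m : ℝ,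
      c * (1 + |m|) ^ s.card ≤ ‖(s.map fun r => Complex.I * m - r).prod‖ := by
  induction s using Multiset.induction_on with
  | empty => exact ⟨1, one_pos, by simp⟩
  | cons r s ih =>
    obtain ⟨c, hc, h⟩ := ih fun r' hr' => hs r' (Multiset.mem_cons_of_mem hr')
    have hre : r.re ≠ 0 := by
      intro h0
      refine hs r (Multiset.mem_cons_self r s) r.im ?_
      rw [sub_eq_zero]
      apply Complex.ext <;> simp [h0]
    have hpos : 0 < |r.re| := abs_pos.2 hre
    set b := (1 + ‖r‖) / |r.re| + 1 with hb
    have hb0 : 0 < b := by positivity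
    refine ⟨b⁻¹ * c, by positivity, fun m => ?_⟩
    rw [Multiset.card_cons, Multiset.map_cons, Multiset.prod_cons, norm_mul]
    have h1 : |r.re| ≤ ‖Complex.I * m - r‖ := by
      have := Complex.abs_re_le_norm (Complex.I * m - r)
      simpa using this
    have h2 : |m| ≤ ‖Complex.I * m - r‖ + ‖r‖ := by
      have := norm_sub_norm_le (Complex.I * m) r
      rw [norm_mul, Complex.norm_I, one_mul, Complex.norm_real, Real.norm_eq_abs] at this
      linarith
    have h3 : 1 + |m| ≤ b * ‖Complex.I * m - r‖ := by
      have h4 : 1 + ‖r‖ ≤ (1 + ‖r‖) / |r.re| * ‖Complex.I * m - r‖ := by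
        rw [div_mul_eq_mul_div, le_div_iff₀ hpos]
        gcongr
      rw [hb, add_mul, one_mul]
      linarith
    have h5 : b⁻¹ * (1 + |m|) ≤ ‖Complex.I * m - r‖ := by
      rw [inv_mul_le_iff₀ hb0]; exact h3
    calc b⁻¹ * c * (1 + |m|) ^ (s.card + 1) = (b⁻¹ * (1 + |m|)) * (c * (1 + |m|) ^ s.card) := by
          rw [pow_succ]; ring
      _ ≤ _ := mul_le_mul h5 (h m) (by positivity) (norm_nonneg _)

theorem exists_norm_evalI_ge {Q : Polynomial ℂ} (hQ : ∀ m : ℝ, evalI Q m ≠ 0) :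
    ∃ c : ℝ, 0 < c ∧ ∀ m : ℝ, c * (1 + |m|) ^ Q.natDegree ≤ ‖evalI Q m‖ := by
  have hQ0 : Q ≠ 0 := by rintro rfl; exact hQ 0 (by simp [evalI])
  have hspl := IsAlgClosed.splits Q
  obtain ⟨c, hc, h⟩ := exists_norm_prod_sub_ge Q.roots fun r hr m h0 => by
    refine hQ m ?_
    rw [sub_eq_zero] at h0
    rw [evalI, h0]
    exact Polynomial.isRoot_of_mem_roots hr
  have hlc : 0 < ‖Q.leadingCoeff‖ := norm_pos_iff.2 (Polynomial.leadingCoeff_ne_zero.2 hQ0)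
  refine ⟨‖Q.leadingCoeff‖ * c, by positivity, fun m => ?_⟩
  rw [evalI, hspl.eval_eq_prod_roots, norm_mul, hspl.natDegree_eq_card_roots, mul_assoc]
  exact mul_le_mul_of_nonneg_left (h m) hlc.le

theorem exists_norm_evalI_le_of_natDegree_le {P Q : Polynomial ℂ} (h : P.natDegree ≤ Q.natDegree)
    (hQ : ∀ m : ℝ, evalI Q m ≠ 0) :
    ∃ C : ℝ, 0 < C ∧ ∀ m : ℝ, ‖evalI P m‖ ≤ C * ‖evalI Q m‖ := by
  obtain ⟨C, hC, h1⟩ := exists_norm_evalI_le P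
  obtain ⟨c, hc, h2⟩ := exists_norm_evalI_ge hQ
  refine ⟨C / c, by positivity, fun m => ?_⟩
  have h3 : (1 + |m|) ^ P.natDegree ≤ (1 + |m|) ^ Q.natDegree :=
    pow_le_pow_right₀ (by linarith [abs_nonneg m]) h
  calc _ ≤ C * (1 + |m|) ^ P.natDegree := h1 m
    _ ≤ C * (1 + |m|) ^ Q.natDegree := by gcongr
    _ = C / c * (c * (1 + |m|) ^ Q.natDegree) := by field_simp
    _ ≤ _ := by gcongr; exact h2 m

theorem continuous_evalI (P : Polynomial ℂ) : Continuous (evalI P) :=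
  P.continuous.comp (by fun_prop)

/-! ### The weight -/

/-- The weight in the variable `m`. -/
noncomputable def decay (β μ m : ℝ) : ℝ := (1 + |m|) ^ (-μ) * Real.exp (-β * |m|)

theorem decay_pos (β μ m : ℝ) : 0 < decay β μ m :=
  mul_pos (Real.rpow_pos_of_pos (by positivity) _) (Real.exp_pos _)

theorem decay_le_one {β μ : ℝ} (hβ : 0 ≤ β) (hμ : 0 ≤ μ) (m : ℝ) : decay β μ m ≤ 1 := by
  refine mul_le_one₀ ?_ (Real.exp_pos _).le ?_
  · exact Real.rpow_le_one_of_one_le_of_nonpos (by linarith [abs_nonneg m]) (by linarith)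
  · rw [Real.exp_le_one_iff, neg_mul, neg_nonpos]; positivity

/-- The inverse of the weight that defines the norm of `F^d_{(ν,β,μ,k,ρ)}`. -/
noncomputable def weight (ν β μ k : ℝ) (τ : ℂ) (m : ℝ) : ℝ :=
  ‖τ‖ ^ k / (1 + (‖τ‖ ^ k) ^ 2) * Real.exp (ν * ‖τ‖ ^ k) * decay β μ m

section Weight

variable {ν β μ k : ℝ}

theorem weight_nonneg (τ : ℂ) (m : ℝ) : 0 ≤ weight ν β μ k τ m :=
  mul_nonneg (by positivity) (decay_pos β μ m).le

theorem weight_le (τ : ℂ) (m : ℝ) :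
    weight ν β μ k τ m ≤ ‖τ‖ ^ k * Real.exp (ν * ‖τ‖ ^ k) * decay β μ m := by
  have h0 : 0 ≤ ‖τ‖ ^ k := by positivity
  have h : ‖τ‖ ^ k / (1 + (‖τ‖ ^ k) ^ 2) ≤ ‖τ‖ ^ k :=
    div_le_self h0 (by nlinarith [sq_nonneg (‖τ‖ ^ k)])
  have := (decay_pos β μ m).le
  rw [weight]
  gcongr

theorem weight_le_growth (hβ : 0 ≤ β) (hμ : 0 ≤ μ) (τ : ℂ) (m : ℝ) :
    weight ν β μ k τ m ≤ ‖τ‖ ^ k * Real.exp (ν * ‖τ‖ ^ k) :=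
  (weight_le τ m).trans (mul_le_of_le_one_right (by positivity) (decay_le_one hβ hμ m))

theorem weightedAbs_eq {τ : ℂ} (hτ : τ ≠ 0) (h : ℂ → ℝ → ℂ) (m : ℝ) :
    weightedAbs ν β μ k h τ m * weight ν β μ k τ m = ‖h τ m‖ := by
  have hx : 0 < ‖τ‖ ^ k := Real.rpow_pos_of_pos (norm_pos_iff.2 hτ) _
  have h2 : ‖τ‖ ^ (2 * k) = (‖τ‖ ^ k) ^ 2 := by
    rw [mul_comm, Real.rpow_mul (norm_nonneg _), Real.rpow_two]
  have hm : (0 : ℝ) < 1 + |m| := by positivity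
  have h3 : (1 + |m|) ^ μ * (1 + |m|) ^ (-μ) = 1 := by
    rw [← Real.rpow_add hm, add_neg_cancel, Real.rpow_zero]
  have h4 : Real.exp (β * |m| - ν * ‖τ‖ ^ k) * (Real.exp (ν * ‖τ‖ ^ k) * Real.exp (-β * |m|)) = 1 := by
    rw [← Real.exp_add, ← Real.exp_add]
    ring_nf
    exact Real.exp_zero
  rw [weightedAbs, weight, decay, h2]
  have h5 : (1 + (‖τ‖ ^ k) ^ 2) / ‖τ‖ ^ k * (‖τ‖ ^ k / (1 + (‖τ‖ ^ k) ^ 2)) = 1 := by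
    field_simp
  calc _ = ((1 + |m|) ^ μ * (1 + |m|) ^ (-μ)) *
        ((1 + (‖τ‖ ^ k) ^ 2) / ‖τ‖ ^ k * (‖τ‖ ^ k / (1 + (‖τ‖ ^ k) ^ 2))) *
        (Real.exp (β * |m| - ν * ‖τ‖ ^ k) * (Real.exp (ν * ‖τ‖ ^ k) * Real.exp (-β * |m|))) *
        ‖h τ m‖ := by ring
    _ = _ := by rw [h3, h4, h5]; ring

theorem weight_locBdd (hk : 0 < k) (hν : 0 < ν) (hβ : 0 ≤ β) (hμ : 0 ≤ μ) (R : ℝ) :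
    ∃ C : ℝ, ∀ τ : ℂ, ‖τ‖ < R → ∀ m, weight ν β μ k τ m ≤ C := by
  refine ⟨|R| ^ k * Real.exp (ν * |R| ^ k), fun τ hR m => (weight_le_growth hβ hμ τ m).trans ?_⟩
  have : ‖τ‖ ^ k ≤ |R| ^ k :=
    Real.rpow_le_rpow (norm_nonneg _) (hR.le.trans (le_abs_self R)) hk.le
  gcongr

variable {d δ ρ : ℝ} {h : ℂ → ℝ → ℂ}

theorem InBall.memF (hh : InBall (tauDomain d δ ρ) (weight ν β μ k) 1 h) :
    MemF ν β μ k d δ ρ h ∧ normF ν β μ k d δ ρ h ≤ 1 := by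
  have hle : ∀ p : tauDomain d δ ρ × ℝ, weightedAbs ν β μ k h p.1 p.2 ≤ 1 := by
    rintro ⟨⟨τ, hτ⟩, m⟩
    have hτ0 := (isConic_tauDomain d δ ρ).ne_zero hτ
    have h1 := hh.2 τ hτ m
    rw [← weightedAbs_eq (ν := ν) (β := β) (μ := μ) (k := k) hτ0 h m] at h1
    have hx : 0 < ‖τ‖ ^ k := Real.rpow_pos_of_pos (norm_pos_iff.2 hτ0) _
    have h2 : 0 < weight ν β μ k τ m := mul_pos (by positivity) (decay_pos β μ m)
    exact le_of_mul_le_mul_right h1 h2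
  exact ⟨⟨hh.1.cont.mono (prod_mono subset_union_left le_rfl), hh.1.holo,
    ⟨1, by rintro _ ⟨p, rfl⟩; exact hle p⟩⟩, Real.iSup_le hle zero_le_one⟩

/-- Over the cut disc a member of F is only known to be bounded there and holomorphic in τ for each
m. Its continuity in m spreads from the overlap with the sector by
`continuous_param_of_preconnected`. Uniqueness rests on this, the competing solution being an
arbitrary member of F. -/
theorem MemF.inBall (hk : 0 < k) (hν : 0 < ν) (hβ : 0 ≤ β) (hμ : 0 ≤ μ) (hδ : 0 < δ) (hρ : 0 < ρ)
    (hap : |d| + δ < Real.pi) (hh : MemF ν β μ k d δ ρ h) (hn : normF ν β μ k d δ ρ h ≤ 1) :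
    InBall (tauDomain d δ ρ) (weight ν β μ k) 1 h := by
  have hle : ∀ τ ∈ tauDomain d δ ρ, ∀ m, ‖h τ m‖ ≤ 1 * weight ν β μ k τ m := by
    intro τ hτ m
    rw [← weightedAbs_eq (ν := ν) (β := β) (μ := μ) (k := k)
      ((isConic_tauDomain d δ ρ).ne_zero hτ) h m]
    exact mul_le_mul_of_nonneg_right ((le_ciSup hh.bddAbove (⟨τ, hτ⟩, m)).trans hn)
      (weight_nonneg τ m)
  refine ⟨?_, hle⟩
  have hopen := isOpen_sector hap
  obtain ⟨C, hC⟩ := weight_locBdd hk hν hβ hμ ρ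
  have hcutopen : IsOpen (cutDisc ρ) := Metric.isOpen_ball.inter Complex.isOpen_slitPlane
  have hcut : ∀ τ ∈ cutDisc ρ, ∀ m, ‖h τ m‖ ≤ C := fun τ hτ m =>
    (hle τ (Or.inr hτ) m).trans (by rw [one_mul]; exact hC τ (by simpa using hτ.1) m)
  have hcont : ∀ τ ∈ sector d δ, Continuous (h τ) := fun τ hτ =>
    continuousOn_univ.1 (hh.continuousOn.comp (f := fun m : ℝ => (τ, m)) (by fun_prop)
      fun m _ => ⟨hτ, mem_univ _⟩)
  have hholo : ∀ m, DifferentiableOn ℂ (fun τ => h τ m) (cutDisc ρ) :=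
    fun m => (hh.holomorphic m).mono subset_union_right
  have hHC : IsHC (cutDisc ρ) h := IsHC.of_separately hcutopen hholo hcut
    (continuous_param_of_preconnected hcutopen (isPreconnected_cutDisc ρ) hholo hcut hopen
      (sector_inter_cutDisc_nonempty hδ hρ hap) hcont)
  refine ⟨?_, hh.holomorphic⟩
  rw [tauDomain, union_prod]
  exact hh.continuousOn.union_of_isOpen hHC.cont (hopen.prod isOpen_univ) (hcutopen.prod isOpen_univ)

end Weight

/-- This is y ≤ e^y at y = bx/s, raised to the power s. -/
theorem rpow_mul_exp_neg_le {s b x : ℝ} (hs : 0 < s) (hb : 0 < b) (hx : 0 ≤ x) :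
    x ^ s * Real.exp (-(b * x)) ≤ (s / b) ^ s := by
  have h1 : x ≤ s / b * Real.exp (b * x / s) := by
    have h2 : b * x / s ≤ Real.exp (b * x / s) := by linarith [Real.add_one_le_exp (b * x / s)]
    calc x = s / b * (b * x / s) := by field_simp
      _ ≤ _ := by gcongr
  have h3 := Real.rpow_le_rpow hx h1 hs.le
  rw [Real.mul_rpow (by positivity) (Real.exp_pos _).le, ← Real.exp_mul,
    div_mul_cancel₀ _ hs.ne'] at h3
  rw [Real.exp_neg, ← div_eq_mul_inv, div_le_iff₀ (Real.exp_pos _)]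
  exact h3

theorem exists_rpow_mul_one_add_sq_mul_exp_neg_le {s b : ℝ} (hs : 0 < s) (hb : 0 < b) :
    ∃ L : ℝ, 0 < L ∧ ∀ x : ℝ, 0 ≤ x → x ^ s * (1 + x ^ 2) * Real.exp (-(b * x)) ≤ L := by
  refine ⟨(s / b) ^ s + ((s + 2) / b) ^ (s + 2), by positivity, fun x hx => ?_⟩
  have h1 := rpow_mul_exp_neg_le hs hb hx
  have h2 := rpow_mul_exp_neg_le (s := s + 2) (by linarith) hb hx
  rw [Real.rpow_add' hx (by linarith), Real.rpow_two] at h2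
  linarith

/-! ### The linear convolution operators. -/

section ConvExp

variable {k : ℝ}

theorem convExp_kernel_integrable {a : ℝ} (ha : 0 < a) (p : ℕ) :
    MeasureTheory.IntegrableOn (fun u : ℝ => (1 - u) ^ (a - 1) * u ^ (p - 1)) (Ioo 0 1) := by
  refine (integrableOn_one_sub_rpow ha).mul_bdd (c := 1) (by fun_prop) ?_
  filter_upwards [MeasureTheory.ae_restrict_mem measurableSet_Ioo] with u hu
  rw [Real.norm_of_nonneg (pow_nonneg hu.1.le _)]
  exact pow_le_one₀ hu.1.le hu.2.le

theorem norm_convExp_le (hk : 0 < k) (hk1 : k < 1) (κ : ℝ) {a : ℝ} (ha : 0 < a) {p : ℕ}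
    (hp : 1 ≤ p) (w : ℂ → ℝ → ℂ) {τ : ℂ} (hτ : τ ≠ 0) {m B : ℝ}
    (hB : ∀ u ∈ Ioo (0 : ℝ) 1, ‖expOpC k κ w (((u ^ (1 / k) : ℝ) : ℂ) * τ) m‖ ≤ B) :
    ‖convExp k κ a p w τ m‖ ≤ k ^ p / Real.Gamma a / a * (‖τ‖ ^ k) ^ (a + p) * B := by
  have hB0 : 0 ≤ B := (norm_nonneg _).trans (hB (1 / 2) ⟨by norm_num, by norm_num⟩)
  have hΓ := Real.Gamma_pos_of_pos ha
  have hray : ‖rayInt k (fun u => (1 - u) ^ (a - 1) * u ^ (p - 1)) (expOpC k κ w) τ m‖ ≤ 1 / a * B := by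
    refine (norm_rayInt_le (B := fun _ => B) ((convExp_kernel_integrable ha p).mul_const B)
      (fun u hu => ?_) hB).trans ?_
    · exact mul_nonneg (Real.rpow_nonneg (by linarith [hu.2]) _) (pow_nonneg hu.1.le _)
    · rw [MeasureTheory.integral_mul_const]
      refine mul_le_mul_of_nonneg_right ?_ hB0
      rw [← integral_one_sub_rpow ha]
      refine MeasureTheory.setIntegral_mono_on (convExp_kernel_integrable ha p)
        (integrableOn_one_sub_rpow ha) measurableSet_Ioo fun u hu => ?_
      exact mul_le_of_le_one_right (Real.rpow_nonneg (by linarith [hu.2]) _)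
        (pow_le_one₀ hu.1.le hu.2.le)
  rw [convExp_eq_rayInt hk hk1 κ a hp w hτ, norm_mul, norm_mul, Complex.norm_cpow_real,
    Complex.norm_cpow_real, Complex.norm_real, Real.norm_of_nonneg (by positivity)]
  refine (mul_le_mul_of_nonneg_left hray (by positivity)).trans (le_of_eq (by ring))

variable {S : Set ℂ}

theorem IsHC.convExp (hSo : IsOpen S) (hS : IsConic S) (hSs : S ⊆ Complex.slitPlane) (hk : 0 < k)
    (hk1 : k < 1) {ν κ a C : ℝ} (hν : 0 < ν) (hκ : 0 < κ) (ha : 0 < a) {p : ℕ} (hp : 1 ≤ p)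
    {w : ℂ → ℝ → ℂ} (hw : IsHC S w) (hC : 0 ≤ C)
    (h : ∀ τ ∈ S, ∀ m, ‖w τ m‖ ≤ C * ‖τ‖ ^ k * Real.exp (ν * ‖τ‖ ^ k)) :
    IsHC S (convExp k κ a p w) := by
  obtain ⟨h1, h2⟩ := hw.expOpC hSo hS hk hk1 hν hκ hC h
  refine (((IsHC.const _).mul (IsHC.of_fst ?_)).mul
    (h1.rayInt hSo hS hk (convExp_kernel_integrable ha p) h2)).congr fun τ hτ m =>
      convExp_eq_rayInt hk hk1 κ a hp w (hS.ne_zero hτ) m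
  refine DifferentiableOn.cpow (differentiableOn_id.cpow (differentiableOn_const _) hSs)
    (differentiableOn_const _) fun τ hτ => ?_
  -- The outer power is holomorphic only if τ^k avoids the cut, which holds because |k arg τ| < π.
  have hτ' := Complex.mem_slitPlane_iff_arg.1 (hSs hτ)
  have h4 : -Real.pi < Complex.arg τ * k := by
    nlinarith [Complex.neg_pi_lt_arg τ, Real.pi_pos]
  have h5 : Complex.arg τ * k < Real.pi := by
    nlinarith [Complex.arg_le_pi τ, Real.pi_pos]
  rw [Complex.mem_slitPlane_iff_arg]
  refine ⟨fun h6 => ?_, cpow_ne_zero' hτ'.2 _⟩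
  have h7 : Complex.arg (τ ^ (k : ℂ)) = Complex.arg τ * k := by
    rw [cpow_polar]
    have := Complex.arg_mul_cos_add_sin_mul_I
      (r := ‖τ‖ ^ k) (Real.rpow_pos_of_pos (norm_pos_iff.2 hτ'.2) _)
      (θ := Complex.arg τ * k) ⟨h4, h5.le⟩
    rwa [← Complex.ofReal_cos, ← Complex.ofReal_sin] at this
  simp only [h7] at h6
  linarith

theorem convExp_sub (hSo : IsOpen S) (hS : IsConic S) (hk : 0 < k) (hk1 : k < 1)
    {ν κ a C C' : ℝ} (hν : 0 < ν) (hκ : 0 < κ) (ha : 0 < a) {p : ℕ} (hp : 1 ≤ p)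
    {w w' : ℂ → ℝ → ℂ} (hw : IsHC S w) (hC : 0 ≤ C)
    (h : ∀ τ ∈ S, ∀ m, ‖w τ m‖ ≤ C * ‖τ‖ ^ k * Real.exp (ν * ‖τ‖ ^ k))
    (hw' : IsHC S w') (hC' : 0 ≤ C')
    (h' : ∀ τ ∈ S, ∀ m, ‖w' τ m‖ ≤ C' * ‖τ‖ ^ k * Real.exp (ν * ‖τ‖ ^ k)) :
    ∀ τ ∈ S, ∀ m, convExp k κ a p (fun τ m => w τ m - w' τ m) τ m =
      convExp k κ a p w τ m - convExp k κ a p w' τ m := by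
  intro τ hτ m
  obtain ⟨h1, h2⟩ := hw.expOpC hSo hS hk hk1 hν hκ hC h
  obtain ⟨h3, h4⟩ := hw'.expOpC hSo hS hk hk1 hν hκ hC' h'
  rw [convExp_eq_rayInt hk hk1 κ a hp _ (hS.ne_zero hτ),
    convExp_eq_rayInt hk hk1 κ a hp _ (hS.ne_zero hτ),
    convExp_eq_rayInt hk hk1 κ a hp _ (hS.ne_zero hτ),
    rayInt_congr (g := fun τ m => expOpC k κ w τ m - expOpC k κ w' τ m) hS hk _
      (fun σ hσ => expOpC_sub hSo hS hk hk1 hν hκ hw hC h hw' hC' h' σ hσ m) τ hτ,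
    rayInt_sub hS hk (convExp_kernel_integrable ha p) h1 h2 h3 h4 hτ]
  ring

end ConvExp

/-- The analytic data that the estimates of the terms of the equation depend on: lower bounds of
`H` relative to `Q`, on the sector and on the cut disc. -/
structure DenomBound (k ν β μ d δ ρ AH b A' : ℝ) (q : ℝ → ℝ) (Hn : ℂ → ℝ → ℝ) : Prop where
  hk : 1 / 2 < k
  hk1 : k < 1
  hν : 1 < ν
  hβ : 0 < β
  hμ : 1 < μ
  hδ : 0 < δ
  hρ : 0 < ρ
  hap : |d| + δ < Real.pi
  hAH : 0 < AH
  hA' : 0 < A'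
  hb : 0 < b
  q_nonneg : ∀ m, 0 ≤ q m
  sector : ∀ τ ∈ sector d δ, ∀ m, AH * q m * Real.exp (b * ‖τ‖ ^ k) ≤ Hn τ m
  cutDisc : ∀ τ ∈ cutDisc ρ, ∀ m, A' * q m ≤ Hn τ m

namespace DenomBound

variable {k ν β μ d δ ρ AH b A' : ℝ} {q : ℝ → ℝ} {Hn : ℂ → ℝ → ℝ}

theorem growth (hD : DenomBound k ν β μ d δ ρ AH b A' q Hn) {C : ℝ} (hC : 0 ≤ C) {w : ℂ → ℝ → ℂ}
    (h : ∀ τ ∈ tauDomain d δ ρ, ∀ m, ‖w τ m‖ ≤ C * weight ν β μ k τ m) :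
    ∀ τ ∈ tauDomain d δ ρ, ∀ m, ‖w τ m‖ ≤ C * ‖τ‖ ^ k * Real.exp (ν * ‖τ‖ ^ k) := by
  intro τ hτ m
  refine (h τ hτ m).trans ?_
  rw [mul_assoc]
  exact mul_le_mul_of_nonneg_left
    (weight_le_growth hD.hβ.le (by linarith [hD.hμ]) τ m) hC

theorem isOpen (hD : DenomBound k ν β μ d δ ρ AH b A' q Hn) : IsOpen (tauDomain d δ ρ) :=
  isOpen_tauDomain hD.hap

theorem subset_slitPlane (hD : DenomBound k ν β μ d δ ρ AH b A' q Hn) :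
    tauDomain d δ ρ ⊆ Complex.slitPlane := tauDomain_subset_slitPlane hD.hap

/-- The estimate of `exp(-κ C_k) w`, on the sector and on the cut disc. -/
theorem norm_expOpC_le (hD : DenomBound k ν β μ d δ ρ AH b A' q Hn) {K₁ κ C : ℝ} (hκ : 0 < κ)
    (hK : IsExpOpBound k ν K₁) {w : ℂ → ℝ → ℂ} (hC : 0 < C) (hw : IsHC (tauDomain d δ ρ) w)
    (h : ∀ τ ∈ tauDomain d δ ρ, ∀ m, ‖w τ m‖ ≤ C * weight ν β μ k τ m) :
    (∀ τ ∈ _root_.sector d δ, ∀ m, ‖expOpC k κ w τ m‖ ≤ C * ‖τ‖ ^ k * Real.exp (ν * ‖τ‖ ^ k) *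
      Real.exp (κ * K₁ * (k / Real.Gamma (1 / k - 1)) * ‖τ‖ ^ k) * decay β μ m) ∧
    (∀ τ ∈ _root_.cutDisc ρ, ∀ m, ‖expOpC k κ w τ m‖ ≤ C * ‖τ‖ ^ k * Real.exp (ν * ‖τ‖ ^ k) *
      Real.exp (κ * (k * ν ^ (1 - 1 / k)) * ‖τ‖ ^ k) * decay β μ m) := by
  have hk0 : 0 < k := by linarith [hD.hk]
  have hν0 : 0 < ν := by linarith [hD.hν]
  have h1 : ∀ τ ∈ tauDomain d δ ρ, ∀ m,
      ‖w τ m‖ ≤ C * ‖τ‖ ^ k * Real.exp (ν * ‖τ‖ ^ k) * decay β μ m := fun τ hτ m => by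
    refine (h τ hτ m).trans ?_
    rw [mul_assoc C, mul_assoc C]
    exact mul_le_mul_of_nonneg_left (weight_le τ m) hC.le
  constructor
  · intro τ hτ m
    -- On the cut disc e^{νx} ≤ e^{νρ^k}, which supplies the constant C' in the definition of
    -- admissibility.
    refine (hK.2 d δ ρ β μ C (C * Real.exp (ν * ρ ^ k)) κ w hD.hδ hD.hap.le hD.hρ hD.hβ hD.hμ hC
      (by positivity) hκ (hw.cont.mono (prod_mono subset_union_left le_rfl)) hw.holo ?_ ?_ τ hτ
      m).trans (le_of_eq ?_)
    · intro τ hτ m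
      refine (h1 τ (Or.inl hτ) m).trans (le_of_eq ?_)
      rw [decay]; ring
    · intro τ hτ m
      refine (h1 τ (Or.inr hτ) m).trans ?_
      have h2 : ‖τ‖ < ρ := by simpa using hτ.1
      have h3 := Real.rpow_le_rpow (norm_nonneg _) h2.le hk0.le
      calc _ ≤ C * ‖τ‖ ^ k * Real.exp (ν * ρ ^ k) * decay β μ m := by
            have := (decay_pos β μ m).le
            gcongr
        _ = _ := by rw [decay]; ring
    · rw [decay]; ring
  -- Admissibility of K₁ controls the sector only; on the cut disc the explicit constant k ν^{1-1/k}
  -- is used.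
  · intro τ hτ m
    refine (expOpC_bound (m := m) (C := C * decay β μ m) hk0 hD.hk1 hν0 hκ (isConic_cutDisc ρ)
      (mul_nonneg hC.le (decay_pos β μ m).le) (fun τ hτ => ?_) τ hτ).trans (le_of_eq (by ring))
    exact (h1 τ (Or.inr hτ) m).trans (le_of_eq (by ring))

/-- The linear convolution operators, divided by `H / Q`, are bounded. -/
theorem exists_convExp_bound (hD : DenomBound k ν β μ d δ ρ AH b A' q Hn) {K₁ κ a : ℝ} (hκ : 0 < κ)
    (hK : IsExpOpBound k ν K₁) (hκb : κ * K₁ * (k / Real.Gamma (1 / k - 1)) < b) (ha : 0 < a)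
    {p : ℕ} (hp : 1 ≤ p) :
    ∃ L : ℝ, 0 < L ∧ ∀ (w : ℂ → ℝ → ℂ) (C : ℝ), 0 < C → IsHC (tauDomain d δ ρ) w →
      (∀ τ ∈ tauDomain d δ ρ, ∀ m, ‖w τ m‖ ≤ C * weight ν β μ k τ m) →
      ∀ τ ∈ tauDomain d δ ρ, ∀ m,
        q m * ‖convExp k κ a p w τ m‖ ≤ L * C * weight ν β μ k τ m * Hn τ m := by
  have hk0 : 0 < k := by linarith [hD.hk]
  have hν0 : 0 < ν := by linarith [hD.hν]
  have hΓ := Real.Gamma_pos_of_pos ha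
  have hc : 0 < 1 / k - 1 := by rw [sub_pos, lt_div_iff₀ hk0]; linarith [hD.hk1]
  have hΓ' := Real.Gamma_pos_of_pos hc
  obtain ⟨κ', hκ'⟩ : ∃ κ', κ' = κ * K₁ * (k / Real.Gamma (1 / k - 1)) := ⟨_, rfl⟩
  have hκ'0 : 0 < κ' := by rw [hκ']; have := hK.1; positivity
  obtain ⟨M, hM⟩ : ∃ M, M = κ * (k * ν ^ (1 - 1 / k)) := ⟨_, rfl⟩
  have hM0 : 0 < M := by rw [hM]; positivity
  obtain ⟨c, hcdef⟩ : ∃ c, c = k ^ p / Real.Gamma a / a := ⟨_, rfl⟩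
  have hc0 : 0 < c := by rw [hcdef]; positivity
  rw [← hκ'] at hκb
  have hap0 : 0 < a + p := by positivity
  -- The power x^{a+p} comes from the kernel, and 1 + x² restores the denominator of the weight,
  -- which the estimate of exp(-κ C_k) has lost. The surplus b - κ' > 0 absorbs both.
  obtain ⟨L₁, hL₁, hL₁b⟩ := exists_rpow_mul_one_add_sq_mul_exp_neg_le hap0 (sub_pos.2 hκb)
  obtain ⟨L₂, hL₂⟩ : ∃ L₂, L₂ = (ρ ^ k) ^ (a + p) * (1 + (ρ ^ k) ^ 2) * Real.exp (M * ρ ^ k) :=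
    ⟨_, rfl⟩
  have hρ := hD.hρ
  have hL₂0 : 0 < L₂ := by rw [hL₂]; positivity
  have hAH := hD.hAH
  have hA' := hD.hA'
  refine ⟨c * L₁ / AH + c * L₂ / A', by positivity, fun w C hC hw h τ hτ m => ?_⟩
  have hE := hD.norm_expOpC_le hκ hK hC hw h
  rw [← hκ', ← hM] at hE
  have hτ0 := (isConic_tauDomain d δ ρ).ne_zero hτ
  have hx : 0 < ‖τ‖ ^ k := Real.rpow_pos_of_pos (norm_pos_iff.2 hτ0) _
  have hdec := decay_pos β μ m
  have hW0 := weight_nonneg (ν := ν) (β := β) (μ := μ) (k := k) τ m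
  have hqm := hD.q_nonneg m
  -- the bound along the ray follows from the bound at its end point
  have mono : ∀ {lam u : ℝ}, 0 ≤ lam → u ∈ Ioo (0 : ℝ) 1 →
      C * (u * ‖τ‖ ^ k) * Real.exp (ν * (u * ‖τ‖ ^ k)) * Real.exp (lam * (u * ‖τ‖ ^ k)) * decay β μ m
      ≤ C * ‖τ‖ ^ k * Real.exp (ν * ‖τ‖ ^ k) * Real.exp (lam * ‖τ‖ ^ k) * decay β μ m := by
    intro lam u hlam hu
    have h1 : u * ‖τ‖ ^ k ≤ ‖τ‖ ^ k := mul_le_of_le_one_left hx.le hu.2.le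
    have h2 := mul_nonneg hu.1.le hx.le
    gcongr
  have hWx : ‖τ‖ ^ k * Real.exp (ν * ‖τ‖ ^ k) * decay β μ m =
      (1 + (‖τ‖ ^ k) ^ 2) * weight ν β μ k τ m := by
    rw [weight]; field_simp
  rcases hτ with hτs | hτc
  · have h1 := norm_convExp_le hk0 hD.hk1 κ ha hp w hτ0 (m := m)
      (B := C * ‖τ‖ ^ k * Real.exp (ν * ‖τ‖ ^ k) * Real.exp (κ' * ‖τ‖ ^ k) * decay β μ m) (by
        intro u hu
        refine (hE.1 _ ((IsConic.sector d δ).scale_mem hk0 hu hτs) m).trans ?_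
        rw [norm_scale_rpow hk0 hu.1.le]
        exact mono hκ'0.le hu)
    rw [← hcdef] at h1
    have h2 := hL₁b _ hx.le
    have h3 := hD.sector τ hτs m
    have h4 : Real.exp (κ' * ‖τ‖ ^ k) = Real.exp (-((b - κ') * ‖τ‖ ^ k)) * Real.exp (b * ‖τ‖ ^ k) := by
      rw [← Real.exp_add]; ring_nf
    calc q m * ‖convExp k κ a p w τ m‖ ≤ q m * _ := mul_le_mul_of_nonneg_left h1 hqm
      _ = c * C * weight ν β μ k τ m * q m * Real.exp (b * ‖τ‖ ^ k) *
          ((‖τ‖ ^ k) ^ (a + p) * (1 + (‖τ‖ ^ k) ^ 2) * Real.exp (-((b - κ') * ‖τ‖ ^ k))) := by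
          rw [h4]
          linear_combination q m * c * (‖τ‖ ^ k) ^ (a + p) * C *
            (Real.exp (-((b - κ') * ‖τ‖ ^ k)) * Real.exp (b * ‖τ‖ ^ k)) * hWx
      _ ≤ c * C * weight ν β μ k τ m * q m * Real.exp (b * ‖τ‖ ^ k) * L₁ := by gcongr
      _ = c * L₁ / AH * C * weight ν β μ k τ m * (AH * q m * Real.exp (b * ‖τ‖ ^ k)) := by
          field_simp
      _ ≤ c * L₁ / AH * C * weight ν β μ k τ m * Hn τ m := by gcongr
      _ ≤ _ := by
          have h5 : 0 ≤ Hn τ m := le_trans (by positivity) h3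
          have : 0 ≤ c * L₂ / A' := by positivity
          gcongr
          linarith
  · have h1 := norm_convExp_le hk0 hD.hk1 κ ha hp w hτ0 (m := m)
      (B := C * ‖τ‖ ^ k * Real.exp (ν * ‖τ‖ ^ k) * Real.exp (M * ‖τ‖ ^ k) * decay β μ m) (by
        intro u hu
        refine (hE.2 _ ((isConic_cutDisc ρ).scale_mem hk0 hu hτc) m).trans ?_
        rw [norm_scale_rpow hk0 hu.1.le]
        exact mono hM0.le hu)
    rw [← hcdef] at h1
    have hρx : ‖τ‖ ^ k ≤ ρ ^ k := by
      have h2 : ‖τ‖ < ρ := by simpa using hτc.1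
      exact Real.rpow_le_rpow (norm_nonneg _) h2.le hk0.le
    have h2 : (‖τ‖ ^ k) ^ (a + p) * (1 + (‖τ‖ ^ k) ^ 2) * Real.exp (M * ‖τ‖ ^ k) ≤ L₂ := by
      rw [hL₂]; gcongr
    have h3 := hD.cutDisc τ hτc m
    calc q m * ‖convExp k κ a p w τ m‖ ≤ q m * _ := mul_le_mul_of_nonneg_left h1 hqm
      _ = c * C * weight ν β μ k τ m * q m *
          ((‖τ‖ ^ k) ^ (a + p) * (1 + (‖τ‖ ^ k) ^ 2) * Real.exp (M * ‖τ‖ ^ k)) := by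
          linear_combination q m * c * (‖τ‖ ^ k) ^ (a + p) * C * Real.exp (M * ‖τ‖ ^ k) * hWx
      _ ≤ c * C * weight ν β μ k τ m * q m * L₂ := by gcongr
      _ = c * L₂ / A' * C * weight ν β μ k τ m * (A' * q m) := by field_simp
      _ ≤ c * L₂ / A' * C * weight ν β μ k τ m * Hn τ m := by gcongr
      _ ≤ _ := by
          have h5 : 0 ≤ Hn τ m := le_trans (by positivity) h3
          have : 0 ≤ c * L₁ / AH := by positivity
          gcongr
          linarith

end DenomBound

/-! ### The quadratic convolution term. -/

section Quad

/-- Lebesgue measure on `(0,1) × ℝ`. -/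
noncomputable def stripMeasure : MeasureTheory.Measure (ℝ × ℝ) :=
  (MeasureTheory.volume.restrict (Ioo (0 : ℝ) 1)).prod MeasureTheory.volume

theorem stripMeasure_eq : stripMeasure =
    (MeasureTheory.volume.prod MeasureTheory.volume).restrict (Ioo (0 : ℝ) 1 ×ˢ univ) := by
  rw [← MeasureTheory.Measure.prod_restrict, MeasureTheory.Measure.restrict_univ, stripMeasure]

theorem ae_stripMeasure_mem : ∀ᵐ p ∂stripMeasure, p.1 ∈ Ioo (0 : ℝ) 1 := by
  rw [stripMeasure_eq]
  filter_upwards [MeasureTheory.ae_restrict_mem (measurableSet_Ioo.prod MeasurableSet.univ)]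
    with p hp using hp.1

/-- The integrand of the quadratic term, after rescaling; `p = (u, m₁)`. -/
noncomputable def quadKernel (k : ℝ) (Q₁ Q₂ : Polynomial ℂ) (w v : ℂ → ℝ → ℂ) (p : ℝ × ℝ) (τ : ℂ)
    (m : ℝ) : ℂ :=
  evalI Q₁ (m - p.2) * w ((((1 - p.1) ^ (1 / k) : ℝ) : ℂ) * τ) (m - p.2) *
    (evalI Q₂ p.2 * v (((p.1 ^ (1 / k) : ℝ) : ℂ) * τ) p.2) * ((1 / ((1 - p.1) * p.1) : ℝ) : ℂ)

/-- The bilinear form behind the quadratic term. -/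
noncomputable def quadBi (k : ℝ) (Q₁ Q₂ : Polynomial ℂ) (w v : ℂ → ℝ → ℂ) (τ : ℂ) (m : ℝ) : ℂ :=
  1 / ((2 * Real.pi) ^ (1 / 2 : ℝ) : ℝ) * ∫ p, quadKernel k Q₁ Q₂ w v p τ m ∂stripMeasure

variable {k ν β μ : ℝ} {Q₁ Q₂ : Polynomial ℂ} {S : Set ℂ} {w w' v v' : ℂ → ℝ → ℂ} {C C' : ℝ}

theorem one_sub_mem_Ioo {u : ℝ} (hu : u ∈ Ioo (0 : ℝ) 1) : 1 - u ∈ Ioo (0 : ℝ) 1 :=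
  ⟨by linarith [hu.2], by linarith [hu.1]⟩

/-- The `u`-dependence of the bound for the kernel. -/
noncomputable def quadProfile (x u : ℝ) : ℝ := x ^ 2 / ((1 + ((1 - u) * x) ^ 2) * (1 + (u * x) ^ 2))

theorem quadProfile_nonneg (x u : ℝ) : 0 ≤ quadProfile x u := by rw [quadProfile]; positivity

theorem quadProfile_le_sq (x u : ℝ) : quadProfile x u ≤ x ^ 2 := by
  refine div_le_self (sq_nonneg x) ?_
  nlinarith [sq_nonneg ((1 - u) * x), sq_nonneg (u * x),
    mul_nonneg (sq_nonneg ((1 - u) * x)) (sq_nonneg (u * x))]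

theorem continuous_quadProfile (x : ℝ) : Continuous (quadProfile x) :=
  Continuous.div continuous_const (by fun_prop) fun u => by positivity

theorem integral_inv_one_add_sq_mul_le {x : ℝ} (hx : 0 < x) :
    ∫ u in (0 : ℝ)..1, (1 + (u * x) ^ 2)⁻¹ ≤ Real.pi / 2 / x := by
  have h := intervalIntegral.integral_comp_mul_right (a := 0) (b := 1)
    (fun y : ℝ => (1 + y ^ 2)⁻¹) hx.ne'
  rw [h, integral_inv_one_add_sq]
  simp only [zero_mul, one_mul, Real.arctan_zero, sub_zero, smul_eq_mul]
  rw [div_eq_inv_mul]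
  exact mul_le_mul_of_nonneg_left (Real.arctan_lt_pi_div_two x).le (by positivity)

/-- One of u, 1 - u is at least 1/2, so one denominator is at least (1+x²)/4. The reciprocal of the
other integrates to an arctangent over x, at most π/(2x). The denominator 1 + x² of the weight thus
survives convolution. -/
theorem integral_quadProfile_le {x : ℝ} (hx : 0 < x) :
    ∫ u in Ioo (0 : ℝ) 1, quadProfile x u ≤ 4 * Real.pi * (x / (1 + x ^ 2)) := by
  rw [← MeasureTheory.integral_Ioc_eq_integral_Ioo, ← intervalIntegral.integral_of_le zero_le_one]
  have hcont : ∀ f : ℝ → ℝ, Continuous f → Continuous fun u => (1 + (f u * x) ^ 2)⁻¹ := by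
    intro f hf
    exact Continuous.inv₀ (by fun_prop) fun u => by positivity
  have h1 : ∀ u ∈ Icc (0 : ℝ) 1, quadProfile x u ≤
      4 * x ^ 2 / (1 + x ^ 2) * ((1 + ((1 - u) * x) ^ 2)⁻¹ + (1 + (u * x) ^ 2)⁻¹) := by
    intro u hu
    have hx2 : 0 < x ^ 2 := by positivity
    have key : ∀ a b : ℝ, 0 ≤ b → 1 / 2 ≤ a →
        x ^ 2 / ((1 + (b * x) ^ 2) * (1 + (a * x) ^ 2)) ≤
          4 * x ^ 2 / (1 + x ^ 2) * (1 + (b * x) ^ 2)⁻¹ := by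
      intro a b hb ha
      have h2 : (1 + x ^ 2) / 4 ≤ 1 + (a * x) ^ 2 := by
        have : (1 / 4 : ℝ) ≤ a ^ 2 := by nlinarith
        rw [mul_pow]; nlinarith
      calc x ^ 2 / ((1 + (b * x) ^ 2) * (1 + (a * x) ^ 2)) ≤
            x ^ 2 / ((1 + (b * x) ^ 2) * ((1 + x ^ 2) / 4)) := by gcongr
        _ = _ := by field_simp
    have hc : 0 ≤ 4 * x ^ 2 / (1 + x ^ 2) := by positivity
    rw [mul_add, quadProfile]
    rcases le_total u (1 / 2) with h | h
    · have h3 := key (1 - u) u hu.1 (by linarith)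
      rw [mul_comm (1 + (u * x) ^ 2)] at h3
      have h4 : 0 ≤ 4 * x ^ 2 / (1 + x ^ 2) * (1 + ((1 - u) * x) ^ 2)⁻¹ := by positivity
      linarith
    · have h3 := key u (1 - u) (by linarith [hu.2]) h
      have h4 : 0 ≤ 4 * x ^ 2 / (1 + x ^ 2) * (1 + (u * x) ^ 2)⁻¹ := by positivity
      linarith
  have hi1 : IntervalIntegrable (fun u : ℝ => (1 + ((1 - u) * x) ^ 2)⁻¹) MeasureTheory.volume 0 1 :=
    (hcont (fun u => 1 - u) (by fun_prop)).intervalIntegrable _ _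
  have hi2 : IntervalIntegrable (fun u : ℝ => (1 + (u * x) ^ 2)⁻¹) MeasureTheory.volume 0 1 :=
    (hcont (fun u => u) (by fun_prop)).intervalIntegrable _ _
  refine (intervalIntegral.integral_mono_on zero_le_one
    ((continuous_quadProfile x).intervalIntegrable _ _) ((hi1.add hi2).const_mul _) h1).trans ?_
  rw [intervalIntegral.integral_const_mul, intervalIntegral.integral_add hi1 hi2,
    intervalIntegral.integral_comp_sub_left (fun u : ℝ => (1 + (u * x) ^ 2)⁻¹) 1]
  norm_num only [sub_self, sub_zero]
  have h5 := integral_inv_one_add_sq_mul_le hx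
  calc _ ≤ 4 * x ^ 2 / (1 + x ^ 2) * (Real.pi / 2 / x + Real.pi / 2 / x) := by gcongr
    _ = _ := by field_simp; norm_num

/-- The `m`-dependence of the bound for the kernel. -/
noncomputable def quadTail (β μ : ℝ) (Q₁ Q₂ : Polynomial ℂ) (m m₁ : ℝ) : ℝ :=
  (‖evalI Q₁ (m - m₁)‖ * decay β μ (m - m₁)) * (‖evalI Q₂ m₁‖ * decay β μ m₁)

theorem quadTail_nonneg (m m₁ : ℝ) : 0 ≤ quadTail β μ Q₁ Q₂ m m₁ :=
  mul_nonneg (mul_nonneg (norm_nonneg _) (decay_pos _ _ _).le)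
    (mul_nonneg (norm_nonneg _) (decay_pos _ _ _).le)

theorem weight_scale (hk : 0 < k) {u : ℝ} (hu : 0 ≤ u) (τ : ℂ) (m : ℝ) :
    weight ν β μ k (((u ^ (1 / k) : ℝ) : ℂ) * τ) m = u * ‖τ‖ ^ k / (1 + (u * ‖τ‖ ^ k) ^ 2) *
      Real.exp (ν * (u * ‖τ‖ ^ k)) * decay β μ m := by
  rw [weight, norm_scale_rpow hk hu]

/-- The factors (1-u)x and ux of the two weights cancel the singularity 1/((1-u)u), and the
exponentials multiply exactly to e^{νx}. -/
theorem norm_quadKernel_le (hk : 0 < k) (hS : IsConic S) (hC : 0 ≤ C)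
    (hw : ∀ τ ∈ S, ∀ m, ‖w τ m‖ ≤ C * weight ν β μ k τ m)
    (hv : ∀ τ ∈ S, ∀ m, ‖v τ m‖ ≤ C' * weight ν β μ k τ m) {τ : ℂ} (hτ : τ ∈ S) (m : ℝ)
    {p : ℝ × ℝ} (hp : p.1 ∈ Ioo (0 : ℝ) 1) :
    ‖quadKernel k Q₁ Q₂ w v p τ m‖ ≤ C * C' * Real.exp (ν * ‖τ‖ ^ k) *
      (quadProfile (‖τ‖ ^ k) p.1 * quadTail β μ Q₁ Q₂ m p.2) := by
  obtain ⟨u, m₁⟩ := p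
  have hu' := one_sub_mem_Ioo hp
  have hu0 : 0 < u := hp.1
  have hu1 : 0 < 1 - u := hu'.1
  have h1 := hw _ (hS.scale_mem hk hu' hτ) (m - m₁)
  have h2 := hv _ (hS.scale_mem hk hp hτ) m₁
  rw [weight_scale hk hu'.1.le] at h1
  rw [weight_scale hk hp.1.le] at h2
  rw [quadKernel, norm_mul, norm_mul, norm_mul, norm_mul, Complex.norm_real,
    Real.norm_of_nonneg (by positivity)]
  dsimp only at h1 h2 hu0 hu1 ⊢
  have hx : 0 ≤ ‖τ‖ ^ k := by positivity
  have hd1 := (decay_pos β μ (m - m₁)).le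
  have hd2 := (decay_pos β μ m₁).le
  have he : Real.exp (ν * ‖τ‖ ^ k) =
      Real.exp (ν * ((1 - u) * ‖τ‖ ^ k)) * Real.exp (ν * (u * ‖τ‖ ^ k)) := by
    rw [← Real.exp_add]; ring_nf
  calc _ ≤ ‖evalI Q₁ (m - m₁)‖ * (C * ((1 - u) * ‖τ‖ ^ k / (1 + ((1 - u) * ‖τ‖ ^ k) ^ 2) *
        Real.exp (ν * ((1 - u) * ‖τ‖ ^ k)) * decay β μ (m - m₁))) *
        (‖evalI Q₂ m₁‖ * (C' * (u * ‖τ‖ ^ k / (1 + (u * ‖τ‖ ^ k) ^ 2) *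
        Real.exp (ν * (u * ‖τ‖ ^ k)) * decay β μ m₁))) * (1 / ((1 - u) * u)) := by gcongr
    _ = _ := by
      rw [he, quadProfile, quadTail]
      field_simp

theorem quadKernel_aestronglyMeasurable (hk : 0 < k) (hS : IsConic S) (hw : IsHC S w)
    (hv : IsHC S v) {τ : ℂ} (hτ : τ ∈ S) (m : ℝ) :
    MeasureTheory.AEStronglyMeasurable (fun p => quadKernel k Q₁ Q₂ w v p τ m) stripMeasure := by
  rw [stripMeasure_eq]
  refine ContinuousOn.aestronglyMeasurable ?_ (measurableSet_Ioo.prod MeasurableSet.univ)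
  have hroot : ∀ f : ℝ → ℝ, Continuous f → (∀ u ∈ Ioo (0 : ℝ) 1, f u ≠ 0) →
      ContinuousOn (fun p : ℝ × ℝ => ((f p.1 ^ (1 / k) : ℝ) : ℂ) * τ) (Ioo (0 : ℝ) 1 ×ˢ univ) := by
    intro f hf h0
    refine ContinuousOn.mul (Complex.continuous_ofReal.comp_continuousOn ?_) continuousOn_const
    exact (hf.comp continuous_fst).continuousOn.rpow_const fun p hp => Or.inl (h0 _ hp.1)
  have hc1 : ContinuousOn (fun p : ℝ × ℝ =>
      w ((((1 - p.1) ^ (1 / k) : ℝ) : ℂ) * τ) (m - p.2)) (Ioo (0 : ℝ) 1 ×ˢ univ) :=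
    hw.cont.comp (f := fun p : ℝ × ℝ => ((((1 - p.1) ^ (1 / k) : ℝ) : ℂ) * τ, m - p.2))
      ((hroot (fun u => 1 - u) (by fun_prop) fun u hu => (one_sub_mem_Ioo hu).1.ne').prodMk
        (by fun_prop)) fun p hp => ⟨hS.scale_mem hk (one_sub_mem_Ioo hp.1) hτ, mem_univ _⟩
  have hc2 : ContinuousOn (fun p : ℝ × ℝ => v (((p.1 ^ (1 / k) : ℝ) : ℂ) * τ) p.2)
      (Ioo (0 : ℝ) 1 ×ˢ univ) :=
    hv.cont.comp (f := fun p : ℝ × ℝ => (((p.1 ^ (1 / k) : ℝ) : ℂ) * τ, p.2))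
      ((hroot (fun u => u) (by fun_prop) fun u hu => hu.1.ne').prodMk
        (by fun_prop)) fun p hp => ⟨hS.scale_mem hk hp.1 hτ, mem_univ _⟩
  have hq1 : Continuous fun p : ℝ × ℝ => evalI Q₁ (m - p.2) :=
    (continuous_evalI Q₁).comp (by fun_prop)
  have hq2 : Continuous fun p : ℝ × ℝ => evalI Q₂ p.2 := (continuous_evalI Q₂).comp (by fun_prop)
  refine ((hq1.continuousOn.mul hc1).mul (hq2.continuousOn.mul hc2)).mul
    (Complex.continuous_ofReal.comp_continuousOn ?_)
  refine ContinuousOn.div continuousOn_const (by fun_prop) fun p hp => ?_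
  exact (mul_pos (one_sub_mem_Ioo hp.1).1 hp.1.1).ne'

theorem exists_evalI_mul_decay_le {P : Polynomial ℂ} :
    ∃ C : ℝ, 0 < C ∧ ∀ y : ℝ, ‖evalI P y‖ * decay β μ y ≤
      C * ((1 + |y|) ^ (-(μ - P.natDegree)) * Real.exp (-β * |y|)) := by
  obtain ⟨C, hC, h⟩ := exists_norm_evalI_le P
  refine ⟨C, hC, fun y => ?_⟩
  have hy : 0 < 1 + |y| := by positivity
  have h1 : (1 + |y|) ^ (-(μ - P.natDegree)) = (1 + |y|) ^ P.natDegree * (1 + |y|) ^ (-μ) := by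
    rw [← Real.rpow_natCast, ← Real.rpow_add hy]; ring_nf
  calc _ ≤ C * (1 + |y|) ^ P.natDegree * decay β μ y :=
        mul_le_mul_of_nonneg_right (h y) (decay_pos β μ y).le
    _ = _ := by rw [h1, decay]; ring

/-- The larger of A and B is at least M/2. It supplies the decay in M, and the other factor is left
to be integrated. -/
theorem rpow_neg_mul_rpow_neg_le {A B M s₁ s₂ μ n : ℝ} (hA : 1 ≤ A) (hB : 1 ≤ B) (hM : 1 ≤ M)
    (hMAB : M ≤ A + B) (h1 : μ - n ≤ s₁) (h2 : μ - n ≤ s₂) (h3 : s₁ ≤ μ) (h4 : s₂ ≤ μ)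
    (h5 : 0 ≤ s₁) (h6 : 0 ≤ s₂) :
    A ^ (-s₁) * B ^ (-s₂) ≤ 2 ^ μ * M ^ (n - μ) * (A ^ (-s₁) + B ^ (-s₂)) := by
  have key : ∀ A s : ℝ, M / 2 ≤ A → μ - n ≤ s → s ≤ μ → 0 ≤ s →
      A ^ (-s) ≤ 2 ^ μ * M ^ (n - μ) := by
    intro A s hA hs hsμ hs0
    calc A ^ (-s) ≤ (M / 2) ^ (-s) :=
          Real.rpow_le_rpow_of_nonpos (by linarith) hA (by linarith)
      _ = 2 ^ s * M ^ (-s) := by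
          rw [Real.div_rpow (by linarith) (by norm_num), Real.rpow_neg (by norm_num : (0 : ℝ) ≤ 2)]
          field_simp
      _ ≤ 2 ^ μ * M ^ (n - μ) := by
          have e1 := Real.rpow_le_rpow_of_exponent_le (by norm_num : (1 : ℝ) ≤ 2) hsμ
          have e2 := Real.rpow_le_rpow_of_exponent_le hM (show -s ≤ n - μ by linarith)
          gcongr
  have hA0 : 0 ≤ A ^ (-s₁) := by positivity
  have hB0 : 0 ≤ B ^ (-s₂) := by positivity
  have hK : 0 ≤ 2 ^ μ * M ^ (n - μ) := by positivity
  rcases le_total A B with h | h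
  · have := mul_le_mul_of_nonneg_left (key B s₂ (by linarith) h2 h4 h6) hA0
    nlinarith [mul_nonneg hK hB0]
  · have := mul_le_mul_of_nonneg_right (key A s₁ (by linarith) h1 h3 h5) hB0
    nlinarith [mul_nonneg hK hA0]

theorem integrable_one_add_abs_rpow {s : ℝ} (hs : 1 < s) :
    MeasureTheory.Integrable fun y : ℝ => (1 + |y|) ^ (-s) := by
  have := integrable_one_add_norm (E := ℝ) (μ := MeasureTheory.volume) (r := s) (by simpa using hs)
  simpa [Real.norm_eq_abs] using this

/-- Two bounds for the tail: one that is uniform in `m`, one that exhibits the decay in `m`. -/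
theorem exists_quadTail_bound (hβ : 0 ≤ β) {n : ℕ} (h1 : Q₁.natDegree ≤ n) (h2 : Q₂.natDegree ≤ n)
    (hμ1 : (Q₁.natDegree : ℝ) + 1 < μ) (hμ2 : (Q₂.natDegree : ℝ) + 1 < μ) :
    ∃ (K : ℝ) (G : ℝ → ℝ), 0 < K ∧ MeasureTheory.Integrable G ∧ (∀ y, 0 ≤ G y) ∧
      (∀ m m₁, quadTail β μ Q₁ Q₂ m m₁ ≤ G m₁) ∧
      ∀ m, ∃ g : ℝ → ℝ, MeasureTheory.Integrable g ∧ (∀ m₁, quadTail β μ Q₁ Q₂ m m₁ ≤ g m₁) ∧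
        (∀ m₁, 0 ≤ g m₁) ∧ ∫ m₁, g m₁ ≤ K * (1 + |m|) ^ n * decay β μ m := by
  obtain ⟨C₁, hC₁, hb1⟩ := exists_evalI_mul_decay_le (β := β) (μ := μ) (P := Q₁)
  obtain ⟨C₂, hC₂, hb2⟩ := exists_evalI_mul_decay_le (β := β) (μ := μ) (P := Q₂)
  set s₁ := μ - Q₁.natDegree with hs₁
  set s₂ := μ - Q₂.natDegree with hs₂
  have hs1 : 1 < s₁ := by linarith
  have hs2 : 1 < s₂ := by linarith
  have hi1 := integrable_one_add_abs_rpow hs1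
  have hi2 := integrable_one_add_abs_rpow hs2
  have hI1 : 0 ≤ ∫ y : ℝ, (1 + |y|) ^ (-s₁) := MeasureTheory.integral_nonneg fun y => by positivity
  have hI2 : 0 ≤ ∫ y : ℝ, (1 + |y|) ^ (-s₂) := MeasureTheory.integral_nonneg fun y => by positivity
  have hT : ∀ m m₁, quadTail β μ Q₁ Q₂ m m₁ ≤ C₁ * C₂ * ((1 + |m - m₁|) ^ (-s₁) *
      (1 + |m₁|) ^ (-s₂)) * (Real.exp (-β * |m - m₁|) * Real.exp (-β * |m₁|)) := by
    intro m m₁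
    rw [quadTail]
    refine (mul_le_mul (hb1 _) (hb2 _) (mul_nonneg (norm_nonneg _) (decay_pos _ _ _).le)
      (by positivity)).trans (le_of_eq (by ring))
  refine ⟨C₁ * C₂ * 2 ^ μ * ((∫ y : ℝ, (1 + |y|) ^ (-s₁)) + (∫ y : ℝ, (1 + |y|) ^ (-s₂)) + 1),
    fun y => C₁ * C₂ * (1 + |y|) ^ (-s₂), by positivity, hi2.const_mul _, fun y => by positivity,
    fun m m₁ => (hT m m₁).trans ?_, fun m => ?_⟩
  · have e1 : (1 + |m - m₁|) ^ (-s₁) ≤ 1 :=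
      Real.rpow_le_one_of_one_le_of_nonpos (by linarith [abs_nonneg (m - m₁)]) (by linarith)
    have e2 : Real.exp (-β * |m - m₁|) ≤ 1 := by
      rw [Real.exp_le_one_iff, neg_mul, neg_nonpos]; positivity
    have e3 : Real.exp (-β * |m₁|) ≤ 1 := by
      rw [Real.exp_le_one_iff, neg_mul, neg_nonpos]; positivity
    calc _ ≤ C₁ * C₂ * (1 * (1 + |m₁|) ^ (-s₂)) * (1 * 1) := by gcongr
      _ = _ := by ring
  · refine ⟨fun m₁ => C₁ * C₂ * (2 ^ μ * (1 + |m|) ^ ((n : ℝ) - μ) * Real.exp (-β * |m|)) *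
      ((1 + |m - m₁|) ^ (-s₁) + (1 + |m₁|) ^ (-s₂)), ((hi1.comp_sub_left m).add hi2).const_mul _,
      fun m₁ => (hT m m₁).trans ?_, fun m₁ => by positivity, ?_⟩
    · have e1 : |m| ≤ |m - m₁| + |m₁| := by
        have := abs_add_le (m - m₁) m₁
        rwa [sub_add_cancel] at this
      have e2 : Real.exp (-β * |m - m₁|) * Real.exp (-β * |m₁|) ≤ Real.exp (-β * |m|) := by
        rw [← Real.exp_add, Real.exp_le_exp]
        nlinarith
      have n1 : (Q₁.natDegree : ℝ) ≤ n := by exact_mod_cast h1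
      have n2 : (Q₂.natDegree : ℝ) ≤ n := by exact_mod_cast h2
      have e3 := rpow_neg_mul_rpow_neg_le (A := 1 + |m - m₁|) (B := 1 + |m₁|) (M := 1 + |m|)
        (s₁ := s₁) (s₂ := s₂) (μ := μ) (n := n) (by linarith [abs_nonneg (m - m₁)])
        (by linarith [abs_nonneg m₁]) (by linarith [abs_nonneg m]) (by linarith)
        (by linarith) (by linarith)
        (by linarith [Q₁.natDegree.cast_nonneg (α := ℝ)])
        (by linarith [Q₂.natDegree.cast_nonneg (α := ℝ)]) (by linarith) (by linarith)
      calc _ ≤ C₁ * C₂ * (2 ^ μ * (1 + |m|) ^ ((n : ℝ) - μ) *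
            ((1 + |m - m₁|) ^ (-s₁) + (1 + |m₁|) ^ (-s₂))) * Real.exp (-β * |m|) := by gcongr
        _ = _ := by ring
    · rw [MeasureTheory.integral_const_mul, MeasureTheory.integral_add (hi1.comp_sub_left m) hi2,
        MeasureTheory.integral_sub_left_eq_self (fun y : ℝ => (1 + |y|) ^ (-s₁))]
      -- The loss (1+|m|)^n caused by Q₁ and Q₂ is isolated here; with n = deg Q it is later
      -- compensated by |Q(im)|.
      have e4 : (1 + |m|) ^ ((n : ℝ) - μ) = (1 + |m|) ^ n * (1 + |m|) ^ (-μ) := by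
        rw [← Real.rpow_natCast, ← Real.rpow_add (by positivity)]; ring_nf
      rw [e4, decay]
      have e5 : 0 ≤ C₁ * C₂ * 2 ^ μ * ((1 + |m|) ^ n * ((1 + |m|) ^ (-μ) * Real.exp (-β * |m|))) := by
        positivity
      nlinarith

end Quad

section QuadOperator

variable {k ν β μ : ℝ} {Q₁ Q₂ : Polynomial ℂ} {S : Set ℂ} {w w' v v' : ℂ → ℝ → ℂ} {C C' : ℝ}

/-- Domination of the kernel, in terms of an integrable majorant of `quadTail`. -/
theorem integrable_quad_majorant (x : ℝ) {G : ℝ → ℝ} (hG : MeasureTheory.Integrable G) :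
    MeasureTheory.Integrable (fun p : ℝ × ℝ => quadProfile x p.1 * G p.2) stripMeasure := by
  refine MeasureTheory.Integrable.mul_prod (f := quadProfile x) ?_ hG
  exact ((continuous_quadProfile x).integrableOn_Icc (a := 0) (b := 1)).mono_set Ioo_subset_Icc_self

theorem integrable_quadKernel (hk : 0 < k) (hS : IsConic S) (hC : 0 ≤ C) (hC' : 0 ≤ C')
    {G : ℝ → ℝ} (hG : MeasureTheory.Integrable G) (hGb : ∀ m m₁, quadTail β μ Q₁ Q₂ m m₁ ≤ G m₁)
    (hwc : IsHC S w) (hvc : IsHC S v)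
    (hw : ∀ τ ∈ S, ∀ m, ‖w τ m‖ ≤ C * weight ν β μ k τ m)
    (hv : ∀ τ ∈ S, ∀ m, ‖v τ m‖ ≤ C' * weight ν β μ k τ m) {τ : ℂ} (hτ : τ ∈ S) (m : ℝ) :
    MeasureTheory.Integrable (fun p => quadKernel k Q₁ Q₂ w v p τ m) stripMeasure := by
  refine ((integrable_quad_majorant (‖τ‖ ^ k) hG).const_mul
    (C * C' * Real.exp (ν * ‖τ‖ ^ k))).mono'
    (quadKernel_aestronglyMeasurable hk hS hwc hvc hτ m) ?_
  filter_upwards [ae_stripMeasure_mem] with p hp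
  refine (norm_quadKernel_le hk hS hC hw hv hτ m hp).trans ?_
  have := hGb m p.2
  have := quadProfile_nonneg (‖τ‖ ^ k) p.1
  gcongr

/-- After s = u τ^k, the prefactor, ds and 1/((τ^k-s)s) cancel all powers of τ^k. Passing from the
iterated integral to the strip is Fubini's theorem, hence the integrability hypothesis. -/
theorem quadTerm_eq_quadBi (hk : 0 < k) (hk1 : k < 1) {τ : ℂ} (hτ : τ ≠ 0) (m : ℝ)
    (hint : MeasureTheory.Integrable (fun p => quadKernel k Q₁ Q₂ w w p τ m) stripMeasure) :
    quadTerm k Q₁ Q₂ w τ m = quadBi k Q₁ Q₂ w w τ m := by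
  have hz : τ ^ (k : ℂ) ≠ 0 := cpow_ne_zero' hτ _
  rw [quadTerm, quadBi, stripMeasure, MeasureTheory.integral_prod _ hint, segInt_eq_setIntegral,
    ← MeasureTheory.integral_const_mul, ← MeasureTheory.integral_const_mul]
  refine MeasureTheory.setIntegral_congr_fun measurableSet_Ioo fun u hu => ?_
  have hu' := one_sub_mem_Ioo hu
  have h1 : τ ^ (k : ℂ) - (u : ℂ) * τ ^ (k : ℂ) = ((1 - u : ℝ) : ℂ) * τ ^ (k : ℂ) := by
    push_cast; ring
  have hu0 : (u : ℂ) ≠ 0 := by exact_mod_cast hu.1.ne'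
  have hu1 : ((1 - u : ℝ) : ℂ) ≠ 0 := by exact_mod_cast hu'.1.ne'
  simp only [quadKernel]
  rw [h1, root_ofReal_mul_cpow hk hk1 hu.1 hτ, root_ofReal_mul_cpow hk hk1 hu'.1 hτ,
    MeasureTheory.integral_mul_const, MeasureTheory.integral_mul_const]
  generalize (∫ m₁ : ℝ, _ : ℂ) = J
  rw [Complex.ofReal_div, Complex.ofReal_one, Complex.ofReal_mul]
  field_simp

/-- Joint continuity requires a majorant independent of m; this is the role of `G`. For bounded |τ|
the dependence on u may be bounded crudely. -/
theorem IsHC.quadBi (hSo : IsOpen S) (hS : IsConic S) (hk : 0 < k) (hν : 0 ≤ ν) (hC : 0 ≤ C)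
    (hC' : 0 ≤ C') {G : ℝ → ℝ} (hG : MeasureTheory.Integrable G) (hG0 : ∀ y, 0 ≤ G y)
    (hGb : ∀ m m₁, quadTail β μ Q₁ Q₂ m m₁ ≤ G m₁) (hwc : IsHC S w) (hvc : IsHC S v)
    (hw : ∀ τ ∈ S, ∀ m, ‖w τ m‖ ≤ C * weight ν β μ k τ m)
    (hv : ∀ τ ∈ S, ∀ m, ‖v τ m‖ ≤ C' * weight ν β μ k τ m) :
    IsHC S (quadBi k Q₁ Q₂ w v) := by
  refine (IsHC.const _).mul (IsHC.integral hSo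
    (fun τ hτ m => quadKernel_aestronglyMeasurable hk hS hwc hvc hτ m) ?_ fun R => ?_)
  · filter_upwards [ae_stripMeasure_mem] with p hp
    refine (((IsHC.of_snd ((continuous_evalI Q₁).comp (continuous_id.sub continuous_const))).mul
      ((hwc.comp_scale fun τ hτ => hS.scale_mem hk (one_sub_mem_Ioo hp) hτ).comp_sub_right
        p.2)).mul ((IsHC.const _).mul
        ((hvc.comp_scale fun τ hτ => hS.scale_mem hk hp hτ).freeze p.2))).mul (IsHC.const _)
  · have hc : MeasureTheory.Integrable (fun p : ℝ × ℝ => (1 : ℝ) * G p.2) stripMeasure :=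
      MeasureTheory.Integrable.mul_prod (f := fun _ => (1 : ℝ)) (MeasureTheory.integrable_const _) hG
    refine ⟨_, hc.const_mul (C * C' * Real.exp (ν * |R| ^ k) * (|R| ^ k) ^ 2), ?_⟩
    filter_upwards [ae_stripMeasure_mem] with p hp τ hτ hR m
    refine (norm_quadKernel_le hk hS hC hw hv hτ m hp).trans ?_
    have h1 : ‖τ‖ ^ k ≤ |R| ^ k :=
      Real.rpow_le_rpow (norm_nonneg _) (hR.le.trans (le_abs_self R)) hk.le
    have h2 := quadProfile_le_sq (‖τ‖ ^ k) p.1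
    have h3 : quadProfile (‖τ‖ ^ k) p.1 ≤ (|R| ^ k) ^ 2 := h2.trans (by gcongr)
    have h4 := hGb m p.2
    have h5 := quadProfile_nonneg (‖τ‖ ^ k) p.1
    have h6 := hG0 p.2
    have h7 := quadTail_nonneg (β := β) (μ := μ) (Q₁ := Q₁) (Q₂ := Q₂) m p.2
    calc _ ≤ C * C' * Real.exp (ν * |R| ^ k) * ((|R| ^ k) ^ 2 * G p.2) := by gcongr
      _ = _ := by ring

theorem quadBi_sub (hk : 0 < k) (hS : IsConic S) {D : ℝ} (hC : 0 ≤ C) (hD : 0 ≤ D)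
    {G : ℝ → ℝ} (hG : MeasureTheory.Integrable G) (hGb : ∀ m m₁, quadTail β μ Q₁ Q₂ m m₁ ≤ G m₁)
    (hwc : IsHC S w) (hwc' : IsHC S w')
    (hw : ∀ τ ∈ S, ∀ m, ‖w τ m‖ ≤ C * weight ν β μ k τ m)
    (hw' : ∀ τ ∈ S, ∀ m, ‖w' τ m‖ ≤ C * weight ν β μ k τ m)
    (hww' : ∀ τ ∈ S, ∀ m, ‖w τ m - w' τ m‖ ≤ D * weight ν β μ k τ m)
    {τ : ℂ} (hτ : τ ∈ S) (m : ℝ) :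
    quadBi k Q₁ Q₂ w w τ m - quadBi k Q₁ Q₂ w' w' τ m =
      quadBi k Q₁ Q₂ (fun τ m => w τ m - w' τ m) w τ m +
        quadBi k Q₁ Q₂ w' (fun τ m => w τ m - w' τ m) τ m := by
  have i1 := integrable_quadKernel hk hS hC hC hG hGb hwc hwc hw hw hτ m
  have i2 := integrable_quadKernel hk hS hC hC hG hGb hwc' hwc' hw' hw' hτ m
  have i3 := integrable_quadKernel hk hS hD hC hG hGb (hwc.sub hwc') hwc hww' hw hτ m
  have i4 := integrable_quadKernel hk hS hC hD hG hGb hwc' (hwc.sub hwc') hw' hww' hτ m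
  rw [quadBi, quadBi, quadBi, quadBi, ← mul_sub, ← mul_add, ← MeasureTheory.integral_sub i1 i2,
    ← MeasureTheory.integral_add i3 i4]
  congr 2 with p
  simp only [quadKernel]
  ring

/-- The bilinear form is bounded, up to the factor `Q(im)`. -/
theorem exists_quadBi_bound (hk : 0 < k) (hS : IsConic S) (hβ : 0 ≤ β) {Q : Polynomial ℂ}
    (hQ : ∀ m : ℝ, evalI Q m ≠ 0) (h1 : Q₁.natDegree ≤ Q.natDegree)
    (h2 : Q₂.natDegree ≤ Q.natDegree) (hμ1 : (Q₁.natDegree : ℝ) + 1 < μ)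
    (hμ2 : (Q₂.natDegree : ℝ) + 1 < μ) :
    ∃ (L : ℝ) (G : ℝ → ℝ), 0 < L ∧ MeasureTheory.Integrable G ∧ (∀ y, 0 ≤ G y) ∧
      (∀ m m₁, quadTail β μ Q₁ Q₂ m m₁ ≤ G m₁) ∧
      ∀ (w v : ℂ → ℝ → ℂ) (C C' : ℝ), 0 ≤ C → 0 ≤ C' →
        (∀ τ ∈ S, ∀ m, ‖w τ m‖ ≤ C * weight ν β μ k τ m) →
        (∀ τ ∈ S, ∀ m, ‖v τ m‖ ≤ C' * weight ν β μ k τ m) →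
        ∀ τ ∈ S, ∀ m, ‖quadBi k Q₁ Q₂ w v τ m‖ ≤
          L * (C * C') * weight ν β μ k τ m * ‖evalI Q m‖ := by
  obtain ⟨K, G, hK, hG, hG0, hGb, hg⟩ := exists_quadTail_bound hβ h1 h2 hμ1 hμ2
  obtain ⟨c, hc, hcQ⟩ := exists_norm_evalI_ge hQ
  refine ⟨4 * Real.pi * K / c, G, by have := Real.pi_pos; positivity, hG, hG0, hGb, ?_⟩
  intro w v C C' hC hC' hw hv τ hτ m
  obtain ⟨g, hgi, hgb, hg0, hgI⟩ := hg m
  have hx : 0 < ‖τ‖ ^ k := Real.rpow_pos_of_pos (norm_pos_iff.2 (hS.ne_zero hτ)) _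
  have hdec := decay_pos β μ m
  have hsq : ‖(1 / ((2 * Real.pi) ^ (1 / 2 : ℝ) : ℝ) : ℂ)‖ ≤ 1 := by
    have h3 : (1 : ℝ) ≤ (2 * Real.pi) ^ (1 / 2 : ℝ) :=
      Real.one_le_rpow (by linarith [Real.pi_gt_three]) (by norm_num)
    rw [norm_div, norm_one, Complex.norm_real, Real.norm_of_nonneg (by linarith)]
    exact div_le_one_of_le₀ h3 (by linarith)
  have hint : ‖∫ p, quadKernel k Q₁ Q₂ w v p τ m ∂stripMeasure‖ ≤
      C * C' * Real.exp (ν * ‖τ‖ ^ k) *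
        ((∫ u in Ioo (0 : ℝ) 1, quadProfile (‖τ‖ ^ k) u) * ∫ m₁, g m₁) := by
    have h4 : ∫ p : ℝ × ℝ, quadProfile (‖τ‖ ^ k) p.1 * g p.2 ∂stripMeasure =
        (∫ u in Ioo (0 : ℝ) 1, quadProfile (‖τ‖ ^ k) u) * ∫ m₁, g m₁ :=
      MeasureTheory.integral_prod_mul (quadProfile (‖τ‖ ^ k)) g
    rw [← h4, ← MeasureTheory.integral_const_mul]
    refine MeasureTheory.norm_integral_le_of_norm_le
      ((integrable_quad_majorant (‖τ‖ ^ k) hgi).const_mul _) ?_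
    filter_upwards [ae_stripMeasure_mem] with p hp
    refine (norm_quadKernel_le hk hS hC hw hv hτ m hp).trans ?_
    have := hgb p.2
    have := quadProfile_nonneg (‖τ‖ ^ k) p.1
    gcongr
  have hJ := integral_quadProfile_le hx
  have hgI0 : 0 ≤ ∫ m₁, g m₁ := MeasureTheory.integral_nonneg hg0
  have hpi := Real.pi_pos
  rw [quadBi, norm_mul]
  calc _ ≤ 1 * (C * C' * Real.exp (ν * ‖τ‖ ^ k) *
        ((4 * Real.pi * (‖τ‖ ^ k / (1 + (‖τ‖ ^ k) ^ 2))) * (K * (1 + |m|) ^ Q.natDegree *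
          decay β μ m))) := by
        refine mul_le_mul hsq (hint.trans ?_) (norm_nonneg _) zero_le_one
        gcongr
    _ = 4 * Real.pi * K / c * (C * C') * weight ν β μ k τ m * (c * (1 + |m|) ^ Q.natDegree) := by
        rw [weight]; field_simp
    _ ≤ _ := by
        have := weight_nonneg (ν := ν) (β := β) (μ := μ) (k := k) τ m
        have := hcQ m
        gcongr

end QuadOperator

/-! ### The forcing term. -/

section Psi

variable {k ν β μ : ℝ}

/-- Restricting the Gamma integral to (X, X+1] gives Γ(s) ≥ X^{s-1} e^{-(X+1)}. Since X is free, the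
choice X = ν' r^k yields at once the factor r^k e^{ν' r^k} and a geometric ratio. -/
theorem rpow_div_Gamma_le {s X y : ℝ} (hs : 1 ≤ s) (hX : 0 < X) (hy : 0 ≤ y) :
    y ^ s / Real.Gamma s ≤ X * Real.exp (X + 1) * (y / X) ^ s := by
  have hs0 : 0 < s := by linarith
  have hΓ := Real.Gamma_pos_of_pos hs0
  have h1 : X ^ (s - 1) * Real.exp (-(X + 1)) ≤ Real.Gamma s := by
    rw [Real.Gamma_eq_integral hs0]
    have h2 : ∫ _ in Ioc X (X + 1), X ^ (s - 1) * Real.exp (-(X + 1)) ≤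
        ∫ t in Ioc X (X + 1), Real.exp (-t) * t ^ (s - 1) := by
      refine MeasureTheory.setIntegral_mono_on (MeasureTheory.integrable_const _)
        ((Real.GammaIntegral_convergent hs0).mono_set fun t ht => ?_) measurableSet_Ioc
        fun t ht => ?_
      · exact lt_trans hX ht.1
      · rw [mul_comm]
        have e1 : Real.exp (-(X + 1)) ≤ Real.exp (-t) := Real.exp_le_exp.2 (by linarith [ht.2])
        have e2 : X ^ (s - 1) ≤ t ^ (s - 1) := Real.rpow_le_rpow hX.le ht.1.le (by linarith)
        gcongr
    have h3 : ∫ _ in Ioc X (X + 1), X ^ (s - 1) * Real.exp (-(X + 1)) =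
        X ^ (s - 1) * Real.exp (-(X + 1)) := by
      simp
    rw [h3] at h2
    refine h2.trans (MeasureTheory.setIntegral_mono_set (Real.GammaIntegral_convergent hs0) ?_
      (Filter.Eventually.of_forall fun t ht => lt_trans hX ht.1))
    filter_upwards [MeasureTheory.ae_restrict_mem measurableSet_Ioi] with t ht
    exact mul_nonneg (Real.exp_pos _).le (Real.rpow_nonneg (le_of_lt ht) _)
  rw [div_le_iff₀ hΓ]
  have h4 : X * Real.exp (X + 1) * (y / X) ^ s * (X ^ (s - 1) * Real.exp (-(X + 1))) = y ^ s := by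
    rw [Real.div_rpow hy hX.le, Real.exp_neg]
    have h5 : X * X ^ (s - 1) = X ^ s := by
      rw [mul_comm, ← Real.rpow_add_one hX.ne', sub_add_cancel]
    have h6 : X ^ s ≠ 0 := (Real.rpow_pos_of_pos hX s).ne'
    calc _ = (X * X ^ (s - 1)) * (Real.exp (X + 1) * (Real.exp (X + 1))⁻¹) * (y ^ s / X ^ s) := by
          ring
      _ = _ := by
          rw [h5, mul_inv_cancel₀ (Real.exp_pos _).ne']
          field_simp
  rw [← h4]
  gcongr

/-- The terms of the series `ψ` are dominated by a geometric series. -/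
theorem exists_psi_term_bound (hk : 0 < k) (hk1 : k < 1) {T₀ : ℝ} (hT₀ : 0 < T₀)
    (hν : (1 / T₀) ^ k < ν) :
    ∃ (c ν' q : ℝ), 0 < c ∧ 0 < ν' ∧ ν' < ν ∧ 0 < q ∧ q < 1 ∧ ∀ (r : ℝ), 0 < r → ∀ j : ℕ,
      (1 / T₀) ^ (j + 1) * r ^ (j + 1) / Real.Gamma (((j + 1 : ℕ) : ℝ) / k) ≤
        c * r ^ k * Real.exp (ν' * r ^ k) * q ^ (j + 1) := by
  -- The gap between T₀^{-k} and ν' makes the ratio `q` smaller than 1; the gap between ν' and ν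
  -- will pay for the factor 1 + |τ|^{2k} of the norm.
  obtain ⟨ν', hν'1, hν'2⟩ := exists_between hν
  have hT : 0 < (1 / T₀) ^ k := by positivity
  have hν'0 : 0 < ν' := hT.trans hν'1
  refine ⟨ν' * Real.exp 1, ν', ((1 / T₀) ^ k / ν') ^ (1 / k), by positivity, hν'0, hν'2,
    by positivity, Real.rpow_lt_one (by positivity) ((div_lt_one hν'0).2 hν'1) (by positivity),
    fun r hr j => ?_⟩
  have hrk : 0 < r ^ k := Real.rpow_pos_of_pos hr k
  have hjk : (1 : ℝ) ≤ ((j + 1 : ℕ) : ℝ) / k := by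
    rw [le_div_iff₀ hk]; push_cast; linarith [j.cast_nonneg (α := ℝ)]
  have h1 := rpow_div_Gamma_le (X := ν' * r ^ k) (y := (1 / T₀) ^ k * r ^ k) hjk
    (by positivity) (by positivity)
  have e1 : ((1 / T₀) ^ k * r ^ k) ^ (((j + 1 : ℕ) : ℝ) / k) = (1 / T₀) ^ (j + 1) * r ^ (j + 1) := by
    rw [← Real.mul_rpow (by positivity) hr.le, ← Real.rpow_mul (by positivity),
      mul_div_cancel₀ _ hk.ne', Real.rpow_natCast, mul_pow]
  have e2 : ((1 / T₀) ^ k * r ^ k / (ν' * r ^ k)) ^ (((j + 1 : ℕ) : ℝ) / k) =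
      (((1 / T₀) ^ k / ν') ^ (1 / k)) ^ (j + 1) := by
    rw [mul_div_mul_right _ _ hrk.ne', ← Real.rpow_natCast, ← Real.rpow_mul (by positivity)]
    ring_nf
  rw [e1, e2, Real.exp_add] at h1
  refine h1.trans (le_of_eq (by ring))

variable {S : Set ℂ} {F : ℕ → ℝ → ℂ → ℂ} {K₀ T₀ ε₀ : ℝ}

theorem norm_F_le {f : ℝ → ℂ} {K : ℝ} (hf : MemE β μ f) (hn : normE β μ f ≤ K) (m : ℝ) :
    ‖f m‖ ≤ K * decay β μ m := by
  have h1 := (le_ciSup hf.2 m).trans hn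
  have hm : (0 : ℝ) < 1 + |m| := by positivity
  have h2 : (1 + |m|) ^ μ * Real.exp (β * |m|) * decay β μ m = 1 := by
    rw [decay]
    have h3 : (1 + |m|) ^ μ * (1 + |m|) ^ (-μ) = 1 := by
      rw [← Real.rpow_add hm, add_neg_cancel, Real.rpow_zero]
    have h4 : Real.exp (β * |m|) * Real.exp (-β * |m|) = 1 := by
      rw [← Real.exp_add, neg_mul, add_neg_cancel, Real.exp_zero]
    calc _ = ((1 + |m|) ^ μ * (1 + |m|) ^ (-μ)) * (Real.exp (β * |m|) * Real.exp (-β * |m|)) := by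
          ring
      _ = 1 := by rw [h3, h4, one_mul]
  calc ‖f m‖ = (1 + |m|) ^ μ * Real.exp (β * |m|) * ‖f m‖ * decay β μ m := by
        linear_combination -‖f m‖ * h2
    _ ≤ _ := mul_le_mul_of_nonneg_right h1 (decay_pos β μ m).le

/-- The forcing term belongs to the space, with a bound that is uniform in the parameter. -/
theorem exists_psi_bound (hSo : IsOpen S) (hS : IsConic S) (hk : 0 < k) (hk1 : k < 1)
    (hβ : 0 ≤ β) (hμ : 0 ≤ μ) (hK₀ : 0 < K₀) (hT₀ : 0 < T₀) (hν : (1 / T₀) ^ k < ν)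
    (hF : ∀ n, 1 ≤ n → ∀ ε ∈ Metric.ball (0 : ℂ) ε₀, MemE β μ (fun m => F n m ε))
    (hFn : ∀ n, 1 ≤ n → ∀ ε ∈ Metric.ball (0 : ℂ) ε₀,
        normE β μ (fun m => F n m ε) ≤ K₀ * (1 / T₀) ^ n) :
    ∃ L : ℝ, 0 < L ∧ ∀ ε ∈ Metric.ball (0 : ℂ) ε₀, IsHC S (fun τ m => psi k F τ m ε) ∧
      ∀ τ ∈ S, ∀ m, ‖psi k F τ m ε‖ ≤ L * weight ν β μ k τ m := by
  obtain ⟨c, ν', q, hc, hν'0, hν'ν, hq0, hq1, hterm⟩ := exists_psi_term_bound hk hk1 hT₀ hν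
  have hΓ : ∀ j : ℕ, 0 < Real.Gamma (((j + 1 : ℕ) : ℝ) / k) := fun j =>
    Real.Gamma_pos_of_pos (by positivity)
  have hb : ∀ ε ∈ Metric.ball (0 : ℂ) ε₀, ∀ τ : ℂ, τ ≠ 0 → ∀ m j,
      ‖F (j + 1) m ε * τ ^ (j + 1) / (Real.Gamma (((j + 1 : ℕ) : ℝ) / k) : ℂ)‖ ≤
      K₀ * decay β μ m * (c * ‖τ‖ ^ k * Real.exp (ν' * ‖τ‖ ^ k)) * q ^ (j + 1) := by
    intro ε hε τ hτ m j
    have h1 := norm_F_le (hF (j + 1) (by omega) ε hε) (hFn (j + 1) (by omega) ε hε) m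
    have h2 := hterm ‖τ‖ (norm_pos_iff.2 hτ) j
    have hd := (decay_pos β μ m).le
    have hg := hΓ j
    rw [norm_div, norm_mul, norm_pow, Complex.norm_real, Real.norm_of_nonneg hg.le]
    calc _ ≤ K₀ * (1 / T₀) ^ (j + 1) * decay β μ m * ‖τ‖ ^ (j + 1) /
          Real.Gamma (((j + 1 : ℕ) : ℝ) / k) := by gcongr
      _ = K₀ * decay β μ m * ((1 / T₀) ^ (j + 1) * ‖τ‖ ^ (j + 1) /
          Real.Gamma (((j + 1 : ℕ) : ℝ) / k)) := by ring
      _ ≤ K₀ * decay β μ m * (c * ‖τ‖ ^ k * Real.exp (ν' * ‖τ‖ ^ k) * q ^ (j + 1)) := by gcongr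
      _ = _ := by ring
  have hsum : Summable fun j : ℕ => q ^ (j + 1) :=
    (summable_nat_add_iff 1).2 (summable_geometric_of_lt_one hq0.le hq1)
  have hsum0 : 0 ≤ ∑' j : ℕ, q ^ (j + 1) := tsum_nonneg fun j => by positivity
  have hν'' : 0 < (ν - ν') := sub_pos.2 hν'ν
  obtain ⟨L₂, hL₂, hL₂b⟩ : ∃ L : ℝ, 0 < L ∧ ∀ x : ℝ, 0 ≤ x →
      (1 + x ^ 2) * Real.exp (-((ν - ν') * x)) ≤ L := by
    refine ⟨1 + (2 / (ν - ν')) ^ (2 : ℝ), by positivity, fun x hx => ?_⟩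
    have h1 := rpow_mul_exp_neg_le (s := 2) two_pos hν'' hx
    have h2 : Real.exp (-((ν - ν') * x)) ≤ 1 := by
      rw [Real.exp_le_one_iff, neg_nonpos]; positivity
    rw [Real.rpow_two] at h1
    linarith
  refine ⟨K₀ * c * L₂ * (∑' j : ℕ, q ^ (j + 1) + 1), by positivity, fun ε hε => ⟨?_, ?_⟩⟩
  · refine IsHC.tsum hSo (fun j => ?_) fun R => ?_
    · refine IsHC.div ((IsHC.of_snd (hF (j + 1) (by omega) ε hε).1).mul
        (IsHC.of_fst (by fun_prop))) (IsHC.const _) fun τ _ m => ?_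
      exact_mod_cast (hΓ j).ne'
    · refine ⟨_, hsum.mul_left (K₀ * 1 * (c * |R| ^ k * Real.exp (ν' * |R| ^ k))),
        fun j τ hτ hR m => ?_⟩
      refine (hb ε hε τ (hS.ne_zero hτ) m j).trans ?_
      have h1 : ‖τ‖ ^ k ≤ |R| ^ k :=
        Real.rpow_le_rpow (norm_nonneg _) (hR.le.trans (le_abs_self R)) hk.le
      have h2 := decay_le_one hβ hμ m
      have h3 := (decay_pos β μ m).le
      gcongr
  · intro τ hτ m
    have h1 : ‖psi k F τ m ε‖ ≤ K₀ * decay β μ m * (c * ‖τ‖ ^ k * Real.exp (ν' * ‖τ‖ ^ k)) *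
        ∑' j : ℕ, q ^ (j + 1) :=
      tsum_of_norm_bounded (hsum.hasSum.mul_left _) fun j => hb ε hε τ (hS.ne_zero hτ) m j
    have hx : 0 ≤ ‖τ‖ ^ k := by positivity
    have hd := decay_pos β μ m
    have h2 : Real.exp (ν' * ‖τ‖ ^ k) =
        Real.exp (ν * ‖τ‖ ^ k) * Real.exp (-((ν - ν') * ‖τ‖ ^ k)) := by
      rw [← Real.exp_add]; ring_nf
    refine h1.trans ?_
    calc _ = K₀ * c * ((1 + (‖τ‖ ^ k) ^ 2) * Real.exp (-((ν - ν') * ‖τ‖ ^ k))) *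
          (∑' j : ℕ, q ^ (j + 1)) * weight ν β μ k τ m := by
          rw [h2, weight]; field_simp
      _ ≤ K₀ * c * L₂ * (∑' j : ℕ, q ^ (j + 1) + 1) * weight ν β μ k τ m := by
          have h3 := hL₂b _ hx
          have h4 := weight_nonneg (ν := ν) (β := β) (μ := μ) (k := k) τ m
          gcongr
          linarith

end Psi

/-! ### Bounded linear operators and the linear part of the equation. -/

/-- A family of linear operators, bounded in the weighted norms and compatible with differences. -/
def IsLinOp (S : Set ℂ) (W N : ℂ → ℝ → ℝ) (E : Set ℂ) (B : ℂ → (ℂ → ℝ → ℂ) → ℂ → ℝ → ℂ) : Prop :=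
  ∃ L : ℝ, 0 ≤ L ∧ ∀ ε ∈ E,
    (∀ (w : ℂ → ℝ → ℂ) (C : ℝ), 0 < C → InBall S W C w →
      IsHC S (B ε w) ∧ ∀ τ ∈ S, ∀ m, ‖B ε w τ m‖ ≤ L * C * W τ m * N τ m) ∧
    ∀ (w w' : ℂ → ℝ → ℂ) (C : ℝ), 0 < C → InBall S W C w → InBall S W C w' → ∀ τ ∈ S, ∀ m,
      B ε (fun τ m => w τ m - w' τ m) τ m = B ε w τ m - B ε w' τ m

namespace IsLinOp

variable {S : Set ℂ} {W N N' : ℂ → ℝ → ℝ} {E : Set ℂ}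

/-- A factor depending on m is absorbed by the change of normalisation from `N'` to `N`; R_l(im) is
handled in this way. -/
theorem mul {B : ℂ → (ℂ → ℝ → ℂ) → ℂ → ℝ → ℂ} (hB : IsLinOp S W N' E B)
    (hW : ∀ τ ∈ S, ∀ m, 0 ≤ W τ m) {a : ℂ → ℝ → ℂ} (ha : ∀ ε ∈ E, Continuous (a ε)) {M : ℝ}
    (hM : 0 ≤ M) (hN : ∀ ε ∈ E, ∀ τ ∈ S, ∀ m, ‖a ε m‖ * N' τ m ≤ M * N τ m) :
    IsLinOp S W N E fun ε w τ m => a ε m * B ε w τ m := by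
  obtain ⟨L, hL, h⟩ := hB
  refine ⟨M * L, mul_nonneg hM hL, fun ε hε => ⟨fun w C hC hw => ?_, fun w w' C hC hw hw' τ hτ m => ?_⟩⟩
  · obtain ⟨h1, h2⟩ := (h ε hε).1 w C hC hw
    refine ⟨(IsHC.of_snd (ha ε hε)).mul h1, fun τ hτ m => ?_⟩
    rw [norm_mul]
    have h3 := hW τ hτ m
    calc _ ≤ ‖a ε m‖ * (L * C * W τ m * N' τ m) :=
          mul_le_mul_of_nonneg_left (h2 τ hτ m) (norm_nonneg _)
      _ = L * C * W τ m * (‖a ε m‖ * N' τ m) := by ring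
      _ ≤ L * C * W τ m * (M * N τ m) :=
          mul_le_mul_of_nonneg_left (hN ε hε τ hτ m) (by positivity)
      _ = _ := by ring
  · beta_reduce
    rw [(h ε hε).2 w w' C hC hw hw' τ hτ m, mul_sub]

/-- Finite sums with coefficients of modulus at most `c₀`. -/
theorem sum_mul {ι : Type*} {s : Finset ι} {B : ι → ℂ → (ℂ → ℝ → ℂ) → ℂ → ℝ → ℂ}
    (hW : ∀ τ ∈ S, ∀ m, 0 ≤ W τ m) (hN : ∀ τ ∈ S, ∀ m, 0 ≤ N τ m)
    (hB : ∀ i ∈ s, IsLinOp S W N E (B i)) :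
    ∃ L : ℝ, 0 ≤ L ∧ ∀ (c₀ : ℝ) (c : ι → ℂ), (∀ i ∈ s, ‖c i‖ ≤ c₀) → ∀ ε ∈ E,
      (∀ (w : ℂ → ℝ → ℂ) (C : ℝ), 0 < C → InBall S W C w →
        IsHC S (fun τ m => ∑ i ∈ s, c i * B i ε w τ m) ∧
        ∀ τ ∈ S, ∀ m, ‖∑ i ∈ s, c i * B i ε w τ m‖ ≤ c₀ * L * C * W τ m * N τ m) ∧
      ∀ (w w' : ℂ → ℝ → ℂ) (C : ℝ), 0 < C → InBall S W C w → InBall S W C w' → ∀ τ ∈ S, ∀ m,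
        ∑ i ∈ s, c i * B i ε (fun τ m => w τ m - w' τ m) τ m =
          ∑ i ∈ s, c i * B i ε w τ m - ∑ i ∈ s, c i * B i ε w' τ m := by
  choose! L hL h using hB
  refine ⟨∑ i ∈ s, L i, Finset.sum_nonneg hL, fun c₀ c hc ε hε =>
    ⟨fun w C hC hw => ⟨?_, fun τ hτ m => ?_⟩, fun w w' C hC hw hw' τ hτ m => ?_⟩⟩
  · exact IsHC.sum fun i hi => (IsHC.const _).mul ((h i hi ε hε).1 w C hC hw).1
  · refine (norm_sum_le _ _).trans ?_
    rw [Finset.mul_sum, Finset.sum_mul, Finset.sum_mul, Finset.sum_mul]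
    refine Finset.sum_le_sum fun i hi => ?_
    have h1 := ((h i hi ε hε).1 w C hC hw).2 τ hτ m
    have h2 := hc i hi
    have h3 := hL i hi
    have h4 := hW τ hτ m
    have h5 := hN τ hτ m
    have h6 := (norm_nonneg _).trans h2
    rw [norm_mul]
    calc _ ≤ c₀ * (L i * C * W τ m * N τ m) := by gcongr
      _ = _ := by ring
  · rw [← Finset.sum_sub_distrib]
    refine Finset.sum_congr rfl fun i hi => ?_
    rw [(h i hi ε hε).2 w w' C hC hw hw' τ hτ m, mul_sub]

theorem sum {ι : Type*} {s : Finset ι} {B : ι → ℂ → (ℂ → ℝ → ℂ) → ℂ → ℝ → ℂ}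
    (hW : ∀ τ ∈ S, ∀ m, 0 ≤ W τ m) (hN : ∀ τ ∈ S, ∀ m, 0 ≤ N τ m)
    (hB : ∀ i ∈ s, IsLinOp S W N E (B i)) : IsLinOp S W N E fun ε w τ m => ∑ i ∈ s, B i ε w τ m := by
  obtain ⟨L, hL, h⟩ := sum_mul hW hN hB
  exact ⟨L, hL, fun ε hε => by simpa using h 1 (fun _ => 1) (by simp) ε hε⟩

theorem add {B B' : ℂ → (ℂ → ℝ → ℂ) → ℂ → ℝ → ℂ} (hW : ∀ τ ∈ S, ∀ m, 0 ≤ W τ m)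
    (hN : ∀ τ ∈ S, ∀ m, 0 ≤ N τ m) (hB : IsLinOp S W N E B) (hB' : IsLinOp S W N E B') :
    IsLinOp S W N E fun ε w τ m => B ε w τ m + B' ε w τ m := by
  have := sum (s := Finset.univ) (B := fun b : Bool => if b then B else B') hW hN fun i _ => by
    cases i <;> simpa
  simpa using this

end IsLinOp

namespace DenomBound

variable {k ν β μ d δ ρ AH b A' : ℝ} {q : ℝ → ℝ} {Hn : ℂ → ℝ → ℝ}

/-- Normalising by |H|/|Q| rather than |H| keeps a factor |Q(im)| in reserve against R_l(im). -/
theorem isLinOp_convExp (hD : DenomBound k ν β μ d δ ρ AH b A' q Hn) (hq : ∀ m, 0 < q m)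
    {K₁ κ a : ℝ} (hκ : 0 < κ) (hK : IsExpOpBound k ν K₁)
    (hκb : κ * K₁ * (k / Real.Gamma (1 / k - 1)) < b) (ha : 0 < a) {p : ℕ} (hp : 1 ≤ p)
    (E : Set ℂ) : IsLinOp (tauDomain d δ ρ) (weight ν β μ k) (fun τ m => Hn τ m / q m) E
      fun _ => convExp k κ a p := by
  have hk0 : 0 < k := by linarith [hD.hk]
  have hν0 : 0 < ν := by linarith [hD.hν]
  obtain ⟨L, hL, h⟩ := hD.exists_convExp_bound hκ hK hκb ha hp
  refine ⟨L, hL.le, fun ε _ => ⟨fun w C hC hw => ⟨?_, fun τ hτ m => ?_⟩,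
    fun w w' C hC hw hw' => ?_⟩⟩
  · exact hw.1.convExp hD.isOpen (isConic_tauDomain d δ ρ) hD.subset_slitPlane hk0 hD.hk1 hν0 hκ
      ha hp hC.le (hD.growth hC.le hw.2)
  · rw [← mul_div_assoc, le_div_iff₀ (hq m), mul_comm]
    exact h w C hC hw.1 hw.2 τ hτ m
  · exact convExp_sub hD.isOpen (isConic_tauDomain d δ ρ) hk0 hD.hk1 hν0 hκ ha hp hw.1 hC.le
      (hD.growth hC.le hw.2) hw'.1 hC.le (hD.growth hC.le hw'.2)

theorem norm_nonneg' (hD : DenomBound k ν β μ d δ ρ AH b A' q Hn) :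
    ∀ τ ∈ tauDomain d δ ρ, ∀ m, 0 ≤ Hn τ m := by
  intro τ hτ m
  have h1 := hD.q_nonneg m
  have h2 := hD.hAH
  have h3 := hD.hA'
  rcases hτ with h | h
  · exact le_trans (by positivity) (hD.sector τ h m)
  · exact le_trans (by positivity) (hD.cutDisc τ h m)

theorem min_mul_le (hD : DenomBound k ν β μ d δ ρ AH b A' q Hn) :
    ∀ τ ∈ tauDomain d δ ρ, ∀ m, min AH A' * q m ≤ Hn τ m := by
  intro τ hτ m
  have h1 := hD.q_nonneg m
  have h2 := hD.hAH
  rcases hτ with h | h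
  · refine le_trans ?_ (hD.sector τ h m)
    have h3 : 1 ≤ Real.exp (b * ‖τ‖ ^ k) := by
      rw [Real.one_le_exp_iff]
      have := hD.hb
      positivity
    calc _ ≤ AH * q m := by gcongr; exact min_le_left _ _
      _ ≤ _ := le_mul_of_one_le_right (by positivity) h3
  · refine le_trans ?_ (hD.cutDisc τ h m)
    gcongr
    exact min_le_right _ _

/-- All kernels are integrable: (n + d_{l,k})/k is positive, and δ_l - p ≥ 0 only raises the
exponent. -/
theorem isLinOp_bracket (hD : DenomBound k ν β μ d δ ρ AH b A' q Hn) (hq : ∀ m, 0 < q m)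
    {K₁ κ dk : ℝ} (hκ : 0 < κ) (hK : IsExpOpBound k ν K₁)
    (hκb : κ * K₁ * (k / Real.Gamma (1 / k - 1)) < b) (hdk : 0 < dk) {δ₁ : ℕ} (hδ₁ : 1 ≤ δ₁)
    (n : ℕ) (E : Set ℂ) :
    IsLinOp (tauDomain d δ ρ) (weight ν β μ k) (fun τ m => Hn τ m / q m) E
      fun _ => bracket k κ dk δ₁ n := by
  have hk0 : 0 < k := by linarith [hD.hk]
  have hW : ∀ τ ∈ tauDomain d δ ρ, ∀ m, 0 ≤ weight ν β μ k τ m := fun τ _ m => weight_nonneg τ m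
  have hN : ∀ τ ∈ tauDomain d δ ρ, ∀ m, 0 ≤ Hn τ m / q m := fun τ hτ m =>
    div_nonneg (hD.norm_nonneg' τ hτ m) (hq m).le
  have ha : 0 < ((n : ℝ) + dk) / k := by positivity
  refine IsLinOp.add hW hN (hD.isLinOp_convExp hq hκ hK hκb ha hδ₁ E)
    (IsLinOp.sum hW hN fun p hp => ?_)
  obtain ⟨hp1, hp2⟩ := Finset.mem_Icc.1 hp
  have hpδ : (p : ℝ) ≤ δ₁ := by exact_mod_cast (by omega : p ≤ δ₁)
  refine (hD.isLinOp_convExp hq hκ hK hκb (a := ((n : ℝ) + dk) / k + δ₁ - p) (by linarith) hp1 E).mul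
    hW (fun _ _ => continuous_const) (abs_nonneg (tahara k δ₁ p)) fun ε _ τ hτ m => ?_
  rw [Complex.norm_real, Real.norm_eq_abs]

end DenomBound

namespace DenomBound

variable {k ν β μ d δ ρ AH b A' : ℝ} {Hn : ℂ → ℝ → ℝ}

/-- The contribution of one index `l` to the linear part of the equation. -/
theorem isLinOp_summand {Q R : Polynomial ℂ}
    (hD : DenomBound k ν β μ d δ ρ AH b A' (fun m => ‖evalI Q m‖) Hn)
    (hQ : ∀ m : ℝ, evalI Q m ≠ 0) (hR : R.natDegree ≤ Q.natDegree)
    {K₁ κ dk : ℝ} (hκ : 0 < κ) (hK : IsExpOpBound k ν K₁)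
    (hκb : κ * K₁ * (k / Real.Gamma (1 / k - 1)) < b) (hdk : 0 < dk) {δ₁ : ℕ} (hδ₁ : 1 ≤ δ₁)
    {ε₀ : ℝ} {I : Finset ℕ} {A : ℕ → ℂ → ℂ}
    (hA : ∀ n ∈ I, ∃ M : ℝ, ∀ ε ∈ Metric.ball (0 : ℂ) ε₀, ‖A n ε‖ ≤ M) (e : ℕ) :
    IsLinOp (tauDomain d δ ρ) (weight ν β μ k) Hn (Metric.ball (0 : ℂ) ε₀) fun ε w τ m =>
      ε ^ e * evalI R m * ∑ n ∈ I, A n ε * bracket k κ dk δ₁ n w τ m := by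
  have hq : ∀ m, 0 < ‖evalI Q m‖ := fun m => norm_pos_iff.2 (hQ m)
  have hW : ∀ τ ∈ tauDomain d δ ρ, ∀ m, 0 ≤ weight ν β μ k τ m := fun τ _ m => weight_nonneg τ m
  have hN : ∀ τ ∈ tauDomain d δ ρ, ∀ m, 0 ≤ Hn τ m / ‖evalI Q m‖ := fun τ hτ m =>
    div_nonneg (hD.norm_nonneg' τ hτ m) (hq m).le
  obtain ⟨C, hC, hRQ⟩ := exists_norm_evalI_le_of_natDegree_le hR hQ
  refine IsLinOp.mul (N' := fun τ m => Hn τ m / ‖evalI Q m‖) (a := fun ε m => ε ^ e * evalI R m)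
    (M := |ε₀| ^ e * C) (IsLinOp.sum hW hN fun n hn => ?_) hW
    (fun ε _ => continuous_const.mul (continuous_evalI R)) (by positivity) fun ε hε τ hτ m => ?_
  · obtain ⟨M, hM⟩ := hA n hn
    refine (hD.isLinOp_bracket hq hκ hK hκb hdk hδ₁ n (Metric.ball (0 : ℂ) ε₀)).mul hW
      (a := fun ε _ => A n ε) (M := |M|) (fun _ _ => continuous_const) (abs_nonneg M)
      fun ε hε τ hτ m => ?_
    exact mul_le_mul_of_nonneg_right ((hM ε hε).trans (le_abs_self M)) (hN τ hτ m)
  · have h1 : ‖ε‖ ≤ |ε₀| := by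
      have : ‖ε‖ < ε₀ := by simpa using hε
      exact this.le.trans (le_abs_self _)
    have h2 := hN τ hτ m
    rw [norm_mul, norm_pow]
    calc _ ≤ |ε₀| ^ e * (C * ‖evalI Q m‖) * (Hn τ m / ‖evalI Q m‖) := by gcongr; exact hRQ m
      _ = _ := by have := (hq m).ne'; field_simp

end DenomBound

/-! ### The fixed point map. -/

/-- The right-hand side of the equation, without the term in `exp(α k τ^k)`, divided by `H`. -/
noncomputable def convMap (k α : ℝ) (Q Q₁ Q₂ RD : Polynomial ℂ) (s : Finset ℕ) (c : ℕ → ℂ)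
    (B : ℕ → (ℂ → ℝ → ℂ) → ℂ → ℝ → ℂ) (c₁₂ cf : ℂ) (ψ : ℂ → ℝ → ℂ) (w : ℂ → ℝ → ℂ) (τ : ℂ)
    (m : ℝ) : ℂ :=
  (∑ l ∈ s, c l * B l w τ m + c₁₂ * quadTerm k Q₁ Q₂ w τ m + cf * ψ τ m) / funH k α Q RD τ m

theorem isHC_funH {k α : ℝ} (Q RD : Polynomial ℂ) {S : Set ℂ} (hS : S ⊆ Complex.slitPlane) :
    IsHC S (funH k α Q RD) := by
  refine (IsHC.of_snd (continuous_evalI Q)).sub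
    ((IsHC.of_fst ?_).mul (IsHC.of_snd (continuous_evalI RD)))
  exact ((differentiableOn_const _).mul
    (differentiableOn_id.cpow (differentiableOn_const _) hS)).cexp

section Solution

variable {k ν β μ d δ ρ AH b A' α ε₀ : ℝ} {Q Q₁ Q₂ RD : Polynomial ℂ}

/-- For small coefficients, `convMap` is a contracting self-map of the unit ball. -/
theorem exists_convMap_contraction
    (hD : DenomBound k ν β μ d δ ρ AH b A' (fun m => ‖evalI Q m‖) fun τ m => ‖funH k α Q RD τ m‖)
    (hQ : ∀ m : ℝ, evalI Q m ≠ 0) (h1 : Q₁.natDegree ≤ Q.natDegree)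
    (h2 : Q₂.natDegree ≤ Q.natDegree) (hμ1 : (Q₁.natDegree : ℝ) + 1 < μ)
    (hμ2 : (Q₂.natDegree : ℝ) + 1 < μ) {s : Finset ℕ}
    {B : ℕ → ℂ → (ℂ → ℝ → ℂ) → ℂ → ℝ → ℂ}
    (hB : ∀ l ∈ s, IsLinOp (tauDomain d δ ρ) (weight ν β μ k) (fun τ m => ‖funH k α Q RD τ m‖)
      (Metric.ball (0 : ℂ) ε₀) (B l)) {ψ : ℂ → ℂ → ℝ → ℂ} {Lψ : ℝ} (hLψ : 0 < Lψ)
    (hψ : ∀ ε ∈ Metric.ball (0 : ℂ) ε₀, IsHC (tauDomain d δ ρ) (ψ ε) ∧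
      ∀ τ ∈ tauDomain d δ ρ, ∀ m, ‖ψ ε τ m‖ ≤ Lψ * weight ν β μ k τ m) :
    ∃ c₀ : ℝ, 0 < c₀ ∧ ∀ (c₁₂ cf : ℂ) (c : ℕ → ℂ), ‖c₁₂‖ ≤ c₀ → ‖cf‖ ≤ c₀ →
      (∀ l ∈ s, ‖c l‖ ≤ c₀) → ∀ ε ∈ Metric.ball (0 : ℂ) ε₀,
      (∀ w, InBall (tauDomain d δ ρ) (weight ν β μ k) 1 w →
        InBall (tauDomain d δ ρ) (weight ν β μ k) 1
          (convMap k α Q Q₁ Q₂ RD s c (fun l => B l ε) c₁₂ cf (ψ ε) w)) ∧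
      ∀ w w', InBall (tauDomain d δ ρ) (weight ν β μ k) 1 w →
        InBall (tauDomain d δ ρ) (weight ν β μ k) 1 w' → ∀ D : ℝ, 0 < D →
        (∀ τ ∈ tauDomain d δ ρ, ∀ m, ‖w τ m - w' τ m‖ ≤ D * weight ν β μ k τ m) →
        ∀ τ ∈ tauDomain d δ ρ, ∀ m,
          ‖convMap k α Q Q₁ Q₂ RD s c (fun l => B l ε) c₁₂ cf (ψ ε) w τ m -
            convMap k α Q Q₁ Q₂ RD s c (fun l => B l ε) c₁₂ cf (ψ ε) w' τ m‖ ≤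
            D / 2 * weight ν β μ k τ m := by
  set S := tauDomain d δ ρ with hSdef
  have hS : IsConic S := isConic_tauDomain d δ ρ
  have hSo : IsOpen S := hD.isOpen
  have hk0 : 0 < k := by linarith [hD.hk]
  have hν0 : 0 ≤ ν := by linarith [hD.hν]
  have hW : ∀ τ ∈ S, ∀ m, 0 ≤ weight ν β μ k τ m := fun τ _ m => weight_nonneg τ m
  obtain ⟨Llin, hLlin, hlin⟩ := IsLinOp.sum_mul hW (fun τ _ m => norm_nonneg _) hB
  obtain ⟨Lq, G, hLq, hG, hG0, hGb, hquad⟩ :=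
    exists_quadBi_bound (ν := ν) (S := S) hk0 hS hD.hβ.le hQ h1 h2 hμ1 hμ2
  obtain ⟨cQ, hcQ, hcQb⟩ := exists_norm_evalI_ge hQ
  obtain ⟨A₀, hA₀⟩ : ∃ A₀, A₀ = min AH A' := ⟨_, rfl⟩
  have hA₀0 : 0 < A₀ := hA₀ ▸ lt_min hD.hAH hD.hA'
  have hQH : ∀ τ ∈ S, ∀ m, ‖evalI Q m‖ ≤ ‖funH k α Q RD τ m‖ / A₀ := fun τ hτ m => by
    rw [le_div_iff₀ hA₀0, mul_comm, hA₀]; exact hD.min_mul_le τ hτ m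
  have hHpos : ∀ τ ∈ S, ∀ m, 0 < ‖funH k α Q RD τ m‖ := fun τ hτ m => by
    have h3 := hQH τ hτ m
    have h4 := norm_pos_iff.2 (hQ m)
    rw [le_div_iff₀ hA₀0] at h3
    exact lt_of_lt_of_le (by positivity) h3
  have h1H : ∀ τ ∈ S, ∀ m, 1 ≤ ‖funH k α Q RD τ m‖ / (A₀ * cQ) := fun τ hτ m => by
    have h3 := hQH τ hτ m
    have h4 : cQ ≤ ‖evalI Q m‖ := (le_mul_of_one_le_right hcQ.le
      (one_le_pow₀ (by linarith [abs_nonneg m]))).trans (hcQb m)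
    rw [le_div_iff₀ hA₀0] at h3
    rw [le_div_iff₀ (by positivity), one_mul]
    nlinarith
  obtain ⟨Kq, hKq⟩ : ∃ Kq, Kq = Lq / A₀ := ⟨_, rfl⟩
  obtain ⟨Kψ, hKψ⟩ : ∃ Kψ, Kψ = Lψ / (A₀ * cQ) := ⟨_, rfl⟩
  have hKq0 : 0 < Kq := by rw [hKq]; positivity
  have hKψ0 : 0 < Kψ := by rw [hKψ]; positivity
  have hquad' : ∀ (w v : ℂ → ℝ → ℂ) (C C' : ℝ), 0 ≤ C → 0 ≤ C' →
      (∀ τ ∈ S, ∀ m, ‖w τ m‖ ≤ C * weight ν β μ k τ m) →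
      (∀ τ ∈ S, ∀ m, ‖v τ m‖ ≤ C' * weight ν β μ k τ m) →
      ∀ τ ∈ S, ∀ m, ‖quadBi k Q₁ Q₂ w v τ m‖ ≤
        Kq * (C * C') * weight ν β μ k τ m * ‖funH k α Q RD τ m‖ := by
    intro w v C C' hC hC' hw hv τ hτ m
    refine (hquad w v C C' hC hC' hw hv τ hτ m).trans ?_
    have h3 := hW τ hτ m
    calc _ ≤ Lq * (C * C') * weight ν β μ k τ m * (‖funH k α Q RD τ m‖ / A₀) := by
          gcongr; exact hQH τ hτ m
      _ = _ := by rw [hKq]; ring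
  have hψ' : ∀ ε ∈ Metric.ball (0 : ℂ) ε₀, ∀ τ ∈ S, ∀ m, ‖ψ ε τ m‖ ≤
      Kψ * weight ν β μ k τ m * ‖funH k α Q RD τ m‖ := by
    intro ε hε τ hτ m
    have h3 := hW τ hτ m
    calc _ ≤ Lψ * weight ν β μ k τ m := (hψ ε hε).2 τ hτ m
      _ ≤ Lψ * weight ν β μ k τ m * (‖funH k α Q RD τ m‖ / (A₀ * cQ)) :=
          le_mul_of_one_le_right (by positivity) (h1H τ hτ m)
      _ = _ := by rw [hKψ]; ring
  have hqt : ∀ w, InBall S (weight ν β μ k) 1 w → ∀ τ ∈ S, ∀ m,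
      quadTerm k Q₁ Q₂ w τ m = quadBi k Q₁ Q₂ w w τ m := fun w hw τ hτ m =>
    quadTerm_eq_quadBi hk0 hD.hk1 (hS.ne_zero hτ) m
      (integrable_quadKernel hk0 hS zero_le_one zero_le_one hG hGb hw.1 hw.1 hw.2 hw.2 hτ m)
  -- The quadratic constant counts twice because a difference of squares splits into two bilinear
  -- terms. Coefficients of modulus at most 1/(2K) send the unit ball into the ball of radius 1/2
  -- and give contraction ratio 1/2.
  obtain ⟨K, hK⟩ : ∃ K, K = Llin + 2 * Kq + Kψ := ⟨_, rfl⟩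
  have hK0 : 0 < K := by rw [hK]; positivity
  refine ⟨1 / (2 * K), by positivity, fun c₁₂ cf c hc₁₂ hcf hc ε hε => ⟨fun w hw => ⟨?_, ?_⟩, ?_⟩⟩
  · have hq : IsHC S (quadTerm k Q₁ Q₂ w) :=
      (IsHC.quadBi hSo hS hk0 hν0 zero_le_one zero_le_one hG hG0 hGb hw.1 hw.1 hw.2 hw.2).congr
        (hqt w hw)
    exact ((((hlin _ c hc ε hε).1 w 1 one_pos hw).1.add ((IsHC.const _).mul hq)).add
      ((IsHC.const _).mul (hψ ε hε).1)).div (isHC_funH Q RD hD.subset_slitPlane)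
      fun τ hτ m => norm_pos_iff.1 (hHpos τ hτ m)
  · intro τ hτ m
    have e1 := ((hlin _ c hc ε hε).1 w 1 one_pos hw).2 τ hτ m
    have e2 := hquad' w w 1 1 zero_le_one zero_le_one hw.2 hw.2 τ hτ m
    have e3 := hψ' ε hε τ hτ m
    have hw0 := hW τ hτ m
    rw [convMap, norm_div, div_le_iff₀ (hHpos τ hτ m), hqt w hw τ hτ m]
    have hWH : 0 ≤ weight ν β μ k τ m * ‖funH k α Q RD τ m‖ := by positivity
    calc _ ≤ 1 / (2 * K) * Llin * 1 * weight ν β μ k τ m * ‖funH k α Q RD τ m‖ +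
          1 / (2 * K) * (Kq * (1 * 1) * weight ν β μ k τ m * ‖funH k α Q RD τ m‖) +
          1 / (2 * K) * (Kψ * weight ν β μ k τ m * ‖funH k α Q RD τ m‖) := by
          refine (norm_add₃_le).trans (add_le_add_three e1 ?_ ?_)
          · rw [norm_mul]; exact mul_le_mul hc₁₂ e2 (norm_nonneg _) (by positivity)
          · rw [norm_mul]; exact mul_le_mul hcf e3 (norm_nonneg _) (by positivity)
      _ = 1 / (2 * K) * (Llin + Kq + Kψ) *
          (weight ν β μ k τ m * ‖funH k α Q RD τ m‖) := by ring
      _ ≤ 1 * (weight ν β μ k τ m * ‖funH k α Q RD τ m‖) := by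
          refine mul_le_mul_of_nonneg_right ?_ hWH
          rw [div_mul_eq_mul_div, one_mul, div_le_one (by positivity)]
          linarith
      _ = _ := by ring
  · intro w w' hw hw' D hDpos hww' τ hτ m
    have hdiff : InBall S (weight ν β μ k) D fun τ m => w τ m - w' τ m := ⟨hw.1.sub hw'.1, hww'⟩
    have e1 := ((hlin _ c hc ε hε).1 _ D hDpos hdiff).2 τ hτ m
    have e2 := hquad' _ w D 1 hDpos.le zero_le_one hww' hw.2 τ hτ m
    have e3 := hquad' w' _ 1 D zero_le_one hDpos.le hw'.2 hww' τ hτ m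
    have hw0 := hW τ hτ m
    have hWH : 0 ≤ weight ν β μ k τ m * ‖funH k α Q RD τ m‖ := by positivity
    have hsub : ∑ l ∈ s, c l * B l ε w τ m + c₁₂ * quadTerm k Q₁ Q₂ w τ m + cf * ψ ε τ m -
        (∑ l ∈ s, c l * B l ε w' τ m + c₁₂ * quadTerm k Q₁ Q₂ w' τ m + cf * ψ ε τ m) =
        ∑ l ∈ s, c l * B l ε (fun τ m => w τ m - w' τ m) τ m +
          c₁₂ * quadBi k Q₁ Q₂ (fun τ m => w τ m - w' τ m) w τ m +
          c₁₂ * quadBi k Q₁ Q₂ w' (fun τ m => w τ m - w' τ m) τ m := by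
      have e4 := quadBi_sub (Q₁ := Q₁) (Q₂ := Q₂) hk0 hS zero_le_one hDpos.le hG hGb hw.1 hw'.1
        hw.2 hw'.2 hww' hτ m
      rw [hqt w hw τ hτ m, hqt w' hw' τ hτ m, (hlin _ c hc ε hε).2 w w' 1 one_pos hw hw' τ hτ m]
      linear_combination c₁₂ * e4
    rw [convMap, convMap, ← sub_div, hsub, norm_div, div_le_iff₀ (hHpos τ hτ m)]
    calc _ ≤ 1 / (2 * K) * Llin * D * weight ν β μ k τ m * ‖funH k α Q RD τ m‖ +
          1 / (2 * K) * (Kq * (D * 1) * weight ν β μ k τ m * ‖funH k α Q RD τ m‖) +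
          1 / (2 * K) * (Kq * (1 * D) * weight ν β μ k τ m * ‖funH k α Q RD τ m‖) := by
          refine (norm_add₃_le).trans (add_le_add_three e1 ?_ ?_)
          · rw [norm_mul]; exact mul_le_mul hc₁₂ e2 (norm_nonneg _) (by positivity)
          · rw [norm_mul]; exact mul_le_mul hc₁₂ e3 (norm_nonneg _) (by positivity)
      _ = 1 / (2 * K) * (Llin + 2 * Kq) * (D *
          (weight ν β μ k τ m * ‖funH k α Q RD τ m‖)) := by ring
      _ ≤ 1 / 2 * (D * (weight ν β μ k τ m * ‖funH k α Q RD τ m‖)) := by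
          refine mul_le_mul_of_nonneg_right ?_ (by positivity)
          rw [div_mul_eq_mul_div, one_mul, div_le_div_iff₀ (by positivity) (by positivity)]
          linarith
      _ = _ := by ring

end Solution

/-! ### The proposition. -/

theorem proposition4
    (k ν : ℝ) (hk : 1 / 2 < k) (hk1 : k < 1) (hν : 1 < ν) :
    -- existence of the constant `K₁`, attached to `k` and `ν`
    (∃ K₁ : ℝ, IsExpOpBound k ν K₁) ∧
    ∀ (K₁ : ℝ) (_ : IsExpOpBound k ν K₁)
      -- the equation
      (D : ℕ) (_ : 2 ≤ D) (α : ℝ) (_ : 0 < α)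
      (dl δl Δl : ℕ → ℕ) (κ : ℕ → ℝ)
      (_ : ∀ l, 1 ≤ l → l ≤ D - 1 → 0 < κ l)
      (_ : δl 1 = 1) (_ : ∀ l, 1 ≤ l → l + 1 ≤ D - 1 → δl l < δl (l + 1))
      (_ : ∀ l, 1 ≤ l → l ≤ D - 1 → (δl l : ℝ) * (k + 1) < (dl l : ℝ))
      (_ : ∀ l, 1 ≤ l → l ≤ D - 1 → dl l ≤ Δl l + δl l)
      (Q Q₁ Q₂ : Polynomial ℂ) (R : ℕ → Polynomial ℂ)
      (_ : Q.natDegree = (R D).natDegree)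
      (_ : ∀ l, 1 ≤ l → l ≤ D - 1 → (R l).natDegree ≤ (R D).natDegree)
      (_ : Q₁.natDegree ≤ (R D).natDegree) (_ : Q₂.natDegree ≤ (R D).natDegree)
      (_ : ∀ m : ℝ, evalI Q m ≠ 0) (_ : ∀ m : ℝ, evalI (R D) m ≠ 0)
      -- the coefficients and the forcing term
      (β μ ε₀ K₀ T₀ : ℝ) (_ : 0 < β)
      (_ : max ((Q₁.natDegree : ℝ) + 1) ((Q₂.natDegree : ℝ) + 1) < μ)
      (_ : 0 < ε₀) (_ : 0 < K₀) (_ : 0 < T₀)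
      (F : ℕ → ℝ → ℂ → ℂ)
      (_ : ∀ n, 1 ≤ n → ∀ ε ∈ Metric.ball (0 : ℂ) ε₀, MemE β μ (fun m => F n m ε))
      (_ : ∀ n, 1 ≤ n → ∀ m : ℝ, DifferentiableOn ℂ (F n m) (Metric.ball (0 : ℂ) ε₀))
      (_ : ∀ n, 1 ≤ n → ∀ ε ∈ Metric.ball (0 : ℂ) ε₀,
        normE β μ (fun m => F n m ε) ≤ K₀ * (1 / T₀) ^ n)
      (I : ℕ → Finset ℕ) (A : ℕ → ℕ → ℂ → ℂ)
      (_ : ∀ l, 1 ≤ l → l ≤ D - 1 → ∀ n ∈ I l,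
        DifferentiableOn ℂ (A l n) (Metric.ball (0 : ℂ) ε₀) ∧
        ∃ M : ℝ, ∀ ε ∈ Metric.ball (0 : ℂ) ε₀, ‖A l n ε‖ ≤ M)
      -- the exponential type `ν` is large enough with respect to `T₀`
      (_ : (1 / T₀) ^ k < ν)
      -- `Q(im)/R_D(im)` stays in a sectorial annulus outside the closed unit disc
      (r₁ r₂ dQ ηQ : ℝ) (_ : 1 < r₁) (_ : r₁ < r₂) (_ : 0 < ηQ)
      (_ : ∀ m : ℝ, evalI Q m / evalI (R D) m ∈ sectorialAnnulus r₁ r₂ dQ ηQ)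
      -- the sector and the disc, with a margin, avoid all the points `τ_l`
      (d δ δ' ρ ρ' : ℝ) (_ : -(Real.pi / 2) < d) (_ : d < Real.pi / 2)
      (_ : 0 < δ) (_ : δ < δ') (_ : 0 < ρ) (_ : ρ < ρ')
      (_ : ∀ (l : ℤ) (m : ℝ),
        rootTau k α Q (R D) l m ∉ sector d δ' ∪ Metric.ball (0 : ℂ) ρ'),
      -- existence of the constants `A_{H,d}`, `B_{H,d}`
      (∃ AH BH : ℝ, 0 < AH ∧ 0 < BH ∧ ∀ τ ∈ sector d δ, ∀ m : ℝ,
        AH * ‖evalI Q m‖ * Real.exp (BH * α * ‖τ‖ ^ k) ≤ ‖funH k α Q (R D) τ m‖) ∧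
      ∀ (AH BH : ℝ) (_ : 0 < AH) (_ : 0 < BH)
        (_ : ∀ τ ∈ sector d δ, ∀ m : ℝ,
          AH * ‖evalI Q m‖ * Real.exp (BH * α * ‖τ‖ ^ k) ≤ ‖funH k α Q (R D) τ m‖)
        (_ : ∀ l, 1 ≤ l → l ≤ D - 1 → κ l * K₁ * (k / Real.Gamma (1 / k - 1)) < BH * α),
        ∃ c₀ : ℝ, 0 < c₀ ∧
          ∀ (c₁₂ cf : ℂ) (c : ℕ → ℂ), ‖c₁₂‖ ≤ c₀ → ‖cf‖ ≤ c₀ →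
            (∀ l, 1 ≤ l → l ≤ D - 1 → ‖c l‖ ≤ c₀) →
            ∃ ϖ : ℝ, 0 < ϖ ∧ ∀ ε ∈ Metric.ball (0 : ℂ) ε₀,
              ∃ w : ℂ → ℝ → ℂ,
                (MemF ν β μ k d δ ρ w ∧ normF ν β μ k d δ ρ w ≤ ϖ ∧
                  SolvesConvEq k α D Q Q₁ Q₂ R dl δl Δl κ I A F c₁₂ cf c d δ ρ ε w) ∧
                ∀ w' : ℂ → ℝ → ℂ,
                  MemF ν β μ k d δ ρ w' → normF ν β μ k d δ ρ w' ≤ ϖ →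
                  SolvesConvEq k α D Q Q₁ Q₂ R dl δl Δl κ I A F c₁₂ cf c d δ ρ ε w' →
                  ∀ τ ∈ tauDomain d δ ρ, ∀ m : ℝ, w' τ m = w τ m := by
  have hk0 : 0 < k := by linarith
  have hν0 : 0 < ν := by linarith
  refine ⟨exists_isExpOpBound hk0 hk1 hν0, ?_⟩
  intro K₁ hK₁ D hD2 α hα dl δl Δl κ hκ hδ1 hδmono hdl _ Q Q₁ Q₂ R hQdeg hRdeg hQ₁deg hQ₂deg hQ hR
    β μ ε₀ K₀ T₀ hβ hμ hε₀ hK₀ hT₀ F hF _ hFn I A hA hνT r₁ r₂ dQ ηQ hr₁ hr₁₂ _ hann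
    d δ δ' ρ ρ' hd hd2 hδ hδδ' hρ hρρ' hτ
  have hμ1 : (Q₁.natDegree : ℝ) + 1 < μ := (le_max_left _ _).trans_lt hμ
  have hμ2 : (Q₂.natDegree : ℝ) + 1 < μ := (le_max_right _ _).trans_lt hμ
  have hμ0 : 1 < μ := by linarith [Q₁.natDegree.cast_nonneg (α := ℝ)]
  have hnorm : ∀ m, r₁ ≤ ‖evalI Q m / evalI (R D) m‖ ∧ ‖evalI Q m / evalI (R D) m‖ ≤ r₂ := by
    intro m
    obtain ⟨r, θ, h1, h2, -, h3⟩ := hann m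
    have : ‖evalI Q m / evalI (R D) m‖ = r := by
      rw [h3, mul_comm Complex.I, norm_mul, Complex.norm_exp_ofReal_mul_I, mul_one,
        Complex.norm_real, Real.norm_of_nonneg (by linarith)]
    rw [this]; exact ⟨h1, h2⟩
  have hgt : ∀ m, 1 < ‖evalI Q m / evalI (R D) m‖ := fun m => hr₁.trans_le (hnorm m).1
  have hρ'0 : 0 < ρ' := hρ.trans hρρ'
  have hroot := fun (l : ℤ) (m : ℝ) =>
    rootA_of_rootTau_notMem hk hα hρ'0.le (hgt m) (hτ l m)
  -- A single value of m suffices: the points τ_l(0), over all l, already limit the aperture.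
  have hap' : k * (|d| + δ') ≤ Real.pi / 2 :=
    sector_aperture_lt (m := 0) hk hk1 hd hd2 (hδ.trans hδδ') (hgt 0) fun l => (hroot l 0).1
  have hap : k * (|d| + δ) < Real.pi / 2 := by nlinarith
  -- Since k > 1/2, |d| + δ < π/(2k) < π, so the closed negative half-axis is avoided.
  have hapi : |d| + δ < Real.pi := by nlinarith [abs_nonneg d]
  obtain ⟨A', hA', hcut⟩ := exists_norm_funH_ge_cutDisc hk hα hQ hR hρ hρρ'
    fun l m => (hroot l m).2
  constructor
  · obtain ⟨A₁, hA₁, hsec⟩ := exists_norm_funH_ge_sector hk hk1 hα hQ hR hd hd2 hδ hδδ' hρ'0 hap'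
      hgt hroot
    exact exists_norm_funH_ge_exp hk hα hQ hR hap (fun m => (hnorm m).2) hgt hA₁ hsec
  intro AH BH hAH hBH hL hκB
  have hDB : DenomBound k ν β μ d δ ρ AH (BH * α) A' (fun m => ‖evalI Q m‖)
      fun τ m => ‖funH k α Q (R D) τ m‖ :=
    ⟨hk, hk1, hν, hβ, hμ0, hδ, hρ, hapi, hAH, hA', mul_pos hBH hα, fun m => norm_nonneg _, hL, hcut⟩
  -- δ_l ≥ 1 ensures that s^{δ_l}/s is not singular at 0.
  have hδl : ∀ l, 1 ≤ l → l ≤ D - 1 → 1 ≤ δl l := by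
    intro l hl
    induction l, hl using Nat.le_induction with
    | base => exact fun _ => hδ1.ge
    | succ l hl ih => exact fun h => (ih (by omega)).trans (hδmono l hl h).le
  obtain ⟨Lψ, hLψ, hψ⟩ := exists_psi_bound (S := tauDomain d δ ρ) hDB.isOpen
    (isConic_tauDomain d δ ρ) hk0 hk1 hβ.le (by linarith) hK₀ hT₀ hνT hF hFn
  obtain ⟨c₀, hc₀, hmain⟩ := exists_convMap_contraction hDB hQ (hQ₁deg.trans hQdeg.ge)
    (hQ₂deg.trans hQdeg.ge) hμ1 hμ2 (s := Finset.Icc 1 (D - 1)) (ε₀ := ε₀)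
    (B := fun l ε w τ m => ε ^ (Δl l + δl l - dl l) * evalI (R l) m * ∑ n ∈ I l, A l n ε *
      bracket k (κ l) ((dl l : ℝ) - (δl l : ℝ) * (k + 1)) (δl l) n w τ m)
    (fun l hl => by
      obtain ⟨hl1, hl2⟩ := Finset.mem_Icc.1 hl
      exact hDB.isLinOp_summand hQ ((hRdeg l hl1 hl2).trans hQdeg.ge) (hκ l hl1 hl2) hK₁
        (hκB l hl1 hl2) (sub_pos.2 (hdl l hl1 hl2)) (hδl l hl1 hl2)
        (fun n hn => (hA l hl1 hl2 n hn).2) _) hLψ hψ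
  refine ⟨c₀, hc₀, fun c₁₂ cf c hc₁₂ hcf hc => ⟨1, one_pos, fun ε hε => ?_⟩⟩
  obtain ⟨hself, hcontr⟩ := hmain c₁₂ cf c hc₁₂ hcf
    (fun l hl => hc l (Finset.mem_Icc.1 hl).1 (Finset.mem_Icc.1 hl).2) ε hε
  have hH0 : ∀ τ ∈ tauDomain d δ ρ, ∀ m, funH k α Q (R D) τ m ≠ 0 := by
    intro τ hτ m
    have h1 := hDB.min_mul_le τ hτ m
    exact norm_pos_iff.1 (lt_of_lt_of_le
      (mul_pos (lt_min hAH hA') (norm_pos_iff.2 (hQ m))) h1)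
  -- the equation is the fixed point equation of `convMap`
  have hiff : ∀ w : ℂ → ℝ → ℂ,
      SolvesConvEq k α D Q Q₁ Q₂ R dl δl Δl κ I A F c₁₂ cf c d δ ρ ε w ↔
      ∀ τ ∈ tauDomain d δ ρ, ∀ m, convMap k α Q Q₁ Q₂ (R D) (Finset.Icc 1 (D - 1)) c
        (fun l w τ m => ε ^ (Δl l + δl l - dl l) * evalI (R l) m * ∑ n ∈ I l, A l n ε *
          bracket k (κ l) ((dl l : ℝ) - (δl l : ℝ) * (k + 1)) (δl l) n w τ m) c₁₂ cf
        (fun τ m => psi k F τ m ε) w τ m = w τ m := by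
    intro w
    refine forall₃_congr fun τ hτ m => ?_
    have hsum : ∑ l ∈ Finset.Icc 1 (D - 1), ε ^ (Δl l + δl l - dl l) * evalI (R l) m * c l *
        ∑ n ∈ I l, A l n ε *
          bracket k (κ l) ((dl l : ℝ) - (δl l : ℝ) * (k + 1)) (δl l) n w τ m =
        ∑ l ∈ Finset.Icc 1 (D - 1), c l * (ε ^ (Δl l + δl l - dl l) * evalI (R l) m *
        ∑ n ∈ I l, A l n ε *
          bracket k (κ l) ((dl l : ℝ) - (δl l : ℝ) * (k + 1)) (δl l) n w τ m) :=
      Finset.sum_congr rfl fun l _ => by ring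
    rw [convMap, div_eq_iff (hH0 τ hτ m), hsum, funH]
    constructor <;> intro h <;> linear_combination -h
  obtain ⟨w, hw, hfix⟩ := exists_fixedPoint_of_contraction hDB.isOpen
    (fun τ _ m => weight_nonneg τ m)
    (fun R => (weight_locBdd hk0 hν0 hβ.le (by linarith) R).imp fun C hC τ _ => hC τ) hself hcontr
  obtain ⟨hw1, hw2⟩ := hw.memF
  refine ⟨w, ⟨hw1, hw2, (hiff w).2 hfix⟩, fun w' hw'1 hw'2 hw'3 => ?_⟩
  exact unique_fixedPoint_of_contraction hcontr
    (hw'1.inBall hk0 hν0 hβ.le (by linarith) hδ hρ hapi hw'2) hw ((hiff w').1 hw'3) hfix
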